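/- Let $A_1,\dots,A_k\subset\mathbb Z^n$ be non-empty finite sets, and let $E_i=E_{A_i}$ be the space of Laurent polynomials on $(\mathbb C^*)^n$ with support in $A_i$. Notation. For $J\subset\{1,\dots,k\}$ let $E_J=\prod_{i\in J}E_i$ be the span of all products of members of the $E_i$, $i\in J$ (with $E_\varnothing=\mathbb C$), let $\Phi_J:(\mathbb C^*)^n\to\mathbb P(E_J^*)$ be the Kodaira map, which sends $x$ to the hyperplane of all $f\in E_J$ with $f(x)=0$, and let $\tau_J$ be the dimension of its image. The (geometric) defect of $J$ is $\operatorname{def}(E_J)=\tau_J-|J|$. The collection $J$ is essential if $\operatorname{def}(E_J)\le\operatorname{def}(E_I)$ for all $I\subset\{1,\dots,k\}$ and $\operatorname{def}(E_I)>\operatorname{def}(E_J)$ for all proper subsets $I\subsetneq J$. Let $L(A_i)\subset\mathbb R^n$ be the vector subspace parallel to the affine span of $A_i$, let $L(J)$ be the vector subspace parallel to the affine span of the Minkowski sum $\sum_{i\in J}A_i$ (which is $\{0\}$ if $J=\varnothing$), let $\Lambda(J)=L(J)\cap\mathbb Z^n$, let $\pi_J:\mathbb R^n\to\mathbb R^n/L(J)$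 be the projection, so that $\pi_J(\mathbb Z^n)=\mathbb Z^n/\Lambda(J)$, and let $G_J\subset\Lambda(J)$ be the group generated by all differences $a-b$ with $a,b\in A_i$, $i\in J$. The consistency variety $R$ is the Zariski closure in $\mathbf E=E_1\times\dots\times E_k$ of the set of all systems $\mathbf s=(s_1,\dots,s_k)$ that have a common zero in $(\mathbb C^*)^n$, and $Z_{\mathbf s}\subset(\mathbb C^*)^n$ is the zero set of $\mathbf s$. Let $T_J=\operatorname{Hom}(\mathbb Z^n/\Lambda(J),\mathbb C^*)$, regarded as a closed subtorus of $(\mathbb C^*)^n=\operatorname{Hom}(\mathbb Z^n,\mathbb C^*)$; a finite set $B\subset\mathbb Z^n/\Lambda(J)$ defines the space $E_B$ of Laurent polynomials on $T_J$ with support in $B$. Let $J$ be an essential subcollection. Then: (i) For every $I\subset\{1,\dots,k\}$, in particular for $I=J$, the geometric defect equals the defect of the collection of vector subspaces $(L(A_i))_{i\in I}$: $$\tau_I-|I|=\dim\Big(\sum_{i\in I}L(A_i)\Big)-|I|.$$ (ii) The index of $G_J$ in $\Lambda(J)$ is finite, and every non-empty fibre of $\Phi_J$ has the same number $ind(J)$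 of connected components, namely $ind(J)=[\Lambda(J):G_J]$. (iii) For generic $\mathbf s\in R$ the zero set $Z_{\mathbf s}$ is a disjoint union of $ind(J)$ closed subvarieties, each of which is given by a generic system with supports $\pi_J(A_i)$, $i\notin J$. Precisely: for every non-empty Zariski open set $W\subset\prod_{i\notin J}E_{\pi_J(A_i)}$ there is a Zariski open set $U\subset\mathbf E$ such that $R\cap U$ is dense in $R$ and such that for every $\mathbf s\in R\cap U$ there are pairwise disjoint closed sets $Y_1,\dots,Y_{ind(J)}$ with $Z_{\mathbf s}=Y_1\cup\dots\cup Y_{ind(J)}$, where for every $j$ there are a point $t\in(\mathbb C^*)^n$ and a system $g=(g_i)_{i\notin J}\in W$ with $g_i(y)=s_i(ty)$ for all $y\in T_J$ and $i\notin J$, and $Y_j=t\cdot\{y\in T_J : g_i(y)=0\text{ for all }i\notin J\}$. -/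

import Mathlib

open scoped Pointwise Topology LinearAlgebra.Projectivization

noncomputable section

namespace ToricSystems

/-! ### Zariski topologies -/

/-- The Zariski topology on a complex vector space `V`: a basis of open sets is given by the
non-vanishing loci of polynomials in the linear functions on `V`. -/
abbrev zariski (V : Type*) [AddCommGroup V] [Module ℂ V] : TopologicalSpace V :=
  TopologicalSpace.generateFrom
    {D | ∃ p : MvPolynomial (Module.Dual ℂ V) ℂ, D = {v | p.eval (fun l => l v) ≠ 0}}

/-- The Zariski topology on the projective space `ℙ(V)`: a basis of open sets is given by the
non-vanishing loci of homogeneous polynomials in the linear functions on `V`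
(for homogeneous `p`, non-vanishing does not depend on the representative). -/
abbrev zariskiProj (V : Type*) [AddCommGroup V] [Module ℂ V] : TopologicalSpace (ℙ ℂ V) :=
  TopologicalSpace.generateFrom
    {D | ∃ (p : MvPolynomial (Module.Dual ℂ V) ℂ) (d : ℕ), p.IsHomogeneous d ∧
      D = {q | p.eval (fun l => l q.rep) ≠ 0}}

/-- The (Krull) dimension of a subset `Y` of a topological space, with the subspace topology. -/
def dimension {X : Type*} (t : TopologicalSpace X) (Y : Set X) : WithBot ℕ∞ :=
  letI := t
  topologicalKrullDim Y

/-- The number of connected components of a subset `Y` of a topological space (subspace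
topology); it is `0` if there are infinitely many. -/
def numComponents {X : Type*} (t : TopologicalSpace X) (Y : Set X) : ℕ :=
  letI := t
  Nat.card (ConnectedComponents Y)

/-! ### Tori and Laurent polynomials -/

/-- The torus `Hom(M, ℂˣ)` with character lattice `M`. -/
abbrev LatticeTorus (M : Type*) [AddCommGroup M] := AddChar M ℂˣ

/-- The value `f(y) = ∑ a, f_a y(a)` of a Laurent polynomial `f` with exponents in the lattice `M`
at a point `y` of the torus `Hom(M, ℂˣ)`, as an algebra homomorphism in `f`. -/
def evalAt {M : Type*} [AddCommGroup M] (y : LatticeTorus M) : AddMonoidAlgebra ℂ M →ₐ[ℂ] ℂ :=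
  AddMonoidAlgebra.lift ℂ ℂ M ((Units.coeHom ℂ).comp y.toMonoidHom)

/-- The point of `Hom(ℤⁿ, ℂˣ)` given by `x ∈ (ℂˣ)ⁿ`: it sends `a` to the monomial
`x ^ a = x₁ ^ a₁ ⋯ xₙ ^ aₙ`. -/
def monomialChar {n : ℕ} (x : Fin n → ℂˣ) : LatticeTorus (Fin n → ℤ) where
  toFun a := ∏ i, x i ^ a i
  map_zero_eq_one' := by simp
  map_add_eq_mul' a b := by simp [zpow_add, Finset.prod_mul_distrib]

/-- Evaluation of a Laurent polynomial in `n` variables at a point of `(ℂˣ)ⁿ`. -/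
def evalLaurent {n : ℕ} (x : Fin n → ℂˣ) : AddMonoidAlgebra ℂ (Fin n → ℤ) →ₐ[ℂ] ℂ :=
  evalAt (monomialChar x)

theorem evalLaurent_apply {n : ℕ} (x : Fin n → ℂˣ) (f : AddMonoidAlgebra ℂ (Fin n → ℤ)) :
    evalLaurent x f = f.coeff.sum fun a c => c * ∏ i, (x i : ℂ) ^ a i := by
  simp [evalLaurent, evalAt, monomialChar, AddMonoidAlgebra.lift_apply']

/-- The Zariski topology on `(ℂˣ)ⁿ`: the regular functions are the Laurent polynomials. -/
abbrev zariskiTorus (n : ℕ) : TopologicalSpace (Fin n → ℂˣ) :=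
  TopologicalSpace.generateFrom
    {D | ∃ f : AddMonoidAlgebra ℂ (Fin n → ℤ), D = {x | evalLaurent x f ≠ 0}}

/-! ### Linear series on the torus and Kodaira maps -/

/-- The space `E_A` of Laurent polynomials with support in `A`. -/
abbrev laurentSpace {M : Type*} [AddCommGroup M] (A : Set M) :
    Submodule ℂ (AddMonoidAlgebra ℂ M) :=
  AddMonoidAlgebra.supported ℂ ℂ A

/-- The space of systems `E_{A_1} × ⋯ × E_{A_k}`. -/
abbrev Systems {ι M : Type*} [AddCommGroup M] (A : ι → Set M) := ∀ i, laurentSpace (A i)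

/-- A linear series on the torus is base-point free if its members have no common zero. -/
def BasePointFree {n : ℕ} (E : Submodule ℂ (AddMonoidAlgebra ℂ (Fin n → ℤ))) : Prop :=
  ∀ x : Fin n → ℂˣ, ∃ f ∈ E, evalLaurent x f ≠ 0

/-- The Kodaira map `Φ_E : (ℂˣ)ⁿ → ℙ(E*)` of a base-point free linear series. The point `Φ_E(x)`
is the class of the evaluation functional at `x`, i.e. the hyperplane of all `f ∈ E` that vanish
at `x`. -/
def kodairaMap {n : ℕ} (E : Submodule ℂ (AddMonoidAlgebra ℂ (Fin n → ℤ))) (hE : BasePointFree E)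
    (x : Fin n → ℂˣ) : ℙ ℂ (Module.Dual ℂ E) :=
  Projectivization.mk ℂ ((evalLaurent x).toLinearMap ∘ₗ E.subtype) (by
    obtain ⟨f, hf, h⟩ := hE x
    intro h0
    exact h (by simpa using LinearMap.congr_fun h0 ⟨f, hf⟩))

/-- The product `E_J = ∏_{j ∈ J} E_{A_j}`: the span of all products of members of the factors. -/
def productSeries {n k : ℕ} (A : Fin k → Finset (Fin n → ℤ)) (J : Finset (Fin k)) :
    Submodule ℂ (AddMonoidAlgebra ℂ (Fin n → ℤ)) :=
  ∏ j ∈ J, laurentSpace (A j : Set (Fin n → ℤ))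

theorem productSeries_basePointFree {n k : ℕ} (A : Fin k → Finset (Fin n → ℤ))
    (hA : ∀ i, (A i).Nonempty) (J : Finset (Fin k)) : BasePointFree (productSeries A J) := by
  classical
  intro x
  choose a ha using hA
  have key : ∏ j ∈ J, (AddMonoidAlgebra.single (a j) (1 : ℂ)) ∈ productSeries A J := by
    unfold productSeries
    induction J using Finset.induction_on with
    | empty =>
      rw [Finset.prod_empty, Finset.prod_empty]
      exact Submodule.one_le.1 le_rfl
    | insert i s hi ih =>
      rw [Finset.prod_insert hi, Finset.prod_insert hi]
      refine Submodule.mul_mem_mul ?_ ih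
      rw [AddMonoidAlgebra.mem_supported']
      intro m hm
      have : a i ≠ m := fun h => hm (h ▸ by exact_mod_cast ha i)
      simp [this]
  refine ⟨_, key, ?_⟩
  rw [map_prod]
  refine Finset.prod_ne_zero_iff.2 fun j _ => ?_
  simp [evalLaurent, evalAt]

/-- The Kodaira map `Φ_J` of the product `E_J`. -/
def kodaira {n k : ℕ} (A : Fin k → Finset (Fin n → ℤ)) (hA : ∀ i, (A i).Nonempty)
    (J : Finset (Fin k)) : (Fin n → ℂˣ) → ℙ ℂ (Module.Dual ℂ (productSeries A J)) :=
  kodairaMap (productSeries A J) (productSeries_basePointFree A hA J)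

/-- The dimension of the image `Y_J` of the Kodaira map `Φ_J`. -/
def kodairaDim {n k : ℕ} (A : Fin k → Finset (Fin n → ℤ)) (hA : ∀ i, (A i).Nonempty)
    (J : Finset (Fin k)) : WithBot ℕ∞ :=
  dimension (zariskiProj _) (Set.range (kodaira A hA J))

/-- The number `τ_J = dim Y_J`, as a natural number. -/
def tau {n k : ℕ} (A : Fin k → Finset (Fin n → ℤ)) (hA : ∀ i, (A i).Nonempty)
    (J : Finset (Fin k)) : ℕ :=
  ((kodairaDim A hA J).unbotD 0).toNat

/-- The geometric defect `def(E_J) = τ_J - |J|`. -/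
def geomDefect {n k : ℕ} (A : Fin k → Finset (Fin n → ℤ)) (hA : ∀ i, (A i).Nonempty)
    (J : Finset (Fin k)) : ℤ :=
  (tau A hA J : ℤ) - J.card

/-- The fibre of `Φ_J` through the point `x`. -/
def kodairaFiber {n k : ℕ} (A : Fin k → Finset (Fin n → ℤ)) (hA : ∀ i, (A i).Nonempty)
    (J : Finset (Fin k)) (x : Fin n → ℂˣ) : Set (Fin n → ℂˣ) :=
  kodaira A hA J ⁻¹' {kodaira A hA J x}

/-- The number `ind(J)` of connected components of a fibre of `Φ_J`, here of the fibre through the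
identity of the torus. -/
def ind {n k : ℕ} (A : Fin k → Finset (Fin n → ℤ)) (hA : ∀ i, (A i).Nonempty)
    (J : Finset (Fin k)) : ℕ :=
  numComponents (zariskiTorus n) (kodairaFiber A hA J 1)

/-! ### Defects of subspaces and essential subcollections -/

/-- The defect `dim(∑_{i ∈ J} V_i) - |J|` of a collection of vector subspaces. -/
def linDefect {K W ι : Type*} [Field K] [AddCommGroup W] [Module K W] (V : ι → Submodule K W)
    (J : Finset ι) : ℤ :=
  (Module.finrank K (⨆ i ∈ J, V i : Submodule K W) : ℤ) - J.card

/-- `J` is essential for the defect function `d` if `d J` is the minimal defect and every proper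
subset of `J` has larger defect. -/
def IsEssential {ι : Type*} (d : Finset ι → ℤ) (J : Finset ι) : Prop :=
  (∀ I, d J ≤ d I) ∧ ∀ I, I ⊂ J → d J < d I

/-! ### The lattice data of a collection of supports -/

/-- The inclusion `ℤⁿ → ℝⁿ`. -/
def toReal (n : ℕ) : (Fin n → ℤ) →+ (Fin n → ℝ) where
  toFun a i := a i
  map_zero' := by ext; simp
  map_add' a b := by ext; simp

/-- The vector subspace `L(S)` of `ℝⁿ` parallel to the affine span of `S ⊆ ℤⁿ`. -/
def parallelSpace {n : ℕ} (S : Set (Fin n → ℤ)) : Submodule ℝ (Fin n → ℝ) :=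
  (affineSpan ℝ (toReal n '' S)).direction

/-- The Minkowski sum `A_J = ∑_{i ∈ J} A_i`. -/
def minkowskiSum {n k : ℕ} (A : Fin k → Finset (Fin n → ℤ)) (J : Finset (Fin k)) :
    Set (Fin n → ℤ) :=
  ∑ i ∈ J, (A i : Set (Fin n → ℤ))

/-- The lattice `Λ(J) = L(J) ∩ ℤⁿ` of integral points of the space `L(J)` parallel to the affine
span of `A_J`. -/
def lattice {n k : ℕ} (A : Fin k → Finset (Fin n → ℤ)) (J : Finset (Fin k)) :
    AddSubgroup (Fin n → ℤ) :=
  (parallelSpace (minkowskiSum A J)).toAddSubgroup.comap (toReal n)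

/-- The group `G_J` generated by all differences `a - b` with `a, b ∈ A_i`, `i ∈ J`. -/
def differenceGroup {n k : ℕ} (A : Fin k → Finset (Fin n → ℤ)) (J : Finset (Fin k)) :
    AddSubgroup (Fin n → ℤ) :=
  AddSubgroup.closure {c | ∃ i ∈ J, ∃ a ∈ A i, ∃ b ∈ A i, c = a - b}

/-- The index `ind(G_J)` of `G_J` in `Λ(J)`; it is `0` if the index is infinite. -/
def latticeIndex {n k : ℕ} (A : Fin k → Finset (Fin n → ℤ)) (J : Finset (Fin k)) : ℕ :=
  (differenceGroup A J).relIndex (lattice A J)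

/-- The lattice `ℤⁿ / Λ(J)`, the image of `ℤⁿ` under `π_J : ℝⁿ → ℝⁿ / L(J)`. -/
abbrev QuotientLattice {n k : ℕ} (A : Fin k → Finset (Fin n → ℤ)) (J : Finset (Fin k)) :=
  (Fin n → ℤ) ⧸ lattice A J

/-- The projected supports `π_J(A_i)`, `i ∉ J`, in `ℤⁿ / Λ(J)`. -/
def projectedSupport {n k : ℕ} (A : Fin k → Finset (Fin n → ℤ)) (J : Finset (Fin k))
    (i : {i : Fin k // i ∉ J}) : Set (QuotientLattice A J) :=
  QuotientAddGroup.mk' (lattice A J) '' (A i : Set (Fin n → ℤ))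

/-- The inclusion of the torus `Hom(ℤⁿ / Λ(J), ℂˣ)` as a closed subtorus of `(ℂˣ)ⁿ`: the `i`-th
coordinate of the image of `y` is the value of `y` at the class of the `i`-th basis vector. -/
def subtorus {n k : ℕ} (A : Fin k → Finset (Fin n → ℤ)) (J : Finset (Fin k))
    (y : LatticeTorus (QuotientLattice A J)) : Fin n → ℂˣ :=
  fun i => y (QuotientAddGroup.mk' (lattice A J) (Pi.single i 1))

/-! ### Zero sets and the consistency variety -/

/-- The zero set `Z_s ⊆ (ℂˣ)ⁿ` of a system `s`. -/
def zeroSet {n k : ℕ} {A : Fin k → Finset (Fin n → ℤ)}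
    (s : Systems fun i => (A i : Set (Fin n → ℤ))) : Set (Fin n → ℂˣ) :=
  {x | ∀ i, evalLaurent x (s i : AddMonoidAlgebra ℂ (Fin n → ℤ)) = 0}

/-- The zero set in `Hom(M, ℂˣ)` of a system of Laurent polynomials with exponents in `M`. -/
def latticeZeroSet {ι M : Type*} [AddCommGroup M] {A : ι → Set M} (g : Systems A) :
    Set (LatticeTorus M) :=
  {y | ∀ i, evalAt y (g i : AddMonoidAlgebra ℂ M) = 0}

/-- The consistency variety `R`: the Zariski closure of the set of systems that have a common zero
on the torus. -/
def consistencyVariety {n k : ℕ} (A : Fin k → Finset (Fin n → ℤ)) :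
    Set (Systems fun i => (A i : Set (Fin n → ℤ))) :=
  closure[zariski _] {s | (zeroSet s).Nonempty}

end ToricSystems

end

open ToricSystems
open scoped Topology

noncomputable section

namespace ToricSystems

/-! ### Algebras of Laurent functions -/

/-! Everything is governed by the groups G_I of exponent differences. The space E_I is spanned by
the monomials with exponents in the Minkowski sum of the A_i, so two points have the same image
under Φ_I exactly when their quotient is annihilated by G_I (`kodaira_eq_iff`). The image is
therefore a homeomorphic copy of the torus with character lattice G_I, and its dimension is the rank
of G_I, which is the dimension of the sum of the L(A_i) (`kodairaDim_eq`). The fibres of Φ_J are the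
cosets of the annihilator of G_J. The lattice Λ(J) is the saturation of G_J, hence a direct summand
of ℤⁿ, and its annihilator T_J is an irreducible subtorus. The cosets of T_J in the annihilator of
G_J correspond to the characters of the finite group Λ(J)/G_J, so there are [Λ(J):G_J] of them, and
they are the connected components (`numComponents_coset`).

For the zero sets, let r be the rank of G_J and c = |J| - r ≥ 0. After division by monomials the
equations in J live on the r-dimensional quotient of the torus by T_J. Pairs of a system and a zero
of its J-equations in this quotient form a product X of an affine space and (ℂˣ)^r, because the
constant terms of the J-equations can be solved for (`complete`). With N coefficients in all, dim X
= N - |J| + r = N - c. Since J has minimal defect, Rado's theorem gives a set K of k - c equations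
with linearly independent exponents, and an asymptotic argument shows that consistent systems are
dense in the N - c coefficients other than the constant terms outside K
(`exists_consistent_eval_ne_zero`). These coefficients thus form a transcendence basis on X, and
every generic condition becomes the non-vanishing of a polynomial in them.

Two such conditions are needed. Uniqueness (`exists_polynomial_unique_zero`): pairs of zeros whose
quotient is trivial exactly on the exponents of a proper subset I of J form a family of dimension
less than N - c, because I has larger defect than J. Existence (`exists_point_of_generic`): by
integrality, a generic point of the closure R comes from an actual point of X, at which a further
prescribed function does not vanish. Hence the zeros of the J-equations form one coset of the
annihilator of G_J. It splits into ind(J) cosets of T_J; on each of them the J-equations hold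
identically and the others restrict to a system with the projected supports. The genericity of these
restrictions is the prescribed function. -/

/-- The algebra of functions generated by the functions `h i`, the units `z j` and their
inverses. -/
def laurentFunctions {X σ τ : Type*} (h : σ → X → ℂ) (z : τ → X → ℂˣ) : Subalgebra ℂ (X → ℂ) :=
  Algebra.adjoin ℂ (Set.range h ∪ Set.range (fun j x => (z j x : ℂ)) ∪
    Set.range (fun j x => ((z j x)⁻¹ : ℂˣ)))

section LaurentFunctions

variable {X σ τ : Type*} {h : σ → X → ℂ} {z : τ → X → ℂˣ}

theorem coord_mem_laurentFunctions (i : σ) : h i ∈ laurentFunctions h z :=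
  Algebra.subset_adjoin (Or.inl (Or.inl ⟨i, rfl⟩))

theorem unit_mem_laurentFunctions (j : τ) : (fun x => (z j x : ℂ)) ∈ laurentFunctions h z :=
  Algebra.subset_adjoin (Or.inl (Or.inr ⟨j, rfl⟩))

theorem unit_inv_mem_laurentFunctions (j : τ) :
    (fun x => (((z j x)⁻¹ : ℂˣ) : ℂ)) ∈ laurentFunctions h z :=
  Algebra.subset_adjoin (Or.inr ⟨j, rfl⟩)

theorem const_mem_laurentFunctions (c : ℂ) : (fun _ => c) ∈ laurentFunctions h z :=
  (laurentFunctions h z).algebraMap_mem c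

theorem unit_zpow_mem_laurentFunctions (j : τ) (m : ℤ) :
    (fun x => ((z j x ^ m : ℂˣ) : ℂ)) ∈ laurentFunctions h z := by
  obtain ⟨m, rfl | rfl⟩ := m.eq_nat_or_neg
  · have := pow_mem (unit_mem_laurentFunctions (h := h) (z := z) j) m
    convert! this using 1
  · have := pow_mem (unit_inv_mem_laurentFunctions (h := h) (z := z) j) m
    convert! this using 1
    ext x
    simp

theorem monomial_mem_laurentFunctions [Fintype τ] (e : τ → ℤ) :
    (fun x => ((∏ j, z j x ^ e j : ℂˣ) : ℂ)) ∈ laurentFunctions h z := by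
  have := prod_mem (fun j (_ : j ∈ Finset.univ) =>
    unit_zpow_mem_laurentFunctions (h := h) (z := z) j (e j))
  convert! this using 1
  ext x
  simp [Finset.prod_apply]

theorem eval_mem_laurentFunctions {κ : Type*} (p : MvPolynomial κ ℂ) {F : κ → X → ℂ}
    (hF : ∀ i, F i ∈ laurentFunctions h z) :
    (fun x => p.eval fun i => F i x) ∈ laurentFunctions h z := by
  induction p using MvPolynomial.induction_on with
  | C a => simpa using const_mem_laurentFunctions a
  | add p q hp hq => simpa using! add_mem hp hq
  | mul_X p i hp => simpa using! mul_mem hp (hF i)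

theorem comp_mem_laurentFunctions {Y σ' τ' : Type*} {h' : σ' → Y → ℂ} {z' : τ' → Y → ℂˣ}
    {φ : Y → X} (hh : ∀ i, h i ∘ φ ∈ laurentFunctions h' z')
    (hz : ∀ j, (fun y => (z j (φ y) : ℂ)) ∈ laurentFunctions h' z')
    (hz' : ∀ j, (fun y => (((z j (φ y))⁻¹ : ℂˣ) : ℂ)) ∈ laurentFunctions h' z')
    {F : X → ℂ} (hF : F ∈ laurentFunctions h z) : F ∘ φ ∈ laurentFunctions h' z' := by
  induction hF using Algebra.adjoin_induction with
  | mem F hF =>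
    obtain (⟨i, rfl⟩ | ⟨j, rfl⟩) | ⟨j, rfl⟩ := hF
    · exact hh i
    · exact hz j
    · exact hz' j
  | algebraMap c => exact (laurentFunctions h' z').algebraMap_mem c
  | add F G _ _ hF hG => exact add_mem hF hG
  | mul F G _ _ hF hG => exact mul_mem hF hG

/-- Clearing denominators: a Laurent function times a large power of the product of all units is
a polynomial. -/
theorem exists_polynomial_of_mem_laurentFunctions [Fintype τ] {F : X → ℂ}
    (hF : F ∈ laurentFunctions h z) :
    ∃ (M : ℕ) (p : MvPolynomial (σ ⊕ τ) ℂ), ∀ x,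
      p.eval (Sum.elim (fun i => h i x) fun j => (z j x : ℂ)) = F x * ∏ j, (z j x : ℂ) ^ M := by
  classical
  induction hF using Algebra.adjoin_induction with
  | mem F hF =>
    obtain (⟨i, rfl⟩ | ⟨j, rfl⟩) | ⟨j, rfl⟩ := hF
    · exact ⟨0, MvPolynomial.X (Sum.inl i), fun x => by simp⟩
    · exact ⟨0, MvPolynomial.X (Sum.inr j), fun x => by simp⟩
    -- The inverse of one unit times the product of all units is the product of the other units.
    · refine ⟨1, ∏ l ∈ Finset.univ.erase j, MvPolynomial.X (Sum.inr l), fun x => ?_⟩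
      rw [← Finset.mul_prod_erase Finset.univ _ (Finset.mem_univ j)]
      simp
  | algebraMap c => exact ⟨0, MvPolynomial.C c, fun x => by simp⟩
  | add F G _ _ hF hG =>
    obtain ⟨M, p, hp⟩ := hF
    obtain ⟨N, q, hq⟩ := hG
    refine ⟨M + N, p * ∏ j, MvPolynomial.X (Sum.inr j) ^ N +
      q * ∏ j, MvPolynomial.X (Sum.inr j) ^ M, fun x => ?_⟩
    simp only [map_add, map_mul, hp, hq, map_prod, map_pow, MvPolynomial.eval_X, Sum.elim_inr,
      pow_add, Finset.prod_mul_distrib, Pi.add_apply]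
    ring
  | mul F G _ _ hF hG =>
    obtain ⟨M, p, hp⟩ := hF
    obtain ⟨N, q, hq⟩ := hG
    refine ⟨M + N, p * q, fun x => ?_⟩
    simp only [map_mul, hp, hq, pow_add, Finset.prod_mul_distrib, Pi.mul_apply]
    ring

end LaurentFunctions

/-- A non-zero polynomial does not vanish at some point with prescribed non-zero coordinates. -/
theorem exists_eval_ne_zero_of_units {σ τ : Type*} [Fintype τ] {p : MvPolynomial (σ ⊕ τ) ℂ}
    (hp : p ≠ 0) :
    ∃ (h : σ → ℂ) (z : τ → ℂˣ), p.eval (Sum.elim h fun j => (z j : ℂ)) ≠ 0 := by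
  -- With the product of the unit variables as an extra factor, a point of non-vanishing
  -- automatically has non-zero unit coordinates.
  have : p * ∏ j : τ, MvPolynomial.X (Sum.inr j) ≠ 0 :=
    mul_ne_zero hp (Finset.prod_ne_zero_iff.2 fun j _ => MvPolynomial.X_ne_zero _)
  obtain ⟨v, hv⟩ : ∃ v, (p * ∏ j : τ, MvPolynomial.X (Sum.inr j)).eval v ≠ 0 := by
    by_contra! hc
    exact this (MvPolynomial.funext fun v => by simpa using hc v)
  simp only [map_mul, map_prod, MvPolynomial.eval_X, mul_ne_zero_iff,
    Finset.prod_ne_zero_iff, Finset.mem_univ, true_imp_iff] at hv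
  refine ⟨fun i => v (Sum.inl i), fun j => Units.mk0 _ (hv.2 j), ?_⟩
  convert hv.1 using 3
  ext (i | j) <;> simp

/-! ### The Zariski topology of the torus -/

/-- The regular functions on `(ℂˣ)ⁿ`. -/
abbrev torusFunctions (τ : Type*) : Subalgebra ℂ ((τ → ℂˣ) → ℂ) :=
  laurentFunctions (X := τ → ℂˣ) (σ := Empty) (τ := τ) (fun i => i.elim) fun j x => x j

/-- Bridge between the Laurent polynomials that define the Zariski topology and the function
algebra, where membership can be checked by closure properties. -/
theorem mem_torusFunctions_iff {n : ℕ} (F : (Fin n → ℂˣ) → ℂ) :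
    F ∈ torusFunctions (Fin n) ↔ ∃ f, ∀ x, F x = evalLaurent x f := by
  constructor
  · intro hF
    induction hF using Algebra.adjoin_induction with
    | mem F hF =>
      obtain (⟨i, rfl⟩ | ⟨j, rfl⟩) | ⟨j, rfl⟩ := hF
      · exact i.elim
      · refine ⟨AddMonoidAlgebra.single (Pi.single j 1) 1, fun x => ?_⟩
        rw [evalLaurent_apply, AddMonoidAlgebra.coeff_single, Finsupp.sum_single_index (by simp),
          Finset.prod_eq_single j (fun l _ hl => by simp [hl]) (by simp)]
        simp
      · refine ⟨AddMonoidAlgebra.single (Pi.single j (-1)) 1, fun x => ?_⟩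
        rw [evalLaurent_apply, AddMonoidAlgebra.coeff_single, Finsupp.sum_single_index (by simp),
          Finset.prod_eq_single j (fun l _ hl => by simp [hl]) (by simp)]
        simp
    | algebraMap c => exact ⟨algebraMap _ _ c, fun x => by rw [AlgHom.commutes]; rfl⟩
    | add F G _ _ hF hG =>
      obtain ⟨f, hf⟩ := hF
      obtain ⟨g, hg⟩ := hG
      exact ⟨f + g, fun x => by simp [hf, hg]⟩
    | mul F G _ _ hF hG =>
      obtain ⟨f, hf⟩ := hF
      obtain ⟨g, hg⟩ := hG
      exact ⟨f * g, fun x => by simp [hf, hg]⟩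
  · rintro ⟨f, hf⟩
    have : F = ∑ a ∈ f.coeff.support, f.coeff a • fun x : Fin n → ℂˣ =>
        ((∏ j, x j ^ a j : ℂˣ) : ℂ) := by
      ext x
      simp [hf, evalLaurent_apply, Finsupp.sum, Finset.sum_apply]
    rw [this]
    exact sum_mem fun a _ => Subalgebra.smul_mem _ (monomial_mem_laurentFunctions a) _

theorem monomial_mem_torusFunctions {n : ℕ} (a : Fin n → ℤ) :
    (fun x => (monomialChar x a : ℂ)) ∈ torusFunctions (Fin n) :=
  monomial_mem_laurentFunctions a

theorem zariskiTorus_eq (n : ℕ) : zariskiTorus n =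
    TopologicalSpace.generateFrom
      {D | ∃ F ∈ torusFunctions (Fin n), D = {x | F x ≠ 0}} := by
  unfold zariskiTorus
  congr 1
  ext D
  constructor
  · rintro ⟨f, rfl⟩
    exact ⟨_, (mem_torusFunctions_iff _).2 ⟨f, fun x => rfl⟩, rfl⟩
  · rintro ⟨F, hF, rfl⟩
    obtain ⟨f, hf⟩ := (mem_torusFunctions_iff _).1 hF
    exact ⟨f, by simp [hf]⟩

theorem isOpen_ne_zero_torus {n : ℕ} {F : (Fin n → ℂˣ) → ℂ} (hF : F ∈ torusFunctions (Fin n)) :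
    IsOpen[zariskiTorus n] {x | F x ≠ 0} := by
  rw [zariskiTorus_eq]
  exact TopologicalSpace.isOpen_generateFrom_of_mem ⟨F, hF, rfl⟩

theorem isClosed_eq_zero_torus {n : ℕ} {F : (Fin n → ℂˣ) → ℂ} (hF : F ∈ torusFunctions (Fin n)) :
    IsClosed[zariskiTorus n] {x | F x = 0} := by
  let := zariskiTorus n
  exact ⟨isOpen_ne_zero_torus hF⟩

/-- The non-vanishing loci of regular functions form a basis of the Zariski topology. -/
theorem isTopologicalBasis_torus (n : ℕ) :
    @TopologicalSpace.IsTopologicalBasis _ (zariskiTorus n)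
      {D | ∃ F ∈ torusFunctions (Fin n), D = {x | F x ≠ 0}} := by
  let := zariskiTorus n
  refine ⟨?_, ?_, zariskiTorus_eq n⟩
  · rintro _ ⟨F, hF, rfl⟩ _ ⟨G, hG, rfl⟩ x hx
    exact ⟨_, ⟨F * G, mul_mem hF hG, rfl⟩, by simpa using hx, fun y hy => by simpa using hy⟩
  · refine Set.eq_univ_of_forall fun x => ?_
    exact ⟨_, ⟨1, one_mem _, rfl⟩, by simp⟩

/-- Once denominators are cleared, two non-empty basic open sets are given by non-zero polynomials,
whose product is non-zero at some point with unit coordinates. -/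
theorem irreducible_torus (n : ℕ) :
    @IsIrreducible _ (zariskiTorus n) (Set.univ : Set (Fin n → ℂˣ)) := by
  let := zariskiTorus n
  refine ⟨⟨1, trivial⟩, ?_⟩
  rintro U V hU hV ⟨x, -, hx⟩ ⟨y, -, hy⟩
  obtain ⟨_, ⟨F, hF, rfl⟩, hxF, hFU⟩ := (isTopologicalBasis_torus n).exists_subset_of_mem_open hx hU
  obtain ⟨_, ⟨G, hG, rfl⟩, hyG, hGV⟩ := (isTopologicalBasis_torus n).exists_subset_of_mem_open hy hV
  obtain ⟨M, p, hp⟩ := exists_polynomial_of_mem_laurentFunctions hF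
  obtain ⟨N, q, hq⟩ := exists_polynomial_of_mem_laurentFunctions hG
  have aux : ∀ (x : Fin n → ℂˣ) (M : ℕ), ∏ j, (x j : ℂ) ^ M ≠ 0 := fun x M =>
    Finset.prod_ne_zero_iff.2 fun j _ => pow_ne_zero _ (x j).ne_zero
  have hp0 : p ≠ 0 := fun h0 => mul_ne_zero hxF (aux x M) (by rw [← hp, h0, map_zero])
  have hq0 : q ≠ 0 := fun h0 => mul_ne_zero hyG (aux y N) (by rw [← hq, h0, map_zero])
  obtain ⟨h, w, hw⟩ := exists_eval_ne_zero_of_units (mul_ne_zero hp0 hq0)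
  obtain rfl : h = fun i => (i.elim : (Fin n → ℂˣ) → ℂ) w := by ext i; exact i.elim
  rw [map_mul, hp, hq] at hw
  refine ⟨w, trivial, hFU ?_, hGV ?_⟩
  · exact fun h0 => hw (by simp [h0])
  · exact fun h0 => hw (by simp [h0])

theorem continuous_torus_map {m n : ℕ} (φ : (Fin m → ℂˣ) → Fin n → ℂˣ)
    (h₁ : ∀ j, (fun x => (φ x j : ℂ)) ∈ torusFunctions (Fin m))
    (h₂ : ∀ j, (fun x => (((φ x j)⁻¹ : ℂˣ) : ℂ)) ∈ torusFunctions (Fin m)) :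
    @Continuous _ _ (zariskiTorus m) (zariskiTorus n) φ := by
  let := zariskiTorus m
  let := zariskiTorus n
  rw [zariskiTorus_eq n]
  refine continuous_generateFrom_iff.2 ?_
  rintro _ ⟨F, hF, rfl⟩
  exact isOpen_ne_zero_torus (comp_mem_laurentFunctions (fun i => i.elim) h₁ h₂ hF)

/-- The maps of tori all of whose coordinates are monomials with a coefficient are continuous. -/
theorem continuous_monomial_map {m n : ℕ} (c : Fin n → ℂˣ) (e : Fin n → Fin m → ℤ) :
    @Continuous _ _ (zariskiTorus m) (zariskiTorus n)
      fun x j => c j * monomialChar x (e j) := by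
  refine continuous_torus_map _ (fun j => ?_) fun j => ?_
  · simpa using! mul_mem (const_mem_laurentFunctions (c j : ℂ)) (monomial_mem_torusFunctions (e j))
  · have := mul_mem (const_mem_laurentFunctions ((c j)⁻¹ : ℂ))
      (monomial_mem_torusFunctions (-e j))
    convert! this using 1
    ext x
    simp [AddChar.map_neg_eq_inv, mul_comm]

/-- The torus carries the topology induced from the spectrum of the polynomial ring in r variables,
which bounds its dimension by r; a flag of coordinate subtori gives a chain of length r. -/
theorem topologicalKrullDim_torus (r : ℕ) :
    @topologicalKrullDim (Fin r → ℂˣ) (zariskiTorus r) = r := by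
  let := zariskiTorus r
  refine le_antisymm ?_ ?_
  -- A point goes to the kernel of evaluation at it.
  · let ψ : (Fin r → ℂˣ) → PrimeSpectrum (MvPolynomial (Fin r) ℂ) := fun x =>
      PrimeSpectrum.comap (MvPolynomial.eval fun j => (x j : ℂ)) ⊥
    have hψ : Topology.IsInducing ψ := by
      refine ⟨?_⟩
      rw [PrimeSpectrum.isTopologicalBasis_basic_opens.eq_generateFrom,
        induced_generateFrom_eq]
      refine (zariskiTorus_eq r).trans ?_
      refine le_antisymm ?_ ?_
      · refine le_generateFrom ?_
        rintro _ ⟨_, ⟨p, rfl⟩, rfl⟩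
        refine TopologicalSpace.isOpen_generateFrom_of_mem
          ⟨fun x => p.eval fun j => (x j : ℂ), ?_, ?_⟩
        · exact eval_mem_laurentFunctions p fun j => unit_mem_laurentFunctions j
        · ext x
          simp [ψ]
      · refine le_generateFrom ?_
        rintro _ ⟨F, hF, rfl⟩
        obtain ⟨M, p, hp⟩ := exists_polynomial_of_mem_laurentFunctions hF
        refine TopologicalSpace.isOpen_generateFrom_of_mem
          ⟨_, ⟨p.rename (Sum.elim Empty.elim id), rfl⟩, ?_⟩
        ext x
        have := hp x
        have aux : ∏ j, (x j : ℂ) ^ M ≠ 0 :=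
          Finset.prod_ne_zero_iff.2 fun j _ => pow_ne_zero _ (x j).ne_zero
        have h2 : (p.rename (Sum.elim Empty.elim id)).eval (fun j => (x j : ℂ)) =
            F x * ∏ j, (x j : ℂ) ^ M := by
          rw [MvPolynomial.eval_rename, ← hp]
          congr 2
          ext (i | j)
          · exact i.elim
          · rfl
        simp [ψ, h2, aux]
    refine hψ.topologicalKrullDim_le.trans ?_
    rw [PrimeSpectrum.topologicalKrullDim_eq_ringKrullDim,
      MvPolynomial.ringKrullDim_of_isNoetherianRing]
    simp
  -- The i-th member is the subtorus on which the coordinates from index i on equal 1. It is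
  -- irreducible as the image of the torus under the projection that replaces those coordinates by
  -- 1.
  · let Z : Fin (r + 1) → TopologicalSpace.IrreducibleCloseds (Fin r → ℂˣ) := fun i =>
      { carrier := {x | ∀ j : Fin r, (i : ℕ) ≤ j → x j = 1}
        isIrreducible' := by
          have hc := continuous_monomial_map (m := r) (n := r) 1
            fun j => if (i : ℕ) ≤ j then 0 else Pi.single j 1
          have := (irreducible_torus r).image _ hc.continuousOn
          convert! this using 1
          ext x
          simp only [Set.mem_ofPred_eq, Set.image_univ, Set.mem_range]
          constructor
          · intro hx
            refine ⟨x, ?_⟩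
            ext j
            by_cases hj : (i : ℕ) ≤ j
            · simp [hj, hx j hj]
            · simp [hj, monomialChar, Pi.single_apply]
          · rintro ⟨y, rfl⟩ j hj
            simp [hj]
        isClosed' := by
          have : {x : Fin r → ℂˣ | ∀ j : Fin r, (i : ℕ) ≤ j → x j = 1} =
              ⋂ (j : Fin r) (_ : (i : ℕ) ≤ j), {x | (x j : ℂ) - 1 = 0} := by
            ext x
            simp [sub_eq_zero]
          rw [this]
          exact isClosed_iInter fun j => isClosed_iInter fun _ => isClosed_eq_zero_torus
            (sub_mem (unit_mem_laurentFunctions j) (const_mem_laurentFunctions 1)) }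
    have hZ : StrictMono Z := by
      refine Fin.strictMono_iff_lt_succ.2 fun i => ?_
      refine lt_of_le_of_ne (fun x hx j hj => hx j ((by simp : _ ≤ _).trans hj)) fun heq => ?_
      -- The point with i-th coordinate 2 and all others 1 separates consecutive members of the
      -- flag.
      have h2 : (Function.update 1 i (Units.mk0 2 two_ne_zero) : Fin r → ℂˣ) ∈ Z i.succ := by
        intro j hj
        rw [Function.update_of_ne]
        · rfl
        · rintro rfl
          simp at hj
      rw [← heq] at h2
      have := h2 i (by simp)
      rw [Function.update_self, Units.ext_iff] at this
      norm_num at this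
    exact Order.LTSeries.length_le_krullDim ⟨r, Z, fun i => hZ (Fin.castSucc_lt_succ)⟩

/-! ### Monomials and characters -/

section Monomials

variable {n : ℕ}

theorem monomialChar_apply (x : Fin n → ℂˣ) (a : Fin n → ℤ) :
    monomialChar x a = ∏ i, x i ^ a i := rfl

theorem monomialChar_mul (x y : Fin n → ℂˣ) (a : Fin n → ℤ) :
    monomialChar (x * y) a = monomialChar x a * monomialChar y a := by
  simp [monomialChar_apply, mul_zpow, Finset.prod_mul_distrib]

theorem monomialChar_inv (x : Fin n → ℂˣ) (a : Fin n → ℤ) :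
    monomialChar x⁻¹ a = (monomialChar x a)⁻¹ := by
  simp [monomialChar_apply]

theorem monomialChar_div (x y : Fin n → ℂˣ) (a : Fin n → ℤ) :
    monomialChar (x / y) a = monomialChar x a / monomialChar y a := by
  rw [div_eq_mul_inv, monomialChar_mul, monomialChar_inv, div_eq_mul_inv]

theorem monomialChar_one (a : Fin n → ℤ) : monomialChar (1 : Fin n → ℂˣ) a = 1 := by
  simp [monomialChar_apply]

theorem monomialChar_single (x : Fin n → ℂˣ) (l : Fin n) :
    monomialChar x (Pi.single l 1) = x l := by
  rw [monomialChar_apply, Finset.prod_eq_single l (fun j _ hj => by simp [hj]) (by simp)]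
  simp

/-- Characters of a free abelian group are determined by their values on a basis. -/
theorem addChar_eq_of_basis {M κ : Type*} [AddCommGroup M] (b : Module.Basis κ ℤ M)
    {χ χ' : AddChar M ℂˣ} (h : ∀ j, χ (b j) = χ' (b j)) : χ = χ' := by
  have := b.ext (f₁ := χ.toAddMonoidHom.toIntLinearMap) (f₂ := χ'.toAddMonoidHom.toIntLinearMap)
    fun j => by simpa using congrArg Additive.ofMul (h j)
  exact DFunLike.ext _ _ fun x => Additive.ofMul.injective (LinearMap.congr_fun this x)

theorem addChar_map_sum {M κ : Type*} [AddCommGroup M] (χ : AddChar M ℂˣ) (s : Finset κ)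
    (g : κ → M) : χ (∑ i ∈ s, g i) = ∏ i ∈ s, χ (g i) := by
  induction s using Finset.cons_induction with
  | empty => simp
  | cons i s hi ih => rw [Finset.sum_cons, Finset.prod_cons, AddChar.map_add_eq_mul, ih]

/-- Every character of `ℤⁿ` comes from a point of the torus. -/
theorem monomialChar_of_addChar (χ : AddChar (Fin n → ℤ) ℂˣ) :
    monomialChar (fun l => χ (Pi.single l 1)) = χ :=
  addChar_eq_of_basis (Pi.basisFun ℤ (Fin n)) fun j => by simp [monomialChar_single]

theorem monomialChar_injective : Function.Injective (monomialChar (n := n)) := fun x y h => by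
  ext l
  rw [← monomialChar_single x, ← monomialChar_single y, h]

/-- The point of the torus whose value at the basis vector `b j` is `w j`. -/
def basisPoint (b : Module.Basis (Fin n) ℤ (Fin n → ℤ)) (w : Fin n → ℂˣ) : Fin n → ℂˣ :=
  fun l => monomialChar w (b.repr (Pi.single l 1))

theorem monomialChar_basisPoint (b : Module.Basis (Fin n) ℤ (Fin n → ℤ)) (w : Fin n → ℂˣ)
    (a : Fin n → ℤ) : monomialChar (basisPoint b w) a = monomialChar w (b.repr a) := by
  let χ : AddChar (Fin n → ℤ) ℂˣ :=
    { toFun := fun a => monomialChar w (b.repr a)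
      map_zero_eq_one' := by simp
      map_add_eq_mul' := fun x y => by simp [AddChar.map_add_eq_mul] }
  exact DFunLike.congr_fun (monomialChar_of_addChar χ) a

theorem monomialChar_basisPoint_self (b : Module.Basis (Fin n) ℤ (Fin n → ℤ)) (w : Fin n → ℂˣ)
    (j : Fin n) : monomialChar (basisPoint b w) (b j) = w j := by
  rw [monomialChar_basisPoint, b.repr_self, ← monomialChar_single w j]
  congr 1
  exact Finsupp.single_eq_pi_single _ _

/-- Linearly independent monomials take arbitrary values. -/
theorem exists_monomialChar_eq {κ : Type*} {v : κ → Fin n → ℤ}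
    (hv : LinearIndependent ℝ fun i => toReal n (v i)) (q : κ → ℂˣ) :
    ∃ x : Fin n → ℂˣ, ∀ i, monomialChar x (v i) = q i := by
  -- Choose logarithms of the prescribed values, extend them to a real-linear map from ℝⁿ to ℂ, and
  -- exponentiate its values at the standard basis.
  have hlog : ∀ i, ∃ c : ℂ, Complex.exp c = q i := fun i =>
    ⟨Complex.log (q i), Complex.exp_log (q i).ne_zero⟩
  choose c hc using hlog
  obtain ⟨φ, hφ⟩ : ∃ φ : (Fin n → ℝ) →ₗ[ℝ] ℂ, ∀ i, φ (toReal n (v i)) = c i := by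
    obtain ⟨g, hg⟩ := LinearMap.exists_extend
      ((Finsupp.linearCombination ℝ c).comp hv.repr)
    refine ⟨g, fun i => ?_⟩
    have := LinearMap.congr_fun hg ⟨toReal n (v i), Submodule.subset_span ⟨i, rfl⟩⟩
    simp only [LinearMap.comp_apply, Submodule.subtype_apply] at this
    rw [this, hv.repr_eq_single i _ rfl, Finsupp.linearCombination_single, one_smul]
  refine ⟨fun l => Units.mk0 (Complex.exp (φ (Pi.single l 1))) (Complex.exp_ne_zero _), fun i => ?_⟩
  ext
  rw [← hc, ← hφ, monomialChar_apply]
  have : toReal n (v i) = ∑ l, (v i l : ℝ) • Pi.single l (1 : ℝ) := by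
    ext m
    simp [toReal, Finset.sum_apply, Pi.single_apply]
  rw [this, map_sum, Complex.exp_sum]
  simp only [Units.coe_prod, Units.val_zpow_eq_zpow_val, Units.val_mk0, map_smul]
  refine Finset.prod_congr rfl fun l _ => ?_
  rw [← Complex.exp_int_mul]
  simp

theorem linearIndependent_toReal_basis (b : Module.Basis (Fin n) ℤ (Fin n → ℤ)) :
    LinearIndependent ℝ fun j => toReal n (b j) := by
  refine linearIndependent_of_top_le_span_of_card_eq_finrank ?_ (by simp)
  have key : ∀ a, toReal n a ∈ Submodule.span ℝ (Set.range fun j => toReal n (b j)) := by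
    intro a
    rw [← b.sum_repr a, map_sum]
    refine sum_mem fun j _ => ?_
    rw [map_zsmul, ← Int.cast_smul_eq_zsmul ℝ]
    exact Submodule.smul_mem _ _ (Submodule.subset_span ⟨j, rfl⟩)
  intro v _
  have : v = ∑ l, v l • toReal n (Pi.single l 1) := by
    ext m
    simp [toReal, Finset.sum_apply, Pi.single_apply]
  rw [this]
  exact sum_mem fun l _ => Submodule.smul_mem _ _ (key _)

end Monomials

/-! ### Saturation of a sublattice -/

/-- The real span of a sublattice of `ℤⁿ`. -/
def realSpan {n : ℕ} (G : AddSubgroup (Fin n → ℤ)) : Submodule ℝ (Fin n → ℝ) :=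
  Submodule.span ℝ (toReal n '' G)

/-- The lattice of all integral points in the real span of a sublattice. -/
def saturation {n : ℕ} (G : AddSubgroup (Fin n → ℤ)) : AddSubgroup (Fin n → ℤ) :=
  (realSpan G).toAddSubgroup.comap (toReal n)

theorem le_saturation {n : ℕ} (G : AddSubgroup (Fin n → ℤ)) : G ≤ saturation G :=
  fun g hg => Submodule.subset_span ⟨g, hg, rfl⟩

/-! ### Smith normal form of a sublattice -/

section Smith

variable {n r : ℕ} {G : AddSubgroup (Fin n → ℤ)}

theorem smith_coeff_ne_zero
    (S : Module.Basis.SmithNormalForm (AddSubgroup.toIntSubmodule G) (Fin n) r)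
    (i : Fin r) : S.a i ≠ 0 := by
  intro h
  have := S.snf i
  rw [h, zero_smul] at this
  exact S.bN.ne_zero i (Subtype.ext this)

/-- The basis vectors of G are non-zero integer multiples of members of a basis of ℤⁿ, and these
multiples are invertible over ℝ. -/
theorem realSpan_eq_span_smith
    (S : Module.Basis.SmithNormalForm (AddSubgroup.toIntSubmodule G) (Fin n) r) :
    realSpan G = Submodule.span ℝ (Set.range fun i => toReal n (S.bM (S.f i))) := by
  refine le_antisymm (Submodule.span_le.2 ?_) (Submodule.span_le.2 ?_)
  · rintro _ ⟨g, hg, rfl⟩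
    have : g = ∑ i, S.bN.repr ⟨g, hg⟩ i • S.a i • S.bM (S.f i) := by
      have := congrArg (AddSubgroup.toIntSubmodule G).subtype (S.bN.sum_repr ⟨g, hg⟩)
      rw [map_sum] at this
      simpa [S.snf] using this.symm
    rw [this, map_sum]
    refine sum_mem fun i _ => ?_
    rw [smul_smul, map_zsmul, ← Int.cast_smul_eq_zsmul ℝ]
    exact Submodule.smul_mem _ _ (Submodule.subset_span ⟨i, rfl⟩)
  · rintro _ ⟨i, rfl⟩
    have h : toReal n (S.bN i : Fin n → ℤ) ∈ realSpan G :=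
      Submodule.subset_span ⟨_, (S.bN i).2, rfl⟩
    rw [S.snf, map_zsmul, ← Int.cast_smul_eq_zsmul ℝ] at h
    exact (Submodule.smul_mem_iff _ (by exact_mod_cast smith_coeff_ne_zero S i)).1 h

theorem linearIndependent_toReal_smith
    (S : Module.Basis.SmithNormalForm (AddSubgroup.toIntSubmodule G) (Fin n) r) :
    LinearIndependent ℝ fun i => toReal n (S.bM (S.f i)) :=
  (linearIndependent_toReal_basis S.bM).comp _ S.f.injective

theorem finrank_realSpan
    (S : Module.Basis.SmithNormalForm (AddSubgroup.toIntSubmodule G) (Fin n) r) :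
    Module.finrank ℝ (realSpan G) = r := by
  rw [realSpan_eq_span_smith S, finrank_span_eq_card (linearIndependent_toReal_smith S)]
  simp

/-- In the Smith basis the real span of G is a coordinate subspace. The saturation is therefore the
lattice spanned by part of a basis of ℤⁿ, that is, a direct summand. -/
theorem mem_saturation_iff_repr
    (S : Module.Basis.SmithNormalForm (AddSubgroup.toIntSubmodule G) (Fin n) r)
    (a : Fin n → ℤ) :
    a ∈ saturation G ↔ ∀ j ∉ Set.range S.f, S.bM.repr a j = 0 := by
  have hb := linearIndependent_toReal_basis S.bM
  have hsum : toReal n a = ∑ j, (S.bM.repr a j : ℝ) • toReal n (S.bM j) := by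
    conv_lhs => rw [← S.bM.sum_repr a, map_sum]
    exact Finset.sum_congr rfl fun j _ => by rw [map_zsmul, Int.cast_smul_eq_zsmul]
  change toReal n a ∈ realSpan G ↔ _
  rw [realSpan_eq_span_smith S]
  constructor
  · intro h j hj
    have h2 := (Finsupp.mem_span_range_iff_exists_finsupp).1 h
    obtain ⟨c, hc⟩ := h2
    rw [Finsupp.sum_fintype _ _ (by simp), hsum] at hc
    have : ∑ l, ((∑ i, if S.f i = l then c i else 0) - (S.bM.repr a l : ℝ)) •
        toReal n (S.bM l) = 0 := by
      simp only [sub_smul, Finset.sum_sub_distrib, ← hc, Finset.sum_smul]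
      rw [Finset.sum_comm]
      simp
    have := Fintype.linearIndependent_iff.1 hb _ this j
    rw [Finset.sum_eq_zero fun i _ => if_neg fun h => hj ⟨i, h⟩] at this
    simpa using this
  · intro h
    rw [hsum]
    refine sum_mem fun j _ => ?_
    by_cases hj : j ∈ Set.range S.f
    · obtain ⟨i, rfl⟩ := hj
      exact Submodule.smul_mem _ _ (Submodule.subset_span ⟨i, rfl⟩)
    · simp [h j hj]

theorem eq_sum_of_mem_saturation
    (S : Module.Basis.SmithNormalForm (AddSubgroup.toIntSubmodule G) (Fin n) r)
    {a : Fin n → ℤ} (ha : a ∈ saturation G) :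
    a = ∑ i, S.bM.repr a (S.f i) • S.bM (S.f i) := by
  conv_lhs => rw [← S.bM.sum_repr a]
  refine (Finset.sum_of_injOn S.f S.f.injective.injOn (by simp) (fun j _ hj => ?_) (by simp)).symm
  rw [(mem_saturation_iff_repr S a).1 ha j (by simpa using hj), zero_smul]

theorem smith_mem_saturation
    (S : Module.Basis.SmithNormalForm (AddSubgroup.toIntSubmodule G) (Fin n) r)
    (i : Fin r) : S.bM (S.f i) ∈ saturation G := by
  rw [mem_saturation_iff_repr S]
  intro j hj
  rw [S.bM.repr_self, Finsupp.single_eq_of_ne]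
  rintro rfl
  exact hj ⟨i, rfl⟩

theorem smith_smul_mem
    (S : Module.Basis.SmithNormalForm (AddSubgroup.toIntSubmodule G) (Fin n) r)
    (i : Fin r) : S.a i • S.bM (S.f i) ∈ G := by
  rw [← S.snf]
  exact (S.bN i).2

theorem prod_smith_smul_mem
    (S : Module.Basis.SmithNormalForm (AddSubgroup.toIntSubmodule G) (Fin n) r)
    {a : Fin n → ℤ} (ha : a ∈ saturation G) : (∏ i, S.a i) • a ∈ G := by
  rw [eq_sum_of_mem_saturation S ha, Finset.smul_sum]
  refine sum_mem fun i _ => ?_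
  rw [← Finset.prod_erase_mul _ _ (Finset.mem_univ i), mul_smul, smul_comm (S.a i), ]
  exact G.zsmul_mem (G.zsmul_mem (smith_smul_mem S i) _) _

/-- The saturation is a direct summand, so a character extends by the value 1 on the remaining basis
vectors. -/
theorem exists_extend_saturation
    (S : Module.Basis.SmithNormalForm (AddSubgroup.toIntSubmodule G) (Fin n) r)
    (χ : AddChar (saturation G) ℂˣ) :
    ∃ y : Fin n → ℂˣ, ∀ a : saturation G, monomialChar y a = χ a := by
  classical
  refine ⟨basisPoint S.bM fun j => if h : ∃ i, S.f i = j then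
    χ ⟨S.bM (S.f h.choose), smith_mem_saturation S _⟩ else 1, fun a => ?_⟩
  have key : ∀ i, monomialChar (basisPoint S.bM fun j => if h : ∃ i, S.f i = j then
      χ ⟨S.bM (S.f h.choose), smith_mem_saturation S _⟩ else 1) (S.bM (S.f i)) =
      χ ⟨S.bM (S.f i), smith_mem_saturation S _⟩ := by
    intro i
    have h : ∃ i', S.f i' = S.f i := ⟨i, rfl⟩
    rw [monomialChar_basisPoint_self, dif_pos h]
    congr 2
    rw [h.choose_spec]
  have h2 : a = ∑ i, S.bM.repr (a : Fin n → ℤ) (S.f i) •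
      (⟨S.bM (S.f i), smith_mem_saturation S _⟩ : saturation G) := by
    ext1
    conv_lhs => rw [eq_sum_of_mem_saturation S a.2]
    simp
  conv_lhs => rw [eq_sum_of_mem_saturation S a.2]
  conv_rhs => rw [h2]
  rw [addChar_map_sum, addChar_map_sum]
  refine Finset.prod_congr rfl fun i _ => ?_
  rw [AddChar.map_zsmul_eq_zpow, AddChar.map_zsmul_eq_zpow, key]

theorem exists_smith (G : AddSubgroup (Fin n → ℤ)) :
    ∃ r, Nonempty (Module.Basis.SmithNormalForm (AddSubgroup.toIntSubmodule G) (Fin n) r) := by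
  obtain ⟨r, S⟩ := Submodule.smithNormalForm (Pi.basisFun ℤ (Fin n))
    (AddSubgroup.toIntSubmodule G)
  exact ⟨r, ⟨S⟩⟩

end Smith

/-- The quotient is finitely generated and is killed by the product of the Smith coefficients, so it
is a finitely generated torsion group. -/
theorem finite_saturation_quotient {n : ℕ} (G : AddSubgroup (Fin n → ℤ)) :
    Finite (saturation G ⧸ G.addSubgroupOf (saturation G)) := by
  obtain ⟨r, ⟨S⟩⟩ := exists_smith G
  have : Module.Finite ℤ (AddSubgroup.toIntSubmodule (saturation G)) := inferInstance
  have : Module.Finite ℤ (saturation G) := this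
  have : AddGroup.FG (saturation G) := Module.Finite.iff_addGroup_fg.1 this
  have : AddGroup.FG (saturation G ⧸ G.addSubgroupOf (saturation G)) := inferInstance
  have : Module.Finite ℤ (saturation G ⧸ G.addSubgroupOf (saturation G)) :=
    Module.Finite.iff_addGroup_fg.2 this
  refine Module.finite_of_fg_torsion _ fun x => ?_
  obtain ⟨a, rfl⟩ := QuotientAddGroup.mk_surjective x
  refine ⟨⟨∏ i, S.a i, mem_nonZeroDivisors_of_ne_zero
    (Finset.prod_ne_zero_iff.2 fun i _ => smith_coeff_ne_zero S i)⟩, ?_⟩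
  change (((∏ i, S.a i) • a : saturation G) : saturation G ⧸ G.addSubgroupOf (saturation G)) = 0
  rw [QuotientAddGroup.eq_zero_iff]
  exact prod_smith_smul_mem S a.2

/-! ### Annihilators of sublattices and their components -/

/-- The subgroup of the torus on which all monomials with exponents in `G` are equal to `1`. -/
def annihilator {n : ℕ} (G : AddSubgroup (Fin n → ℤ)) : Subgroup (Fin n → ℂˣ) where
  carrier := {y | ∀ g ∈ G, monomialChar y g = 1}
  one_mem' g _ := monomialChar_one g
  mul_mem' hx hy g hg := by rw [monomialChar_mul, hx g hg, hy g hg, one_mul]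
  inv_mem' hx g hg := by rw [monomialChar_inv, hx g hg, inv_one]

theorem relIndex_saturation_ne_zero {n : ℕ} (G : AddSubgroup (Fin n → ℤ)) :
    G.relIndex (saturation G) ≠ 0 := by
  have := finite_saturation_quotient G
  exact AddSubgroup.index_ne_zero_iff_finite.2 this

/-- Representatives of the cosets of the annihilator of the saturation of `G` in the annihilator
of `G`; their number is the index of `G` in its saturation. -/
theorem exists_annihilator_cosets {n : ℕ} (G : AddSubgroup (Fin n → ℤ)) :
    ∃ ζ : Fin (G.relIndex (saturation G)) → Fin n → ℂˣ,
      (∀ j, ζ j ∈ annihilator G) ∧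
      ∀ y ∈ annihilator G, ∃! j, y / ζ j ∈ annihilator (saturation G) := by
  obtain ⟨r, ⟨S⟩⟩ := exists_smith G
  have := finite_saturation_quotient G
  let Q := saturation G ⧸ G.addSubgroupOf (saturation G)
  -- The field ℂ has all roots of unity, so the finite group Q has as many characters as elements.
  have hcard : Nat.card (Multiplicative Q →* ℂˣ) = G.relIndex (saturation G) := by
    rw [CommGroup.card_monoidHom_of_hasEnoughRootsOfUnity]
    rfl
  have : Finite (Multiplicative Q →* ℂˣ) :=
    Nat.finite_of_card_ne_zero (hcard ▸ relIndex_saturation_ne_zero G)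
  have E := (Finite.equivFinOfCardEq hcard).symm
  have hext : ∀ χ : Multiplicative Q →* ℂˣ, ∃ y : Fin n → ℂˣ, ∀ a : saturation G,
      monomialChar y a = χ (Multiplicative.ofAdd (a : Q)) := by
    intro χ
    exact exists_extend_saturation S
      { toFun := fun a => χ (Multiplicative.ofAdd (a : Q))
        map_zero_eq_one' := by simp
        map_add_eq_mul' := fun a b => by simp }
  choose y hy using hext
  refine ⟨fun j => y (E j), fun j g hg => ?_, fun x hx => ?_⟩
  · rw [hy (E j) ⟨g, le_saturation G hg⟩, (QuotientAddGroup.eq_zero_iff _).2, ofAdd_zero, map_one]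
    exact hg
  -- A point annihilating G induces a character of the quotient. It lies in the coset of `ζ j`
  -- exactly when this is the j-th character.
  · let χ : Multiplicative Q →* ℂˣ := AddMonoidHom.toMultiplicativeLeft
      (QuotientAddGroup.lift _ ((monomialChar x).toAddMonoidHom.comp (saturation G).subtype)
        fun a ha => hx a ha)
    have hχ : ∀ a : saturation G, χ (Multiplicative.ofAdd (a : Q)) = monomialChar x a := fun a => rfl
    refine ⟨E.symm χ, fun a ha => ?_, fun j hj => ?_⟩
    · simp only [Equiv.apply_symm_apply]
      rw [monomialChar_div, hy χ ⟨a, ha⟩, hχ, div_self']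
    · rw [Equiv.eq_symm_apply]
      refine MonoidHom.ext fun q => ?_
      obtain ⟨a, ha⟩ := QuotientAddGroup.mk_surjective (Multiplicative.toAdd q)
      obtain rfl : q = Multiplicative.ofAdd (a : Q) := by rw [ha]; rfl
      have := hj a a.2
      rw [monomialChar_div, div_eq_one] at this
      rw [hχ, this, hy]

/-- The cosets of the annihilator of a saturated lattice are irreducible. -/
theorem irreducible_coset {n : ℕ} (G : AddSubgroup (Fin n → ℤ)) (x : Fin n → ℂˣ) :
    @IsIrreducible _ (zariskiTorus n) {y | y / x ∈ annihilator (saturation G)} := by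
  obtain ⟨r, ⟨S⟩⟩ := exists_smith G
  let := zariskiTorus n
  classical
  have hc := continuous_monomial_map x fun l j =>
    if j ∈ Set.range S.f then 0 else S.bM.repr (Pi.single l 1) j
  have := (irreducible_torus n).image _ hc.continuousOn
  have h2 : (fun (w : Fin n → ℂˣ) l => x l * monomialChar w fun j =>
      if j ∈ Set.range S.f then 0 else S.bM.repr (Pi.single l 1) j) =
      fun w => x * basisPoint S.bM fun j => if j ∈ Set.range S.f then 1 else w j := by
    ext w l
    simp only [Pi.mul_apply, basisPoint, monomialChar_apply]
    congr 3
    ext j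
    split_ifs <;> simp
  rw [h2] at this
  convert! this using 1
  ext y
  simp only [Set.image_univ, Set.mem_range, Set.mem_ofPred_eq]
  constructor
  · intro hy
    -- A point of the coset is recovered from the values of y / x at the Smith basis; those at the
    -- vectors of the saturation are 1.
    refine ⟨fun j => monomialChar (y / x) (S.bM j), ?_⟩
    rw [mul_comm, ← eq_div_iff_mul_eq']
    refine monomialChar_injective (addChar_eq_of_basis S.bM fun j => ?_)
    rw [monomialChar_basisPoint_self]
    split_ifs with hj
    · obtain ⟨i, rfl⟩ := hj
      exact (hy _ (smith_mem_saturation S i)).symm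
    · rfl
  · rintro ⟨w, rfl⟩
    rw [mul_div_cancel_left]
    intro a ha
    rw [eq_sum_of_mem_saturation S ha, addChar_map_sum]
    refine Finset.prod_eq_one fun i _ => ?_
    rw [AddChar.map_zsmul_eq_zpow, monomialChar_basisPoint_self, if_pos ⟨i, rfl⟩, one_zpow]

theorem isClosed_coset {n : ℕ} (G : AddSubgroup (Fin n → ℤ)) (x : Fin n → ℂˣ) :
    IsClosed[zariskiTorus n] {y | y / x ∈ annihilator G} := by
  let := zariskiTorus n
  have : {y | y / x ∈ annihilator G} = ⋂ (g : Fin n → ℤ) (_ : g ∈ G),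
      {y | (monomialChar y g : ℂ) - monomialChar x g = 0} := by
    ext y
    simp only [Set.mem_ofPred_eq, Set.mem_iInter, sub_eq_zero, Units.val_inj]
    exact forall₂_congr fun g hg => by rw [monomialChar_div, div_eq_one]
  rw [this]
  exact isClosed_iInter fun g => isClosed_iInter fun _ => isClosed_eq_zero_torus
    (sub_mem (monomial_mem_torusFunctions g) (const_mem_laurentFunctions _))

/-- The number of connected components of a coset of the annihilator of `G` is the index of `G` in
its saturation. -/
theorem numComponents_coset {n : ℕ} (G : AddSubgroup (Fin n → ℤ)) (x : Fin n → ℂˣ) :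
    numComponents (zariskiTorus n) {y | y / x ∈ annihilator G} = G.relIndex (saturation G) := by
  let := zariskiTorus n
  obtain ⟨ζ, hζ, huniq⟩ := exists_annihilator_cosets G
  let Y : Set (Fin n → ℂˣ) := {y | y / x ∈ annihilator G}
  choose q hq hq' using fun y : Y => huniq _ y.2
  change Nat.card (ConnectedComponents Y) = _
  have hfib : ∀ j, q ⁻¹' {j} =
      Subtype.val ⁻¹' {y | y / (x * ζ j) ∈ annihilator (saturation G)} := by
    intro j
    ext y
    simp only [Set.mem_preimage, Set.mem_singleton_iff, Set.mem_ofPred_eq, ← div_div]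
    exact ⟨fun h => h ▸ hq y, fun h => (hq' y j h).symm⟩
  have hclosed : ∀ j, IsClosed (q ⁻¹' {j}) := fun j => by
    rw [hfib]
    exact (isClosed_coset _ _).preimage continuous_subtype_val
  have hcont : Continuous q := by
    refine continuous_iff_isClosed.2 fun s _ => ?_
    rw [← Set.biUnion_of_singleton s, Set.preimage_iUnion₂]
    exact s.toFinite.isClosed_biUnion fun j _ => hclosed j
  have hpre : ∀ j, IsPreconnected (q ⁻¹' {j}) := fun j => by
    rw [hfib, ← Topology.IsInducing.subtypeVal.isPreconnected_image, Subtype.image_preimage_coe,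
      Set.inter_eq_right.2]
    · exact (irreducible_coset _ _).isPreirreducible.isPreconnected
    · intro y hy
      have h1 : y / (x * ζ j) ∈ annihilator G := fun g hg => hy g (le_saturation G hg)
      have := mul_mem h1 (hζ j)
      rwa [← div_div, div_mul_cancel] at this
  -- The label `q` of the subcoset is continuous to a finite discrete space and has preconnected
  -- non-empty fibres, so these are the connected components.
  have hbij : Function.Bijective hcont.connectedComponentsLift := by
    constructor
    · intro a b hab
      obtain ⟨a, rfl⟩ := ConnectedComponents.surjective_coe a
      obtain ⟨b, rfl⟩ := ConnectedComponents.surjective_coe b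
      simp only [Continuous.connectedComponentsLift_apply_coe] at hab
      rw [ConnectedComponents.coe_eq_coe']
      exact (hpre (q b)).subset_connectedComponent rfl hab
    · intro j
      have hj : x * ζ j ∈ Y := by
        change x * ζ j / x ∈ annihilator G
        rw [mul_div_cancel_left]
        exact hζ j
      refine ⟨((⟨x * ζ j, hj⟩ : Y) : ConnectedComponents Y), ?_⟩
      rw [Continuous.connectedComponentsLift_apply_coe]
      refine (hq' _ j ?_).symm
      change x * ζ j / x / ζ j ∈ _
      rw [mul_div_cancel_left, div_self']
      exact one_mem _
  rw [Nat.card_eq_of_bijective _ hbij]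
  simp

/-! ### The lattice data of a collection of supports -/

section LatticeData

variable {n k : ℕ} (A : Fin k → Finset (Fin n → ℤ)) (I : Finset (Fin k))

theorem mem_minkowskiSum {a : Fin n → ℤ} :
    a ∈ minkowskiSum A I ↔ ∃ g : Fin k → Fin n → ℤ, (∀ i ∈ I, g i ∈ A i) ∧ ∑ i ∈ I, g i = a := by
  rw [minkowskiSum, Set.mem_finsetSum]
  exact ⟨fun ⟨g, hg, h⟩ => ⟨g, fun i hi => hg hi, h⟩, fun ⟨g, hg, h⟩ => ⟨g, fun hi => hg _ hi, h⟩⟩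

theorem minkowskiSum_nonempty (hA : ∀ i, (A i).Nonempty) : (minkowskiSum A I).Nonempty := by
  choose a ha using hA
  exact ⟨_, (mem_minkowskiSum A I).2 ⟨a, fun i _ => ha i, rfl⟩⟩

theorem minkowskiSum_finite : (minkowskiSum A I).Finite := by
  classical
  have : minkowskiSum A I = ((∑ i ∈ I, A i : Finset (Fin n → ℤ)) : Set (Fin n → ℤ)) := by
    simp [minkowskiSum]
  rw [this]
  exact Finset.finite_toSet _

theorem sub_mem_differenceGroup {i : Fin k} (hi : i ∈ I) {a b : Fin n → ℤ} (ha : a ∈ A i)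
    (hb : b ∈ A i) : a - b ∈ differenceGroup A I :=
  AddSubgroup.subset_closure ⟨i, hi, a, ha, b, hb, rfl⟩

theorem sub_mem_differenceGroup_of_mem_minkowskiSum {a b : Fin n → ℤ}
    (ha : a ∈ minkowskiSum A I) (hb : b ∈ minkowskiSum A I) : a - b ∈ differenceGroup A I := by
  obtain ⟨g, hg, rfl⟩ := (mem_minkowskiSum A I).1 ha
  obtain ⟨g', hg', rfl⟩ := (mem_minkowskiSum A I).1 hb
  rw [← Finset.sum_sub_distrib]
  exact sum_mem fun i hi => sub_mem_differenceGroup A I hi (hg i hi) (hg' i hi)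

/-- Adding the same fixed elements of the other supports to a and to b does not change the
difference. Hence single supports and the Minkowski sum yield the same difference group and the same
span. -/
theorem exists_minkowskiSum_sub_eq (hA : ∀ i, (A i).Nonempty) {i : Fin k} (hi : i ∈ I)
    {a b : Fin n → ℤ} (ha : a ∈ A i) (hb : b ∈ A i) :
    ∃ a' ∈ minkowskiSum A I, ∃ b' ∈ minkowskiSum A I, a - b = a' - b' := by
  classical
  choose c hc using hA
  have key : ∀ a ∈ A i, a + ∑ j ∈ I.erase i, c j ∈ minkowskiSum A I := by
    intro a ha
    refine (mem_minkowskiSum A I).2 ⟨Function.update c i a, fun j _ => ?_, ?_⟩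
    · by_cases h : j = i
      · subst h
        simpa using ha
      · simpa [h] using hc j
    · rw [← Finset.add_sum_erase _ _ hi, Function.update_self]
      congr 1
      exact Finset.sum_congr rfl fun j hj =>
        Function.update_of_ne (Finset.ne_of_mem_erase hj) _ _
  exact ⟨_, key a ha, _, key b hb, by abel⟩

theorem realSpan_closure (D : Set (Fin n → ℤ)) :
    realSpan (AddSubgroup.closure D) = Submodule.span ℝ (toReal n '' D) := by
  refine le_antisymm (Submodule.span_le.2 ?_)
    (Submodule.span_mono (Set.image_mono AddSubgroup.subset_closure))
  rintro _ ⟨g, hg, rfl⟩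
  induction hg using AddSubgroup.closure_induction with
  | mem g hg => exact Submodule.subset_span ⟨g, hg, rfl⟩
  | zero => rw [map_zero]; exact zero_mem _
  | add g h _ _ hg hh => rw [map_add]; exact add_mem hg hh
  | neg g _ hg => rw [map_neg]; exact neg_mem hg

theorem parallelSpace_eq (S : Set (Fin n → ℤ)) :
    parallelSpace S = Submodule.span ℝ (toReal n '' {c | ∃ a ∈ S, ∃ b ∈ S, c = a - b}) := by
  rw [parallelSpace, direction_affineSpan, vectorSpan_def]
  congr 1
  ext v
  simp only [Set.mem_vsub, Set.mem_image, vsub_eq_sub, Set.mem_ofPred_eq]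
  constructor
  · rintro ⟨_, ⟨a, ha, rfl⟩, _, ⟨b, hb, rfl⟩, rfl⟩
    exact ⟨a - b, ⟨a, ha, b, hb, rfl⟩, map_sub _ _ _⟩
  · rintro ⟨_, ⟨a, ha, b, hb, rfl⟩, rfl⟩
    exact ⟨_, ⟨a, ha, rfl⟩, _, ⟨b, hb, rfl⟩, (map_sub _ _ _).symm⟩

theorem parallelSpace_minkowskiSum (hA : ∀ i, (A i).Nonempty) :
    parallelSpace (minkowskiSum A I) = realSpan (differenceGroup A I) := by
  rw [parallelSpace_eq]
  refine le_antisymm (Submodule.span_mono (Set.image_mono ?_)) ?_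
  · rintro _ ⟨a, ha, b, hb, rfl⟩
    exact sub_mem_differenceGroup_of_mem_minkowskiSum A I ha hb
  · rw [differenceGroup, realSpan_closure]
    refine Submodule.span_mono (Set.image_mono ?_)
    rintro _ ⟨i, hi, a, ha, b, hb, rfl⟩
    exact exists_minkowskiSum_sub_eq A I hA hi ha hb

theorem iSup_parallelSpace :
    ⨆ i ∈ I, parallelSpace (A i : Set (Fin n → ℤ)) = realSpan (differenceGroup A I) := by
  rw [differenceGroup, realSpan_closure]
  simp only [parallelSpace_eq]
  refine le_antisymm (iSup₂_le fun i hi => Submodule.span_mono (Set.image_mono ?_))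
    (Submodule.span_le.2 ?_)
  · rintro _ ⟨a, ha, b, hb, rfl⟩
    exact ⟨i, hi, a, ha, b, hb, rfl⟩
  · rintro _ ⟨_, ⟨i, hi, a, ha, b, hb, rfl⟩, rfl⟩
    exact Submodule.mem_iSup_of_mem i (Submodule.mem_iSup_of_mem hi
      (Submodule.subset_span ⟨_, ⟨a, ha, b, hb, rfl⟩, rfl⟩))

theorem lattice_eq_saturation (hA : ∀ i, (A i).Nonempty) :
    lattice A I = saturation (differenceGroup A I) := by
  rw [lattice, parallelSpace_minkowskiSum A I hA, saturation]

end LatticeData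

/-! ### Linear series and Kodaira maps -/

theorem laurentSpace_mul {M : Type*} [AddCommGroup M] (S T : Set M) :
    laurentSpace S * laurentSpace T = laurentSpace (S + T) := by
  simp only [laurentSpace, AddMonoidAlgebra.supported_eq_span_single, Submodule.span_mul_span]
  congr 1
  ext f
  constructor
  · rintro ⟨_, ⟨a, ha, rfl⟩, _, ⟨b, hb, rfl⟩, rfl⟩
    exact ⟨a + b, Set.add_mem_add ha hb, by simp [AddMonoidAlgebra.single_mul_single]⟩
  · rintro ⟨_, ⟨a, ha, b, hb, rfl⟩, rfl⟩
    exact ⟨_, ⟨a, ha, rfl⟩, _, ⟨b, hb, rfl⟩, by simp [AddMonoidAlgebra.single_mul_single]⟩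

/-- Products of monomials are monomials; the empty product is the line spanned by the monomial 1. -/
theorem productSeries_eq {n k : ℕ} (A : Fin k → Finset (Fin n → ℤ)) (I : Finset (Fin k)) :
    productSeries A I = laurentSpace (minkowskiSum A I) := by
  unfold productSeries minkowskiSum
  induction I using Finset.cons_induction with
  | empty =>
    rw [Finset.prod_empty, Finset.sum_empty, laurentSpace,
      AddMonoidAlgebra.supported_eq_span_single, Submodule.one_eq_span]
    simp [← Set.singleton_zero, AddMonoidAlgebra.one_def]
  | cons i s hi ih => rw [Finset.prod_cons, Finset.sum_cons, ih, laurentSpace_mul]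

theorem evalLaurent_single {n : ℕ} (x : Fin n → ℂˣ) (a : Fin n → ℤ) (c : ℂ) :
    evalLaurent x (AddMonoidAlgebra.single a c) = c * monomialChar x a := by
  simp [evalLaurent, evalAt]

theorem evalLaurent_eq_sum {n : ℕ} (x : Fin n → ℂˣ) (f : AddMonoidAlgebra ℂ (Fin n → ℤ)) :
    evalLaurent x f = ∑ a ∈ f.coeff.support, f.coeff a * monomialChar x a := by
  rw [evalLaurent_apply, Finsupp.sum]
  simp [monomialChar_apply]

theorem eval_mul_of_isHomogeneous {κ : Type*} {p : MvPolynomial κ ℂ} {d : ℕ}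
    (hp : p.IsHomogeneous d) (c : ℂ) (v : κ → ℂ) :
    p.eval (fun i => c * v i) = c ^ d * p.eval v := by
  rw [MvPolynomial.eval_eq, MvPolynomial.eval_eq, Finset.mul_sum]
  refine Finset.sum_congr rfl fun m hm => ?_
  have : m.degree = d := by
    by_contra h
    exact MvPolynomial.mem_support_iff.1 hm (hp.coeff_eq_zero h)
  simp only [mul_pow, Finset.prod_mul_distrib, Finset.prod_pow_eq_pow_sum]
  rw [← this, Finsupp.degree_apply]
  ring

section Kodaira

variable {n k : ℕ} (A : Fin k → Finset (Fin n → ℤ)) (hA : ∀ i, (A i).Nonempty)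
  (I : Finset (Fin k))

theorem single_mem_productSeries {a : Fin n → ℤ} (ha : a ∈ minkowskiSum A I) :
    AddMonoidAlgebra.single a (1 : ℂ) ∈ productSeries A I := by
  rw [productSeries_eq, laurentSpace, AddMonoidAlgebra.supported_eq_span_single]
  exact Submodule.subset_span ⟨a, ha, rfl⟩

/-- Up to a monomial factor, the members of `E_I` are Laurent polynomials with exponents in the
difference group. -/
theorem evalLaurent_productSeries {f : AddMonoidAlgebra ℂ (Fin n → ℤ)}
    (hf : f ∈ productSeries A I) {a₀ : Fin n → ℤ} (ha₀ : a₀ ∈ minkowskiSum A I)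
    (x : Fin n → ℂˣ) :
    evalLaurent x f = monomialChar x a₀ *
      ∑ a : f.coeff.support, f.coeff a * (monomialChar x (a - a₀) : ℂ) ∧
    ∀ a : f.coeff.support, (a : Fin n → ℤ) - a₀ ∈ differenceGroup A I := by
  rw [productSeries_eq] at hf
  constructor
  · rw [evalLaurent_eq_sum, ← Finset.sum_coe_sort, Finset.mul_sum]
    refine Finset.sum_congr rfl fun a _ => ?_
    rw [AddChar.map_sub_eq_div, Units.val_div_eq_div_val]
    have := (monomialChar x a₀).ne_zero
    field_simp
  · intro a
    exact sub_mem_differenceGroup_of_mem_minkowskiSum A I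
      ((AddMonoidAlgebra.mem_supported).1 hf a.2) ha₀

/-- Proportional evaluation functionals agree on quotients of two monomials of E_I, and the
exponents of these quotients generate the difference group. -/
theorem kodaira_eq_iff (x y : Fin n → ℂˣ) :
    kodaira A hA I y = kodaira A hA I x ↔ y / x ∈ annihilator (differenceGroup A I) := by
  rw [kodaira, kodairaMap, kodairaMap, Projectivization.mk_eq_mk_iff']
  constructor
  · rintro ⟨c, hc⟩
    have key : ∀ a ∈ minkowskiSum A I, c * monomialChar x a = monomialChar y a := by
      intro a ha
      have := LinearMap.congr_fun hc ⟨_, single_mem_productSeries A I ha⟩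
      simpa [evalLaurent_single] using this
    intro g hg
    induction hg using AddSubgroup.closure_induction with
    | mem g hg =>
      obtain ⟨i, hi, a, ha, b, hb, rfl⟩ := hg
      obtain ⟨a', ha', b', hb', h⟩ := exists_minkowskiSum_sub_eq A I hA hi ha hb
      rw [h, AddChar.map_sub_eq_div, monomialChar_div, monomialChar_div, div_eq_one]
      ext
      rw [Units.val_div_eq_div_val, Units.val_div_eq_div_val, ← key _ ha', ← key _ hb']
      simp
    | zero => simp
    | add g h _ _ hg hh => rw [AddChar.map_add_eq_mul, hg, hh, one_mul]
    | neg g _ hg => rw [AddChar.map_neg_eq_inv, hg, inv_one]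
  · intro h
    obtain ⟨a₀, ha₀⟩ := minkowskiSum_nonempty A I hA
    -- Relative to the base exponent a₀ the members of E_I take equal values at x and y, so the
    -- monomial of a₀ gives the factor of proportionality.
    refine ⟨monomialChar (y / x) a₀, LinearMap.ext fun f => ?_⟩
    have h₁ := evalLaurent_productSeries A I f.2 ha₀ x
    have h₂ := evalLaurent_productSeries A I f.2 ha₀ y
    simp only [LinearMap.smul_apply, LinearMap.comp_apply, Submodule.subtype_apply,
      AlgHom.toLinearMap_apply, h₁.1, h₂.1]
    rw [smul_eq_mul, ← mul_assoc, ← Units.val_mul, ← monomialChar_mul,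
      div_mul_cancel]
    congr 1
    refine Finset.sum_congr rfl fun a _ => ?_
    have := h _ (h₁.2 a)
    rw [monomialChar_div, div_eq_one] at this
    rw [this]

theorem kodairaFiber_eq (x : Fin n → ℂˣ) :
    kodairaFiber A hA I x = {y | y / x ∈ annihilator (differenceGroup A I)} := by
  ext y
  exact kodaira_eq_iff A hA I x y

theorem numComponents_kodairaFiber (x : Fin n → ℂˣ) :
    numComponents (zariskiTorus n) (kodairaFiber A hA I x) = latticeIndex A I := by
  rw [kodairaFiber_eq, numComponents_coset, latticeIndex, lattice_eq_saturation A I hA]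

/-- Finite dimension makes E_I reflexive, so that linear functions on the ambient space of the
Kodaira map are members of E_I. -/
instance finiteDimensional_productSeries : FiniteDimensional ℂ (productSeries A I) := by
  rw [productSeries_eq, laurentSpace, AddMonoidAlgebra.supported_eq_span_single]
  exact FiniteDimensional.span_of_finite ℂ ((minkowskiSum_finite A I).image _)

/-- The values at points of the torus of a homogeneous polynomial in the members of `E_I`. -/
def homogeneousEval (p : MvPolynomial (Module.Dual ℂ (Module.Dual ℂ (productSeries A I))) ℂ)
    (x : Fin n → ℂˣ) : ℂ :=
  p.eval fun l => l ((evalLaurent x).toLinearMap ∘ₗ (productSeries A I).subtype)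

/-- The chosen representative of a projective point is a non-zero multiple of the evaluation
functional, and a form of degree d is multiplied by the d-th power of the factor. -/
theorem eval_rep_kodaira_ne_zero_iff
    {p : MvPolynomial (Module.Dual ℂ (Module.Dual ℂ (productSeries A I))) ℂ} {d : ℕ}
    (hp : p.IsHomogeneous d) (x : Fin n → ℂˣ) :
    p.eval (fun l => l (kodaira A hA I x).rep) ≠ 0 ↔ homogeneousEval A I p x ≠ 0 := by
  obtain ⟨c, hc⟩ := Projectivization.exists_smul_eq_mk_rep ℂ
    ((evalLaurent x).toLinearMap ∘ₗ (productSeries A I).subtype) (by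
      obtain ⟨f, hf, h⟩ := productSeries_basePointFree A hA I x
      intro h0
      exact h (by simpa using LinearMap.congr_fun h0 ⟨f, hf⟩))
  have : (fun l : Module.Dual ℂ (Module.Dual ℂ (productSeries A I)) =>
      l (kodaira A hA I x).rep) = fun l => (c : ℂ) *
      l ((evalLaurent x).toLinearMap ∘ₗ (productSeries A I).subtype) := by
    ext l
    rw [kodaira, kodairaMap, ← hc, Units.smul_def, map_smul, smul_eq_mul]
  rw [this, homogeneousEval, eval_mul_of_isHomogeneous hp]
  simp

/-- The monomials with exponents in the difference group are quotients of homogeneous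
polynomials in the members of `E_I`. -/
theorem exists_homogeneous_of_mem_differenceGroup (hA : ∀ i, (A i).Nonempty) {g : Fin n → ℤ}
    (hg : g ∈ differenceGroup A I) :
    ∃ (d : ℕ) (p q : MvPolynomial (Module.Dual ℂ (Module.Dual ℂ (productSeries A I))) ℂ),
      p.IsHomogeneous d ∧ q.IsHomogeneous d ∧ ∀ x, homogeneousEval A I q x ≠ 0 ∧
        homogeneousEval A I p x = monomialChar x g * homogeneousEval A I q x := by
  induction hg using AddSubgroup.closure_induction with
  | mem g hg =>
    obtain ⟨i, hi, a, ha, b, hb, rfl⟩ := hg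
    obtain ⟨a', ha', b', hb', h⟩ := exists_minkowskiSum_sub_eq A I hA hi ha hb
    rw [h]
    refine ⟨1, MvPolynomial.X (Module.Dual.eval ℂ _ ⟨_, single_mem_productSeries A I ha'⟩),
      MvPolynomial.X (Module.Dual.eval ℂ _ ⟨_, single_mem_productSeries A I hb'⟩),
      MvPolynomial.isHomogeneous_X _ _, MvPolynomial.isHomogeneous_X _ _, fun x => ?_⟩
    simp [homogeneousEval, evalLaurent_single, AddChar.map_sub_eq_div]
  | zero => exact ⟨0, 1, 1, MvPolynomial.isHomogeneous_one _ _, MvPolynomial.isHomogeneous_one _ _,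
      fun x => by simp [homogeneousEval]⟩
  | add g h _ _ hg hh =>
    obtain ⟨d, p, q, hp, hq, H⟩ := hg
    obtain ⟨d', p', q', hp', hq', H'⟩ := hh
    refine ⟨d + d', p * p', q * q', hp.mul hp', hq.mul hq', fun x => ?_⟩
    have h₁ := H x
    have h₂ := H' x
    simp only [homogeneousEval, map_mul] at h₁ h₂ ⊢
    refine ⟨mul_ne_zero h₁.1 h₂.1, ?_⟩
    rw [h₁.2, h₂.2, AddChar.map_add_eq_mul, Units.val_mul]
    ring
  | neg g _ hg =>
    obtain ⟨d, p, q, hp, hq, H⟩ := hg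
    refine ⟨d, q, p, hq, hp, fun x => ?_⟩
    rw [(H x).2, AddChar.map_neg_eq_inv, Units.val_inv_eq_inv_val]
    exact ⟨mul_ne_zero (Units.ne_zero _) (H x).1, by simp⟩

/-- The monomials with exponents in a basis of the difference group are coordinates on the image of
the Kodaira map and identify it with an r-dimensional torus, topology included. -/
theorem kodairaDim_eq {r : ℕ}
    (S : Module.Basis.SmithNormalForm (AddSubgroup.toIntSubmodule (differenceGroup A I)) (Fin n) r) :
    kodairaDim A hA I = r := by
  let v : Fin r → Fin n → ℤ := fun i => S.bN i
  have hvG : ∀ i, v i ∈ differenceGroup A I := fun i => (S.bN i).2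
  have hrepr : ∀ g (hg : g ∈ differenceGroup A I), g = ∑ i, S.bN.repr ⟨g, hg⟩ i • v i := by
    intro g hg
    have := congrArg (AddSubgroup.toIntSubmodule (differenceGroup A I)).subtype
      (S.bN.sum_repr ⟨g, hg⟩)
    rw [map_sum] at this
    simpa using this.symm
  have hmon : ∀ x g (hg : g ∈ differenceGroup A I), monomialChar x g =
      monomialChar (fun i => monomialChar x (v i)) fun i => S.bN.repr ⟨g, hg⟩ i := by
    intro x g hg
    conv_lhs => rw [hrepr g hg, addChar_map_sum]
    exact Finset.prod_congr rfl fun i _ => AddChar.map_zsmul_eq_zpow _ _ _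
  have hv : LinearIndependent ℝ fun i => toReal n (v i) := by
    have := (linearIndependent_toReal_smith S).units_smul fun i =>
      Units.mk0 (S.a i : ℝ) (by exact_mod_cast smith_coeff_ne_zero S i)
    convert this using 1
    ext1 i
    simp only [v, S.snf, map_zsmul, Pi.smul_apply', Units.smul_mk0, Int.cast_smul_eq_zsmul]
  -- A set-theoretic section of the basis monomials. No continuity of it is needed: Φ_I depends only
  -- on monomials with exponents in the difference group, and at `σ w` these are monomials in w.
  choose σ hσ using exists_monomialChar_eq hv
  let := zariskiTorus r
  let := zariskiProj (Module.Dual ℂ (productSeries A I))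
  let ψ : (Fin r → ℂˣ) → Set.range (kodaira A hA I) := fun w => ⟨kodaira A hA I (σ w), ⟨_, rfl⟩⟩
  have hinj : Function.Injective ψ := by
    intro w w' h
    have h2 : kodaira A hA I (σ w) = kodaira A hA I (σ w') := congrArg Subtype.val h
    rw [kodaira_eq_iff] at h2
    ext i
    have := h2 _ (hvG i)
    rw [monomialChar_div, hσ, hσ, div_eq_one] at this
    rw [this]
  have hsurj : Function.Surjective ψ := by
    rintro ⟨_, x, rfl⟩
    refine ⟨fun i => monomialChar x (v i), Subtype.ext ?_⟩
    change kodaira A hA I (σ _) = _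
    rw [kodaira_eq_iff]
    intro g hg
    rw [monomialChar_div, div_eq_one, hmon _ g hg, hmon x g hg]
    simp only [hσ]
  have hind : Topology.IsInducing ψ := by
    rw [← Topology.IsInducing.subtypeVal.of_comp_iff]
    refine ⟨?_⟩
    change zariskiTorus r = _
    rw [induced_generateFrom_eq, zariskiTorus_eq]
    refine le_antisymm ?_ ?_
    · refine le_generateFrom ?_
      rintro _ ⟨_, ⟨p, d, hp, rfl⟩, rfl⟩
      obtain ⟨a₀, ha₀⟩ := minkowskiSum_nonempty A I hA
      let f := fun l => ((Module.evalEquiv ℂ (productSeries A I)).symm l)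
      -- Dividing all members of E_I by the monomial of a₀ turns a form in them into a Laurent
      -- polynomial in w with the same zeros.
      refine TopologicalSpace.isOpen_generateFrom_of_mem
        ⟨fun w => p.eval fun l => ∑ a : (f l : AddMonoidAlgebra ℂ (Fin n → ℤ)).coeff.support,
          (f l : AddMonoidAlgebra ℂ (Fin n → ℤ)).coeff a *
            (monomialChar (σ w) (a - a₀) : ℂ), ?_, ?_⟩
      · refine eval_mem_laurentFunctions p fun l => ?_
        have := sum_mem fun (a : (f l : AddMonoidAlgebra ℂ (Fin n → ℤ)).coeff.support)
          (_ : a ∈ Finset.univ) => mul_mem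
            (const_mem_laurentFunctions ((f l : AddMonoidAlgebra ℂ (Fin n → ℤ)).coeff a))
            (monomial_mem_torusFunctions fun i =>
              S.bN.repr ⟨_, (evalLaurent_productSeries A I (f l).2 ha₀ 1).2 a⟩ i)
        convert! this using 1
        ext w
        rw [Finset.sum_apply]
        refine Finset.sum_congr rfl fun a _ => ?_
        rw [hmon _ _ ((evalLaurent_productSeries A I (f l).2 ha₀ 1).2 a)]
        simp only [hσ]
        rfl
      · ext w
        simp only [Set.mem_preimage, Function.comp_apply, Set.mem_ofPred_eq, ψ]
        rw [eval_rep_kodaira_ne_zero_iff A hA I hp, homogeneousEval]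
        have : (fun l : Module.Dual ℂ (Module.Dual ℂ (productSeries A I)) =>
            l ((evalLaurent (σ w)).toLinearMap ∘ₗ (productSeries A I).subtype)) = fun l =>
            (monomialChar (σ w) a₀ : ℂ) *
              ∑ a : (f l : AddMonoidAlgebra ℂ (Fin n → ℤ)).coeff.support,
              (f l : AddMonoidAlgebra ℂ (Fin n → ℤ)).coeff a *
                (monomialChar (σ w) (a - a₀) : ℂ) := by
          ext l
          rw [← (evalLaurent_productSeries A I (f l).2 ha₀ (σ w)).1]
          conv_lhs => rw [← (Module.evalEquiv ℂ (productSeries A I)).apply_symm_apply l]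
          rfl
        rw [this, eval_mul_of_isHomogeneous hp]
        simp
    · refine le_generateFrom ?_
      rintro _ ⟨F, hF, rfl⟩
      -- Conversely, every regular function of w is a quotient of two forms of equal degree whose
      -- denominator vanishes nowhere on the image.
      have key : ∃ (d : ℕ) (p q : MvPolynomial _ ℂ),
          p.IsHomogeneous d ∧ q.IsHomogeneous d ∧ ∀ w, homogeneousEval A I q (σ w) ≠ 0 ∧
          homogeneousEval A I p (σ w) = F w * homogeneousEval A I q (σ w) := by
        induction hF using Algebra.adjoin_induction with
        | mem F hF =>
          obtain (⟨i, rfl⟩ | ⟨j, rfl⟩) | ⟨j, rfl⟩ := hF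
          · exact i.elim
          · obtain ⟨d, p, q, hp, hq, H⟩ :=
              exists_homogeneous_of_mem_differenceGroup A I hA (hvG j)
            exact ⟨d, p, q, hp, hq, fun w => ⟨(H _).1, by rw [(H _).2, hσ]⟩⟩
          · obtain ⟨d, p, q, hp, hq, H⟩ :=
              exists_homogeneous_of_mem_differenceGroup A I hA (neg_mem (hvG j))
            exact ⟨d, p, q, hp, hq, fun w => ⟨(H _).1, by
              rw [(H _).2, AddChar.map_neg_eq_inv, hσ]⟩⟩
        | algebraMap c =>
          exact ⟨0, MvPolynomial.C c, 1, MvPolynomial.isHomogeneous_C _ _,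
            MvPolynomial.isHomogeneous_one _ _, fun w => by simp [homogeneousEval]⟩
        | add F G _ _ hF hG =>
          obtain ⟨d, p, q, hp, hq, H⟩ := hF
          obtain ⟨d', p', q', hp', hq', H'⟩ := hG
          refine ⟨d + d', p * q' + q * p', q * q', (hp.mul hq').add (hq.mul hp'), hq.mul hq',
            fun w => ?_⟩
          have h₁ := H w
          have h₂ := H' w
          simp only [homogeneousEval, map_mul, map_add, Pi.add_apply] at h₁ h₂ ⊢
          refine ⟨mul_ne_zero h₁.1 h₂.1, ?_⟩
          rw [h₁.2, h₂.2]
          ring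
        | mul F G _ _ hF hG =>
          obtain ⟨d, p, q, hp, hq, H⟩ := hF
          obtain ⟨d', p', q', hp', hq', H'⟩ := hG
          refine ⟨d + d', p * p', q * q', hp.mul hp', hq.mul hq', fun w => ?_⟩
          have h₁ := H w
          have h₂ := H' w
          simp only [homogeneousEval, map_mul, Pi.mul_apply] at h₁ h₂ ⊢
          refine ⟨mul_ne_zero h₁.1 h₂.1, ?_⟩
          rw [h₁.2, h₂.2]
          ring
      obtain ⟨d, p, q, hp, hq, H⟩ := key
      refine TopologicalSpace.isOpen_generateFrom_of_mem ⟨_, ⟨p, d, hp, rfl⟩, ?_⟩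
      ext w
      simp only [Set.mem_preimage, Function.comp_apply, Set.mem_ofPred_eq, ψ]
      rw [eval_rep_kodaira_ne_zero_iff A hA I hp, (H w).2]
      simp [(H w).1]
  have hhomeo : IsHomeomorph ψ :=
    isHomeomorph_iff_isEmbedding_surjective.2 ⟨⟨hind, hinj⟩, hsurj⟩
  rw [← topologicalKrullDim_torus r, hhomeo.topologicalKrullDim_eq]
  rfl

theorem tau_eq : tau A hA I = Module.finrank ℝ (realSpan (differenceGroup A I)) := by
  obtain ⟨r, ⟨S⟩⟩ := exists_smith (differenceGroup A I)
  rw [tau, kodairaDim_eq A hA I S, finrank_realSpan S]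
  rfl

/-- Ensures that the truncations in `tau` lose nothing: the dimension is neither ⊥ nor ∞. -/
theorem kodairaDim_eq_tau : kodairaDim A hA I = (tau A hA I : WithBot ℕ∞) := by
  obtain ⟨r, ⟨S⟩⟩ := exists_smith (differenceGroup A I)
  rw [tau_eq, finrank_realSpan S, kodairaDim_eq A hA I S]

theorem geomDefect_eq_linDefect :
    geomDefect A hA I = linDefect (fun i => parallelSpace (A i : Set (Fin n → ℤ))) I := by
  rw [geomDefect, linDefect, tau_eq, iSup_parallelSpace]

end Kodaira

/-! ### Independent partial transversals -/

/-- **Rado's theorem** with deficiency: if the vectors of any subfamily `I` of a finite family of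
finite sets of vectors have rank at least `|I| - c`, then there is a linearly independent partial
transversal which omits at most `c` of the sets. -/
theorem exists_linearIndependent_transversal {V ι : Type*} [AddCommGroup V] [Module ℝ V]
    [FiniteDimensional ℝ V] [Fintype ι] (c : ℕ) (S : ι → Finset V)
    (hS : ∀ I : Finset ι,
      I.card ≤ Module.finrank ℝ (Submodule.span ℝ (⋃ i ∈ I, (S i : Set V))) + c) :
    ∃ (K : Finset ι) (v : ι → V), Fintype.card ι ≤ K.card + c ∧ (∀ i ∈ K, v i ∈ S i) ∧
      LinearIndependent ℝ fun i : K => v i := by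
  classical
  induction hN : ∑ i, (S i).card using Nat.strong_induction_on generalizing S with
  | _ N ih =>
  -- While some set has two elements x and y, one of them can be deleted without violating the rank
  -- condition; the total size then drops.
  by_cases hbig : ∃ i, 1 < (S i).card
  · obtain ⟨i, hi⟩ := hbig
    obtain ⟨x, hx, y, hy, hxy⟩ := Finset.one_lt_card.1 hi
    let S' : V → ι → Finset V := fun z => Function.update S i ((S i).erase z)
    have hsub : ∀ z j, S' z j ⊆ S j := by
      intro z j
      by_cases h : j = i
      · subst h
        simpa [S'] using Finset.erase_subset _ _
      · simp [S', h]
    have hne : ∀ z j, j ≠ i → S' z j = S j := fun z j h => by simp [S', h]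
    by_cases hgood : ∃ z ∈ S i, ∀ I : Finset ι,
        I.card ≤ Module.finrank ℝ (Submodule.span ℝ (⋃ j ∈ I, (S' z j : Set V))) + c
    · obtain ⟨z, hz, hgood⟩ := hgood
      have hlt : ∑ j, (S' z j).card < N := by
        rw [← hN]
        refine Finset.sum_lt_sum (fun j _ => Finset.card_le_card (hsub z j))
          ⟨i, Finset.mem_univ _, ?_⟩
        simpa [S'] using Finset.card_erase_lt_of_mem hz
      obtain ⟨K, v, hK, hv, hli⟩ := ih _ hlt (S' z) hgood rfl
      exact ⟨K, v, hK, fun j hj => hsub z j (hv j hj), hli⟩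
    -- If neither deletion is possible, there are violating families I and I', both containing i.
    -- The span over I ∪ I' lies in X + Y, since x survives in Y and all else of `S i` in X; the
    -- span over (I ∩ I') without i lies in X ∩ Y. The dimension formula and the hypothesis on these
    -- two families contradict the violations by one.
    · exfalso
      push Not at hgood
      obtain ⟨I, hI⟩ := hgood x hx
      obtain ⟨I', hI'⟩ := hgood y hy
      have hmem : ∀ z (I : Finset ι),
          Module.finrank ℝ (Submodule.span ℝ (⋃ j ∈ I, (S' z j : Set V))) + c < I.card →
          i ∈ I := by
        intro z I hI
        by_contra hiI
        refine (hS I).not_gt ?_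
        have h : ⋃ j ∈ I, (S j : Set V) = ⋃ j ∈ I, (S' z j : Set V) :=
          Set.iUnion₂_congr fun j hj => by rw [hne _ _ (ne_of_mem_of_not_mem hj hiI)]
        rwa [h]
      have hiI := hmem x I hI
      have hiI' := hmem y I' hI'
      set X := Submodule.span ℝ (⋃ j ∈ I, (S' x j : Set V))
      set Y := Submodule.span ℝ (⋃ j ∈ I', (S' y j : Set V))
      have hXmem : ∀ j ∈ I, ∀ w ∈ S' x j, w ∈ X := fun j hj w hw =>
        Submodule.subset_span (Set.mem_biUnion (x := j) hj hw)
      have hYmem : ∀ j ∈ I', ∀ w ∈ S' y j, w ∈ Y := fun j hj w hw =>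
        Submodule.subset_span (Set.mem_biUnion (x := j) hj hw)
      have hsup : Submodule.span ℝ (⋃ j ∈ I ∪ I', (S j : Set V)) ≤ X ⊔ Y := by
        refine Submodule.span_le.2 fun w hw => ?_
        simp only [Set.mem_iUnion] at hw
        obtain ⟨j, hj, hw⟩ := hw
        by_cases h : j = i
        · subst h
          by_cases hwx : w = x
          · refine Submodule.mem_sup_right (hYmem j hiI' w ?_)
            simp only [S', Function.update_self, Finset.mem_erase]
            exact ⟨by rw [hwx]; exact hxy, hw⟩
          · refine Submodule.mem_sup_left (hXmem j hiI w ?_)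
            simp only [S', Function.update_self, Finset.mem_erase]
            exact ⟨hwx, hw⟩
        · rcases Finset.mem_union.1 hj with hj | hj
          · exact Submodule.mem_sup_left (hXmem j hj w (by rw [hne _ _ h]; exact hw))
          · exact Submodule.mem_sup_right (hYmem j hj w (by rw [hne _ _ h]; exact hw))
      have hinf : Submodule.span ℝ (⋃ j ∈ (I ∩ I').erase i, (S j : Set V)) ≤ X ⊓ Y := by
        refine Submodule.span_le.2 fun w hw => ?_
        simp only [Set.mem_iUnion] at hw
        obtain ⟨j, hj, hw⟩ := hw
        obtain ⟨h, hj⟩ := Finset.mem_erase.1 hj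
        obtain ⟨hj, hj'⟩ := Finset.mem_inter.1 hj
        exact ⟨hXmem j hj w (by rw [hne _ _ h]; exact hw),
          hYmem j hj' w (by rw [hne _ _ h]; exact hw)⟩
      have h₁ := Submodule.finrank_mono hsup
      have h₂ := Submodule.finrank_mono hinf
      have h₃ := Submodule.finrank_sup_add_finrank_inf_eq X Y
      have h₄ := hS (I ∪ I')
      have h₅ := hS ((I ∩ I').erase i)
      have h₆ := Finset.card_union_add_card_inter I I'
      have h₇ := Finset.card_erase_add_one (Finset.mem_inter.2 ⟨hiI, hiI'⟩)
      omega
  · push Not at hbig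
    -- An empty set is represented by the zero vector, which cannot occur in an independent family.
    have hv : ∀ i, ∃ v : V, (S i : Set V) ⊆ {v} ∧ (v ∈ S i ∨ v = 0) := by
      intro i
      rcases Nat.le_one_iff_eq_zero_or_eq_one.1 (hbig i) with h | h
      · exact ⟨0, by simp [Finset.card_eq_zero.1 h], Or.inr rfl⟩
      · obtain ⟨v, hv⟩ := Finset.card_eq_one.1 h
        exact ⟨v, by simp [hv], Or.inl (by simp [hv])⟩
    choose v hv hv' using hv
    obtain ⟨κ, a, ha, hspan, hli⟩ := exists_linearIndependent' ℝ v
    have : Finite κ := Finite.of_injective a ha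
    let := Fintype.ofFinite κ
    refine ⟨Finset.univ.image a, v, ?_, ?_, ?_⟩
    · refine (hS Finset.univ).trans (Nat.add_le_add_right ?_ c)
      rw [Finset.card_image_of_injective _ ha, Finset.card_univ, ← finrank_span_eq_card hli, hspan]
      refine Submodule.finrank_mono (Submodule.span_mono ?_)
      intro w hw
      simp only [Set.mem_iUnion] at hw
      obtain ⟨i, -, hw⟩ := hw
      exact ⟨i, (hv i hw).symm⟩
    · intro i hi
      obtain ⟨j, -, rfl⟩ := Finset.mem_image.1 hi
      exact (hv' (a j)).resolve_right (hli.ne_zero j)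
    · choose b hb using fun i : Finset.univ.image a => Finset.mem_image.1 i.2
      have := hli.comp b fun i j hij => Subtype.ext (by rw [← (hb i).2, ← (hb j).2, hij])
      convert! this using 1
      ext1 i
      exact congrArg v (hb i).2.symm

/-! ### Laurent polynomial functions on the product of an affine space and a torus -/

/-- The ring of Laurent polynomial functions on `ℂ^σ × (ℂˣ)^τ`. -/
abbrev LaurentRing (σ τ : Type) : Subalgebra ℂ ((σ → ℂ) × (τ → ℂˣ) → ℂ) :=
  laurentFunctions (fun i x => x.1 i) (fun j x => x.2 j)

theorem isAlgebraic_of_mul_mem {R : Type*} [CommRing R] [Algebra ℂ R] {S : Subalgebra ℂ R}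
    {d F : R} (hd : d ∈ S) (hd0 : d ≠ 0) (h : d * F ∈ S) : IsAlgebraic S F := by
  refine ⟨Polynomial.C ⟨d, hd⟩ * Polynomial.X - Polynomial.C ⟨_, h⟩, fun h0 => ?_, ?_⟩
  · have := congrArg (fun q => Polynomial.coeff q 1) h0
    simp only [Polynomial.coeff_sub, Polynomial.coeff_C_mul, Polynomial.coeff_X_one,
      Polynomial.coeff_zero, mul_one] at this
    rw [Polynomial.coeff_C_of_ne_zero one_ne_zero, sub_zero] at this
    exact hd0 (congrArg Subtype.val this)
  · simp only [map_sub, map_mul, Polynomial.aeval_C, Polynomial.aeval_X]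
    exact sub_self _

section LaurentRing

variable {σ τ : Type}

theorem aeval_laurentRing_apply {κ : Type*} (c : κ → LaurentRing σ τ) (p : MvPolynomial κ ℂ)
    (x : (σ → ℂ) × (τ → ℂˣ)) : (MvPolynomial.aeval c p).1 x = p.eval fun i => (c i).1 x := by
  have := MvPolynomial.comp_aeval_apply (R := ℂ) c
    ((Pi.evalAlgHom ℂ (fun _ : (σ → ℂ) × (τ → ℂˣ) => ℂ) x).comp (LaurentRing σ τ).val) p
  rw [MvPolynomial.aeval_eq_eval] at this
  exact this

variable [Fintype τ]

theorem exists_polynomial_of_laurentRing (F : LaurentRing σ τ) :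
    ∃ (M : ℕ) (p : MvPolynomial (σ ⊕ τ) ℂ), ∀ x : (σ → ℂ) × (τ → ℂˣ),
      p.eval (Sum.elim x.1 fun j => (x.2 j : ℂ)) = F.1 x * ∏ j, (x.2 j : ℂ) ^ M :=
  exists_polynomial_of_mem_laurentFunctions F.2

theorem prod_units_pow_ne_zero (z : τ → ℂˣ) (M : ℕ) : ∏ j, (z j : ℂ) ^ M ≠ 0 :=
  Finset.prod_ne_zero_iff.2 fun j _ => pow_ne_zero _ (z j).ne_zero

/-- Two non-zero functions become non-zero polynomials after clearing denominators, hence have a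
common point of non-vanishing. -/
instance isDomain_laurentRing : IsDomain (LaurentRing σ τ) := by
  have : NoZeroDivisors (LaurentRing σ τ) := by
    refine ⟨fun {F G} h => ?_⟩
    obtain ⟨M, p, hp⟩ := exists_polynomial_of_laurentRing F
    obtain ⟨N, q, hq⟩ := exists_polynomial_of_laurentRing G
    by_contra! hc
    obtain ⟨x, hx⟩ : ∃ x, F.1 x ≠ 0 := by
      by_contra! h0
      exact hc.1 (Subtype.ext (funext h0))
    obtain ⟨y, hy⟩ : ∃ y, G.1 y ≠ 0 := by
      by_contra! h0
      exact hc.2 (Subtype.ext (funext h0))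
    have hp0 : p ≠ 0 := fun h0 =>
      mul_ne_zero hx (prod_units_pow_ne_zero x.2 M) (by rw [← hp, h0, map_zero])
    have hq0 : q ≠ 0 := fun h0 =>
      mul_ne_zero hy (prod_units_pow_ne_zero y.2 N) (by rw [← hq, h0, map_zero])
    obtain ⟨a, w, hw⟩ := exists_eval_ne_zero_of_units (mul_ne_zero hp0 hq0)
    have h1 := hp (a, w)
    have h2 := hq (a, w)
    simp only at h1 h2
    rw [map_mul, h1, h2] at hw
    have h3 : F.1 (a, w) * G.1 (a, w) = 0 := congrFun (congrArg Subtype.val h) (a, w)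
    refine hw ?_
    rw [mul_mul_mul_comm, h3, zero_mul]
  exact NoZeroDivisors.to_isDomain _

/-- The coordinates of the affine space and of the torus, as elements of the Laurent ring. -/
def laurentCoord : σ ⊕ τ → LaurentRing σ τ :=
  Sum.elim (fun i => ⟨_, coord_mem_laurentFunctions i⟩) fun j => ⟨_, unit_mem_laurentFunctions j⟩

/-- Denominators are monomials in the unit coordinates, so every function is a fraction of
polynomials in the coordinates. This bounds the transcendence degree by the number of coordinates.
-/
theorem isAlgebraic_adjoin_laurentCoord :
    Algebra.IsAlgebraic (Algebra.adjoin ℂ (Set.range (laurentCoord (σ := σ) (τ := τ))))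
      (LaurentRing σ τ) := by
  refine ⟨fun F => ?_⟩
  obtain ⟨M, p, hp⟩ := exists_polynomial_of_laurentRing F
  have hmem : ∀ q : MvPolynomial (σ ⊕ τ) ℂ, MvPolynomial.aeval laurentCoord q ∈
      Algebra.adjoin ℂ (Set.range (laurentCoord (σ := σ) (τ := τ))) := fun q => by
    rw [Algebra.adjoin_range_eq_range_aeval]
    exact ⟨q, rfl⟩
  let D : MvPolynomial (σ ⊕ τ) ℂ := ∏ j, MvPolynomial.X (Sum.inr j) ^ M
  have hval : ∀ (q : MvPolynomial (σ ⊕ τ) ℂ) (x : (σ → ℂ) × (τ → ℂˣ)),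
      (MvPolynomial.aeval laurentCoord q).1 x = q.eval (Sum.elim x.1 fun j => (x.2 j : ℂ)) := by
    intro q x
    rw [aeval_laurentRing_apply]
    congr 2
    ext (i | j) <;> rfl
  have hD : MvPolynomial.aeval laurentCoord D * F = MvPolynomial.aeval laurentCoord p := by
    refine Subtype.ext (funext fun x => ?_)
    change (MvPolynomial.aeval laurentCoord D).1 x * F.1 x = _
    rw [hval, hval, hp]
    simp [D, mul_comm]
  have hD0 : MvPolynomial.aeval (laurentCoord (σ := σ) (τ := τ)) D ≠ 0 := by
    intro h0
    have := congrFun (congrArg Subtype.val h0) (0, 1)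
    rw [hval] at this
    simp [D] at this
  refine isAlgebraic_of_mul_mem (hmem D) hD0 ?_
  rw [hD]
  exact hmem p

variable [Fintype σ]

theorem trdeg_laurentRing_le :
    Algebra.trdeg ℂ (LaurentRing σ τ) ≤ (Fintype.card σ + Fintype.card τ : ℕ) := by
  have := isAlgebraic_adjoin_laurentCoord (σ := σ) (τ := τ)
  refine (Algebra.IsAlgebraic.trdeg_le_cardinalMk (R := ℂ) (A := LaurentRing σ τ)
    (Set.range (laurentCoord (σ := σ) (τ := τ)))).trans ?_
  refine Cardinal.mk_range_le.trans ?_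
  simp

/-- More Laurent polynomials than there are variables satisfy a polynomial relation. -/
theorem exists_relation_of_card_lt {C : Type} [Fintype C] (c : C → LaurentRing σ τ)
    (h : Fintype.card σ + Fintype.card τ < Fintype.card C) :
    ∃ P : MvPolynomial C ℂ, P ≠ 0 ∧ ∀ x, P.eval (fun i => (c i).1 x) = 0 := by
  have hc : ¬ AlgebraicIndependent ℂ c := fun hc => by
    have := (hc.cardinalMk_le_trdeg).trans trdeg_laurentRing_le
    rw [Cardinal.mk_fintype] at this
    exact absurd (by exact_mod_cast this) h.not_ge
  rw [algebraicIndependent_iff] at hc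
  push Not at hc
  obtain ⟨P, hP, hP0⟩ := hc
  refine ⟨P, hP0, fun x => ?_⟩
  rw [← aeval_laurentRing_apply, hP]
  rfl

theorem isAlgebraic_adjoin_of_card_eq {C : Type} [Fintype C] {c : C → LaurentRing σ τ}
    (hc : AlgebraicIndependent ℂ c) (h : Fintype.card C = Fintype.card σ + Fintype.card τ) :
    Algebra.IsAlgebraic (Algebra.adjoin ℂ (Set.range c)) (LaurentRing σ τ) := by
  refine (hc.isTranscendenceBasis_of_trdeg_le_of_finite ?_).isAlgebraic
  rw [Cardinal.mk_fintype, h]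
  exact trdeg_laurentRing_le

/-- Every non-zero Laurent polynomial divides a non-zero polynomial in the members of a
transcendence basis. -/
theorem exists_dvd_aeval {C : Type} [Fintype C] {c : C → LaurentRing σ τ}
    (hc : AlgebraicIndependent ℂ c) (h : Fintype.card C = Fintype.card σ + Fintype.card τ)
    {F : LaurentRing σ τ} (hF : F ≠ 0) :
    ∃ P : MvPolynomial C ℂ, P ≠ 0 ∧ F ∣ MvPolynomial.aeval c P := by
  have := isAlgebraic_adjoin_of_card_eq hc h
  obtain ⟨⟨d, hd⟩, hd0, hdvd⟩ := (Algebra.IsAlgebraic.isAlgebraic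
    (R := Algebra.adjoin ℂ (Set.range c)) F).exists_nonzero_dvd (mem_nonZeroDivisors_of_ne_zero hF)
  rw [Algebra.adjoin_range_eq_range_aeval] at hd
  obtain ⟨P, rfl⟩ := hd
  refine ⟨P, ?_, hdvd⟩
  rintro rfl
  exact hd0 (Subtype.ext (map_zero (MvPolynomial.aeval c)))

/-- A homomorphism to `ℂ` whose kernel contains the kernel of `R → S` extends to the integral
closure of `R` in `S`. -/
theorem exists_extend_integralClosure {R S : Type*} [CommRing R] [CommRing S] [Algebra R S]
    (ev : R →+* ℂ) (hev : Function.Surjective ev)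
    (hker : RingHom.ker (algebraMap R S) ≤ RingHom.ker ev) :
    ∃ (B : Subring S) (γ : S → ℂ), (∀ b, IsIntegral R b → b ∈ B) ∧
      (∀ b ∈ B, ∀ c ∈ B, γ (b + c) = γ b + γ c) ∧ (∀ b ∈ B, ∀ c ∈ B, γ (b * c) = γ b * γ c) ∧
      ∀ r, γ (algebraMap R S r) = ev r := by
  classical
  let B := integralClosure R S
  have : (RingHom.ker ev).IsMaximal := RingHom.ker_isMaximal_of_surjective _ hev
  -- Lying over: the residue field at Q is integral over ℂ, hence equal to ℂ.
  obtain ⟨Q, hQ, hQ𝔪⟩ := Ideal.exists_ideal_over_maximal_of_isIntegral (S := B) (RingHom.ker ev) (by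
    intro p hp
    exact hker (congrArg Subtype.val hp))
  let := Ideal.Quotient.field Q
  let ρ : R →+* B ⧸ Q := (Ideal.Quotient.mk Q).comp (algebraMap _ B)
  have hρ : RingHom.ker ev = RingHom.ker ρ := by
    rw [← hQ𝔪]
    ext r
    rw [RingHom.mem_ker, Ideal.mem_comap, ← Ideal.Quotient.eq_zero_iff_mem]
    rfl
  let f₀ : ℂ →+* B ⧸ Q := ev.liftOfSurjective hev ⟨ρ, hρ.le⟩
  have hf₀ : f₀.comp ev = ρ := RingHom.liftOfRightInverse_comp _ _ _ _
  have hf₀int : f₀.IsIntegral := by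
    refine RingHom.IsIntegral.tower_top ev f₀ ?_
    rw [hf₀]
    exact RingHom.IsIntegral.trans _ _ (algebraMap_isIntegral_iff.2 inferInstance)
      (RingHom.isIntegral_of_surjective _ Ideal.Quotient.mk_surjective)
  have hbij := IsAlgClosed.ringHom_bijective_of_isIntegral f₀ hf₀int
  let γ : B →+* ℂ := (RingEquiv.ofBijective f₀ hbij).symm.toRingHom.comp (Ideal.Quotient.mk Q)
  have hγ : ∀ p, γ (algebraMap _ B p) = ev p := by
    intro p
    change (RingEquiv.ofBijective f₀ hbij).symm (ρ p) = _
    rw [← hf₀]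
    exact (RingEquiv.ofBijective f₀ hbij).symm_apply_apply _
  have hdif : ∀ b (hb : b ∈ B), (if h : b ∈ B then γ ⟨b, h⟩ else 0) = γ ⟨b, hb⟩ :=
    fun b hb => dif_pos hb
  -- The extension is a total function with the default value 0 off B; additivity and
  -- multiplicativity are claimed only on B.
  refine ⟨B.toSubring, fun b => if h : b ∈ B then γ ⟨b, h⟩ else 0, fun b hb => hb,
    fun b hb c hc => ?_, fun b hb c hc => ?_, fun r => ?_⟩
  · beta_reduce
    rw [hdif b hb, hdif c hc, hdif _ (add_mem hb hc)]
    exact γ.map_add ⟨b, hb⟩ ⟨c, hc⟩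
  · beta_reduce
    rw [hdif b hb, hdif c hc, hdif _ (mul_mem hb hc)]
    exact γ.map_mul ⟨b, hb⟩ ⟨c, hc⟩
  · beta_reduce
    rw [hdif _ (B.algebraMap_mem r)]
    exact hγ r

/-- **Generic existence.** Let `s` be a family of Laurent polynomials on `ℂ^σ × (ℂˣ)^τ`, a
subfamily of which is a transcendence basis. A generic point of the Zariski closure of the image of
`s` is the image of a point at which a given non-zero Laurent polynomial `F` does not vanish. -/
theorem exists_point_of_generic {C Γ : Type} [Fintype C] (s : Γ → LaurentRing σ τ) (e : C → Γ)
    (hc : AlgebraicIndependent ℂ (s ∘ e))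
    (h : Fintype.card C = Fintype.card σ + Fintype.card τ) {F : LaurentRing σ τ} (hF : F ≠ 0) :
    ∃ P : MvPolynomial C ℂ, P ≠ 0 ∧ ∀ v : Γ → ℂ,
      (∀ p : MvPolynomial Γ ℂ, MvPolynomial.aeval s p = 0 → p.eval v = 0) →
      P.eval (v ∘ e) ≠ 0 → ∃ x, (∀ γ, (s γ).1 x = v γ) ∧ F.1 x ≠ 0 := by
  classical
  obtain ⟨P₁, hP₁, F', hF'⟩ := exists_dvd_aeval hc h hF
  have halg := isAlgebraic_adjoin_of_card_eq hc h
  let zinv : τ → LaurentRing σ τ := fun j => ⟨_, unit_inv_mem_laurentFunctions j⟩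
  -- A common denominator that makes all coordinates and all inverses of the unit coordinates
  -- integral over the polynomials in the transcendence basis.
  obtain ⟨⟨y, hy⟩, hy0, hyint⟩ := Algebra.IsAlgebraic.exists_integral_multiples
    (Algebra.adjoin ℂ (Set.range (s ∘ e)))
    (Finset.univ.image (laurentCoord (σ := σ) (τ := τ)) ∪ Finset.univ.image zinv)
  obtain ⟨P₂, rfl⟩ : ∃ P₂ : MvPolynomial C ℂ, MvPolynomial.aeval (s ∘ e) P₂ = y := by
    rw [Algebra.adjoin_range_eq_range_aeval] at hy
    exact hy
  have hP₂ : P₂ ≠ 0 := by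
    rintro rfl
    exact hy0 (Subtype.ext (map_zero (MvPolynomial.aeval (s ∘ e))))
  refine ⟨P₁ * P₂, mul_ne_zero hP₁ hP₂, fun v hv hP => ?_⟩
  rw [map_mul, mul_ne_zero_iff] at hP
  let φ : MvPolynomial Γ ℂ →ₐ[ℂ] LaurentRing σ τ := MvPolynomial.aeval s
  let := φ.toRingHom.toAlgebra
  -- Evaluation at v kills all relations among the `s γ`, so it extends to the integral closure.
  obtain ⟨B, γ, hB, hadd, hmul, hγ⟩ := exists_extend_integralClosure (S := LaurentRing σ τ)
    (MvPolynomial.eval v) (fun c => ⟨MvPolynomial.C c, MvPolynomial.eval_C _⟩) hv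
  replace hγ : ∀ p, γ (φ p) = p.eval v := hγ
  have hφB : ∀ p, φ p ∈ B := fun p => hB _ isIntegral_algebraMap
  have hint : ∀ b, IsIntegral (Algebra.adjoin ℂ (Set.range (s ∘ e))) b → b ∈ B := by
    intro b hb
    refine hB _ (hb.map_of_comp_eq ((MvPolynomial.rename e).comp hc.aevalEquiv.symm.toAlgHom).toRingHom
      (RingHom.id _) (RingHom.ext fun d => ?_))
    obtain ⟨p, rfl⟩ := hc.aevalEquiv.surjective d
    change φ (MvPolynomial.rename e (hc.aevalEquiv.symm (hc.aevalEquiv p))) = _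
    rw [AlgEquiv.symm_apply_apply]
    exact (MvPolynomial.aeval_rename _ _ _).trans (hc.algebraMap_aevalEquiv p).symm
  let Y : MvPolynomial Γ ℂ := P₂.rename e
  have hY : φ Y = MvPolynomial.aeval (s ∘ e) P₂ := MvPolynomial.aeval_rename _ _ _
  have hYv : Y.eval v ≠ 0 := by
    rw [MvPolynomial.eval_rename]
    exact hP.2
  have hmem : ∀ b ∈ Finset.univ.image (laurentCoord (σ := σ) (τ := τ)) ∪ Finset.univ.image zinv,
      φ Y * b ∈ B := by
    intro b hb
    rw [hY]
    exact hint _ (hyint b hb)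
  have hmemc : ∀ i, φ Y * laurentCoord i ∈ B := fun i => hmem _ (by simp)
  have hmemz : ∀ j, φ Y * zinv j ∈ B := fun j => hmem _ (by simp)
  -- The coordinates of the preimage are the values of γ after the denominator has been divided out
  -- again. The inverse coordinates are treated alike, so the unit coordinates come out invertible.
  let u : τ → ℂ := fun j => γ (φ Y * laurentCoord (Sum.inr j)) / Y.eval v
  let u' : τ → ℂ := fun j => γ (φ Y * zinv j) / Y.eval v
  have huu' : ∀ j, u j * u' j = 1 := by
    intro j
    have : φ Y * laurentCoord (Sum.inr j) * (φ Y * zinv j) = φ (Y * Y) := by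
      refine Subtype.ext (funext fun x => ?_)
      change (φ Y).1 x * (x.2 j : ℂ) * ((φ Y).1 x * ((x.2 j)⁻¹ : ℂˣ)) = (φ (Y * Y)).1 x
      rw [map_mul]
      change _ = (φ Y).1 x * (φ Y).1 x
      have := (x.2 j).ne_zero
      rw [Units.val_inv_eq_inv_val]
      field_simp
    have := congrArg γ this
    rw [hmul _ (hmemc _) _ (hmemz _), hγ, MvPolynomial.eval_mul] at this
    simp only [u, u']
    rw [div_mul_div_comm, this, div_self (mul_ne_zero hYv hYv)]
  let x : (σ → ℂ) × (τ → ℂˣ) := (fun i => γ (φ Y * laurentCoord (Sum.inl i)) / Y.eval v,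
    fun j => ⟨u j, u' j, huu' j, by rw [mul_comm, huu']⟩)
  have hpow : ∀ M, φ (Y ^ M) = φ Y ^ M := fun M => map_pow _ _ _
  -- Up to powers of the denominator, γ is evaluation at the constructed point.
  have key : ∀ G : (σ → ℂ) × (τ → ℂˣ) → ℂ, G ∈ LaurentRing σ τ →
      ∃ M : ℕ, ∃ b ∈ B, b.1 = (φ Y).1 ^ M * G ∧ γ b = Y.eval v ^ M * G x := by
    intro G hG
    induction hG using Algebra.adjoin_induction with
    | mem G hG =>
      obtain (⟨i, rfl⟩ | ⟨j, rfl⟩) | ⟨j, rfl⟩ := hG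
      · refine ⟨1, _, hmemc (Sum.inl i), by rw [pow_one]; rfl, ?_⟩
        rw [pow_one]
        exact (mul_div_cancel₀ _ hYv).symm
      · refine ⟨1, _, hmemc (Sum.inr j), by rw [pow_one]; rfl, ?_⟩
        rw [pow_one]
        exact (mul_div_cancel₀ _ hYv).symm
      · refine ⟨1, _, hmemz j, by rw [pow_one]; rfl, ?_⟩
        rw [pow_one]
        exact (mul_div_cancel₀ _ hYv).symm
    | algebraMap c =>
      refine ⟨0, φ (MvPolynomial.C c), hφB _, ?_, ?_⟩
      · rw [pow_zero, one_mul]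
        exact congrArg Subtype.val (MvPolynomial.aeval_C s c)
      · rw [hγ, MvPolynomial.eval_C, pow_zero, one_mul]
        rfl
    | add G G' _ _ hG hG' =>
      obtain ⟨M, b, hbB, hb, hb'⟩ := hG
      obtain ⟨N, c, hcB, hc, hc'⟩ := hG'
      have h₁ : φ (Y ^ N) * b ∈ B := mul_mem (hφB _) hbB
      have h₂ : φ (Y ^ M) * c ∈ B := mul_mem (hφB _) hcB
      refine ⟨M + N, φ (Y ^ N) * b + φ (Y ^ M) * c, add_mem h₁ h₂, ?_, ?_⟩
      · rw [hpow, hpow]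
        change (φ Y).1 ^ N * b.1 + (φ Y).1 ^ M * c.1 = _
        rw [hb, hc]
        ring
      · rw [hadd _ h₁ _ h₂, hmul _ (hφB _) _ hbB, hmul _ (hφB _) _ hcB, hγ, hγ, hb', hc',
          map_pow, map_pow, Pi.add_apply]
        ring
    | mul G G' _ _ hG hG' =>
      obtain ⟨M, b, hbB, hb, hb'⟩ := hG
      obtain ⟨N, c, hcB, hc, hc'⟩ := hG'
      refine ⟨M + N, b * c, mul_mem hbB hcB, ?_, ?_⟩
      · change b.1 * c.1 = _
        rw [hb, hc]
        ring
      · rw [hmul _ hbB _ hcB, hb', hc', Pi.mul_apply]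
        ring
  have hsx : ∀ g, (s g).1 x = v g := by
    intro g
    obtain ⟨M, b, -, hb, hb'⟩ := key _ (s g).2
    have : b = φ (Y ^ M * MvPolynomial.X g) := by
      refine Subtype.ext ?_
      rw [hb, map_mul, hpow]
      change _ = (φ Y).1 ^ M * (φ (MvPolynomial.X g)).1
      rw [show φ (MvPolynomial.X g) = s g from MvPolynomial.aeval_X _ _]
    rw [this, hγ, map_mul, map_pow, MvPolynomial.eval_X] at hb'
    exact (mul_left_cancel₀ (pow_ne_zero _ hYv) hb').symm
  refine ⟨x, hsx, fun h0 => hP.1 ?_⟩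
  have := congrFun (congrArg Subtype.val hF') x
  rw [aeval_laurentRing_apply] at this
  change _ = F.1 x * F'.1 x at this
  rw [h0, zero_mul] at this
  rw [← this]
  congr 2
  ext i
  exact (hsx (e i)).symm

end LaurentRing

/-! ### Laurent functions built from monomials -/

section Membership

variable {X σ τ : Type*} {h : σ → X → ℂ} {z : τ → X → ℂˣ}

theorem sum_mem_laurentFunctions {κ : Type*} (s : Finset κ) {F : κ → X → ℂ}
    (hF : ∀ i ∈ s, F i ∈ laurentFunctions h z) :
    (fun x => ∑ i ∈ s, F i x) ∈ laurentFunctions h z := by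
  convert! sum_mem hF using 1
  ext x
  simp

theorem monomialChar_mem_laurentFunctions {n : ℕ} {y : X → Fin n → ℂˣ}
    (hy : ∀ l, (fun x => (y x l : ℂ)) ∈ laurentFunctions h z)
    (hy' : ∀ l, (fun x => (((y x l)⁻¹ : ℂˣ) : ℂ)) ∈ laurentFunctions h z) (a : Fin n → ℤ) :
    (fun x => (monomialChar (y x) a : ℂ)) ∈ laurentFunctions h z :=
  comp_mem_laurentFunctions (φ := y) (fun i => i.elim) hy hy' (monomial_mem_torusFunctions a)

end Membership

/-! ### The behaviour of a polynomial along a line -/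

/-- If the top homogeneous component of `Q` does not vanish at `w`, then `Q` does not vanish
identically on any line with direction `w`. -/
theorem exists_eval_line_ne_zero {κ : Type*} {Q : MvPolynomial κ ℂ} {w : κ → ℂ}
    (hw : (Q.homogeneousComponent Q.totalDegree).eval w ≠ 0) (ρ : κ → ℂ) :
    ∃ c : ℂ, Q.eval (fun i => c * w i + ρ i) ≠ 0 := by
  by_contra! hc
  let d := Q.totalDegree
  -- For μ ≠ 0 this is μ^d times the value of Q on the line at c = 1/μ; at μ = 0 only the top
  -- component at w remains. Continuity at 0 then gives a contradiction.
  let g : ℂ → ℂ := fun μ => ∑ j ∈ Finset.range (d + 1),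
    μ ^ (d - j) * (Q.homogeneousComponent j).eval fun i => w i + μ * ρ i
  have hg : Continuous g := by
    refine continuous_finsetSum _ fun j _ => (continuous_pow _).mul ?_
    exact (MvPolynomial.continuous_eval _).comp (by fun_prop)
  have hg0 : g = fun _ => 0 := by
    refine hg.ext_on (dense_compl_singleton (0 : ℂ)) continuous_const fun μ hμ => ?_
    have hμ : μ ≠ 0 := hμ
    have h1 := hc μ⁻¹
    have h2 : (fun i => μ⁻¹ * w i + ρ i) = fun i => μ⁻¹ * (w i + μ * ρ i) := by
      ext i
      field_simp
    rw [h2, ← Q.sum_homogeneousComponent, map_sum] at h1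
    have h3 : g μ = μ ^ d * ∑ j ∈ Finset.range (d + 1),
        (Q.homogeneousComponent j).eval fun i => μ⁻¹ * (w i + μ * ρ i) := by
      rw [Finset.mul_sum]
      refine Finset.sum_congr rfl fun j hj => ?_
      rw [eval_mul_of_isHomogeneous (Q.homogeneousComponent_isHomogeneous j), ← mul_assoc]
      congr 1
      rw [inv_pow, ← div_eq_mul_inv, eq_div_iff (pow_ne_zero _ hμ), ← pow_add]
      congr 1
      have := Finset.mem_range.1 hj
      omega
    rw [h3, h1, mul_zero]
  have := congrFun hg0 0
  simp only [g, Finset.sum_range_succ] at this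
  rw [Finset.sum_eq_zero fun j hj => ?_] at this
  · simp at this
    exact hw this
  · have := Finset.mem_range.1 hj
    rw [zero_pow (by omega), zero_mul]

/-! ### Systems given by their coefficients -/

section Completion

variable {ι : Type} [DecidableEq ι] {κ : ι → Type} [∀ i, Fintype (κ i)]
  [∀ i, DecidableEq (κ i)] {r : ℕ}

/-- Given coefficients, with coefficient `0` at the base points `o i`, and a point `z` of the
torus, change the coefficients at the base points `o i`, `i ∈ J`, in such a way that the equations
with index in `J` hold at `z`. -/
def complete (J : Finset ι) (o : ∀ i, κ i) (e : ∀ i, κ i → Fin r → ℤ) (q : (Σ i, κ i) → ℂ)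
    (z : Fin r → ℂˣ) (γ : Σ i, κ i) : ℂ :=
  if γ.1 ∈ J ∧ γ.2 = o γ.1 then -∑ a, q ⟨γ.1, a⟩ * monomialChar z (e γ.1 a) else q γ

theorem complete_mem_laurentFunctions {X σ τ : Type*} {h : σ → X → ℂ} {w : τ → X → ℂˣ}
    (J : Finset ι) (o : ∀ i, κ i) (e : ∀ i, κ i → Fin r → ℤ) {q : X → (Σ i, κ i) → ℂ}
    {z : X → Fin r → ℂˣ} (hq : ∀ γ, (fun x => q x γ) ∈ laurentFunctions h w)
    (hz : ∀ a, (fun x => (monomialChar (z x) a : ℂ)) ∈ laurentFunctions h w) (γ : Σ i, κ i) :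
    (fun x => complete J o e (q x) (z x) γ) ∈ laurentFunctions h w := by
  unfold complete
  split_ifs
  · exact neg_mem (sum_mem_laurentFunctions _ fun a _ => mul_mem (hq _) (hz _))
  · exact hq γ

/-- The base exponent is 0, so each equation determines its constant term from the zero and the
other coefficients. Thus completion reaches every system with a given zero. -/
theorem complete_eq {J : Finset ι} {o : ∀ i, κ i} {e : ∀ i, κ i → Fin r → ℤ}
    (ho : ∀ i ∈ J, e i (o i) = 0) {q v : (Σ i, κ i) → ℂ} {z : Fin r → ℂˣ}
    (hq : ∀ i ∈ J, q ⟨i, o i⟩ = 0) (hv : ∀ γ : Σ i, κ i, ¬ (γ.1 ∈ J ∧ γ.2 = o γ.1) → q γ = v γ)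
    (h : ∀ i ∈ J, ∑ a, v ⟨i, a⟩ * (monomialChar z (e i a) : ℂ) = 0) :
    complete J o e q z = v := by
  ext ⟨i, a⟩
  unfold complete
  split_ifs with hγ
  · obtain ⟨hi, ha⟩ := hγ
    replace ha : a = o i := ha
    subst ha
    dsimp only at hi ⊢
    have h1 := h i hi
    rw [← Finset.add_sum_erase _ _ (Finset.mem_univ (o i)), ho i hi, AddChar.map_zero_eq_one,
      Units.val_one, mul_one] at h1
    rw [← Finset.add_sum_erase _ _ (Finset.mem_univ (o i)), hq i hi, zero_mul, zero_add]
    rw [Finset.sum_congr rfl fun b hb => by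
      rw [hv ⟨i, b⟩ fun hc => Finset.ne_of_mem_erase hb hc.2]]
    exact (eq_neg_of_add_eq_zero_left h1).symm
  · exact hv _ hγ

theorem sum_complete {J : Finset ι} {o : ∀ i, κ i} {e : ∀ i, κ i → Fin r → ℤ}
    (ho : ∀ i ∈ J, e i (o i) = 0) {q : (Σ i, κ i) → ℂ} {z : Fin r → ℂˣ}
    (hq : ∀ i ∈ J, q ⟨i, o i⟩ = 0) {i : ι} (hi : i ∈ J) :
    ∑ a, complete J o e q z ⟨i, a⟩ * (monomialChar z (e i a) : ℂ) = 0 := by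
  rw [← Finset.add_sum_erase _ _ (Finset.mem_univ (o i))]
  rw [Finset.sum_congr rfl fun b hb => by
    rw [complete, if_neg fun hc => Finset.ne_of_mem_erase hb hc.2]]
  rw [complete, if_pos ⟨hi, rfl⟩, ← Finset.add_sum_erase _ _ (Finset.mem_univ (o i)), hq i hi,
    ho i hi]
  simp

/-- **Generic systems are consistent in all coefficients but some constant terms.** If the vectors
`e i (β i)`, `i ∈ K`, are linearly independent, then no non-zero polynomial in the coefficients
other than the constant terms of the equations with index not in `K` vanishes at all consistent
systems. -/
theorem exists_consistent_eval_ne_zero [Fintype ι] {o : ∀ i, κ i} {e : ∀ i, κ i → Fin r → ℤ}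
    (ho : ∀ i, e i (o i) = 0) {K : Finset ι} {β : ∀ i, κ i}
    (hβ : LinearIndependent ℝ fun i : K => toReal r (e i (β i)))
    {P : MvPolynomial {γ : Σ i, κ i // γ.2 = o γ.1 → γ.1 ∈ K} ℂ} (hP : P ≠ 0) :
    ∃ (v : (Σ i, κ i) → ℂ) (x : Fin r → ℂˣ),
      (∀ i, ∑ a, v ⟨i, a⟩ * (monomialChar x (e i a) : ℂ) = 0) ∧ P.eval (fun γ => v γ.1) ≠ 0 := by
  have hβo : ∀ i ∈ K, β i ≠ o i := by
    intro i hi h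
    refine hβ.ne_zero ⟨i, hi⟩ ?_
    simp only [h, ho, map_zero]
  obtain ⟨p, hp⟩ : ∃ p, P.eval p ≠ 0 := by
    by_contra! hc
    exact hP (MvPolynomial.funext fun v => by simpa using hc v)
  -- For i in K only the coefficients at `o i` and `β i` stay variable; the remaining ones are fixed
  -- at a point where P does not vanish.
  let sub : {γ : Σ i, κ i // γ.2 = o γ.1 → γ.1 ∈ K} → MvPolynomial (K ⊕ K) ℂ := fun γ =>
    if h : γ.1.1 ∈ K then
      if γ.1.2 = o γ.1.1 then MvPolynomial.X (Sum.inr ⟨γ.1.1, h⟩)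
      else if γ.1.2 = β γ.1.1 then MvPolynomial.X (Sum.inl ⟨γ.1.1, h⟩)
      else MvPolynomial.C (p γ)
    else MvPolynomial.C (p γ)
  let Q : MvPolynomial (K ⊕ K) ℂ := MvPolynomial.aeval sub P
  have hQ : ∀ w, Q.eval w = P.eval fun γ => (sub γ).eval w := by
    intro w
    have := MvPolynomial.comp_aeval_apply (R := ℂ) sub (MvPolynomial.aeval w) P
    simp only [MvPolynomial.aeval_eq_eval] at this
    exact this
  have hQ0 : Q ≠ 0 := by
    intro h0
    have := hQ (Sum.elim (fun i => p ⟨⟨i, β i⟩, fun _ => i.2⟩) fun i => p ⟨⟨i, o i⟩, fun _ => i.2⟩)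
    rw [h0, map_zero] at this
    refine hp ?_
    rw [this]
    congr 2
    ext ⟨⟨i, a⟩, hγ⟩
    simp only [sub]
    split_ifs with h1 h2 h3
    · subst h2
      simp
    · subst h3
      simp
    · simp
    · simp
  have htop : Q.homogeneousComponent Q.totalDegree ≠ 0 := by
    intro h0
    obtain ⟨m, hm, hmd⟩ := Finset.exists_mem_eq_sup Q.support
      (MvPolynomial.support_nonempty.2 hQ0) fun s => s.sum fun _ e => e
    have h1 := congrArg (MvPolynomial.coeff m) h0
    have h2 : m.degree = Q.totalDegree := by
      rw [MvPolynomial.totalDegree, hmd]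
      rfl
    rw [MvPolynomial.coeff_homogeneousComponent, if_pos h2] at h1
    exact MvPolynomial.mem_support_iff.1 hm h1
  obtain ⟨w, hw⟩ : ∃ w : K ⊕ K → ℂˣ,
      (Q.homogeneousComponent Q.totalDegree).eval (fun i => (w i : ℂ)) ≠ 0 := by
    obtain ⟨h, w, hw⟩ := exists_eval_ne_zero_of_units (σ := Empty) (τ := K ⊕ K)
      (p := (Q.homogeneousComponent Q.totalDegree).rename Sum.inr)
      ((MvPolynomial.rename_injective _ Sum.inr_injective).ne_iff' (map_zero _) |>.2 htop)
    rw [MvPolynomial.eval_rename] at hw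
    exact ⟨w, hw⟩
  -- With this x, the terms at `o i` and `β i` cancel when their coefficients are proportional to w.
  obtain ⟨x, hx⟩ := exists_monomialChar_eq hβ fun i => -w (Sum.inr i) / w (Sum.inl i)
  -- The contribution of the fixed coefficients, to be absorbed by the constant term. The admissible
  -- coefficients fill a line in direction w, on which Q does not vanish identically.
  let ρ : K → ℂ := fun i => ∑ a, if h : a = o i ∨ a = β i then 0 else
    p ⟨⟨i, a⟩, fun h' => (h (Or.inl h')).elim⟩ * monomialChar x (e i a)
  obtain ⟨c, hc⟩ := exists_eval_line_ne_zero hw (Sum.elim (fun _ => 0) fun i => -ρ i)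
  let W : K ⊕ K → ℂ := fun i => c * (w i : ℂ) + Sum.elim (fun _ => 0) (fun i => -ρ i) i
  let q : (Σ i, κ i) → ℂ := fun γ => if h : γ.2 = o γ.1 then 0 else (sub ⟨γ, fun h' => (h h').elim⟩).eval W
  refine ⟨complete Finset.univ o e q x, x, fun i => sum_complete (fun i _ => ho i)
    (fun i _ => by simp [q]) (Finset.mem_univ i), ?_⟩
  rw [hQ] at hc
  convert hc using 2
  congr 1
  ext ⟨⟨i, a⟩, hγ⟩
  change complete Finset.univ o e q x ⟨i, a⟩ = (sub _).eval W
  unfold complete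
  split_ifs with h
  · replace h : a = o i := h.2
    subst h
    have hi : i ∈ K := hγ rfl
    have h1 : (sub ⟨⟨i, o i⟩, hγ⟩).eval W = W (Sum.inr ⟨i, hi⟩) := by simp [sub, hi]
    have h2 : ∀ a, q ⟨i, a⟩ * (monomialChar x (e i a) : ℂ) =
        (if a = β i then -(c * (w (Sum.inr ⟨i, hi⟩) : ℂ)) else 0) + if h : a = o i ∨ a = β i then 0 else
          p ⟨⟨i, a⟩, fun h' => (h (Or.inl h')).elim⟩ * (monomialChar x (e i a) : ℂ) := by
      intro a
      by_cases ha : a = o i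
      · subst ha
        simp [q, (hβo i hi).symm]
      by_cases hb : a = β i
      · subst hb
        have := hx ⟨i, hi⟩
        simp only at this
        simp [q, ha, sub, hi, W, this, Units.val_div_eq_div_val]
        field_simp
      · simp [q, ha, hb, sub, hi]
    dsimp only
    rw [h1, Finset.sum_congr rfl fun a _ => h2 a, Finset.sum_add_distrib]
    simp [W, ρ]
    ring
  · have ha : a ≠ o i := fun h' => h ⟨Finset.mem_univ _, h'⟩
    simp [q, ha]

end Completion

/-! ### Generic uniqueness of solutions -/

/-- Finitely many generic conditions hold simultaneously outside one hypersurface. -/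
theorem exists_common_polynomial {C T : Type*} [Finite T] {good : T → (C → ℂ) → Prop}
    (h : ∀ t, ∃ P : MvPolynomial C ℂ, P ≠ 0 ∧ ∀ v, P.eval v ≠ 0 → good t v) :
    ∃ P : MvPolynomial C ℂ, P ≠ 0 ∧ ∀ v, P.eval v ≠ 0 → ∀ t, good t v := by
  have := Fintype.ofFinite T
  choose P hP hP' using h
  refine ⟨∏ t, P t, Finset.prod_ne_zero_iff.2 fun t _ => hP t, fun v hv t => hP' t v ?_⟩
  rw [map_prod] at hv
  exact Finset.prod_ne_zero_iff.1 hv t (Finset.mem_univ t)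

section Uniqueness

variable {ι : Type} [DecidableEq ι] {κ : ι → Type} [∀ i, DecidableEq (κ i)]

/-- The graph over `J` of a choice `o` of base points. -/
def graphOver (J : Finset ι) (o : ∀ i, κ i) : Finset (Σ i, κ i) :=
  J.image fun i => ⟨i, o i⟩

theorem mem_graphOver {J : Finset ι} {o : ∀ i, κ i} {γ : Σ i, κ i} :
    γ ∈ graphOver J o ↔ γ.1 ∈ J ∧ γ.2 = o γ.1 := by
  obtain ⟨i, a⟩ := γ
  simp only [graphOver, Finset.mem_image, Sigma.mk.injEq]
  constructor
  · rintro ⟨j, hj, rfl, h⟩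
    exact ⟨hj, (eq_of_heq h).symm⟩
  · rintro ⟨hi, h⟩
    exact ⟨i, hi, rfl, heq_of_eq h.symm⟩

theorem card_graphOver (J : Finset ι) (o : ∀ i, κ i) : (graphOver J o).card = J.card :=
  Finset.card_image_of_injective _ fun _ _ h => congrArg Sigma.fst h

/-- The group generated by the exponents of the equations with index in `I`. -/
def exponentGroup {r : ℕ} (e : ∀ i, κ i → Fin r → ℤ) (I : Finset ι) :
    AddSubgroup (Fin r → ℤ) :=
  AddSubgroup.closure {g | ∃ i ∈ I, ∃ a, g = e i a}

variable [Fintype ι] [∀ i, Fintype (κ i)] {r : ℕ}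

/-- The systems whose equations with index in `J` have two common zeros `z` and `z * u`, where `u`
lies in a given component of the annihilator of the exponents with index in `I`, satisfy a
polynomial relation if `I` has larger defect than `J`. -/
theorem exists_polynomial_of_stratum {C : Type} [Fintype C] {J I : Finset ι} (hI : I ⊆ J)
    {o : ∀ i, κ i} {e : ∀ i, κ i → Fin r → ℤ} (ho : ∀ i ∈ J, e i (o i) = 0) {ρ : ℕ}
    (S : Module.Basis.SmithNormalForm (AddSubgroup.toIntSubmodule (exponentGroup e I)) (Fin r) ρ)
    (hρ : r + I.card < ρ + J.card) (c : C → Σ i, κ i)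
    (hC : Fintype.card C + J.card = Fintype.card (Σ i, κ i) + r) (ζ : Fin ρ → ℂˣ)
    (α : ∀ i, κ i) :
    ∃ P : MvPolynomial C ℂ, P ≠ 0 ∧ ∀ v : (Σ i, κ i) → ℂ, P.eval (v ∘ c) ≠ 0 →
      ∀ z u : Fin r → ℂˣ,
        (∀ i ∈ J, ∑ a, v ⟨i, a⟩ * (monomialChar z (e i a) : ℂ) = 0) →
        (∀ i ∈ J, ∑ a, v ⟨i, a⟩ * (monomialChar (z * u) (e i a) : ℂ) = 0) →
        (∀ l, monomialChar u (S.bM (S.f l)) = ζ l) →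
        ¬ ∀ i ∈ J \ I, monomialChar u (e i (α i)) ≠ 1 := by
  -- The base exponent is 0 and never separates two points, so a choice of α meeting `o` leaves
  -- nothing to prove.
  by_cases hα : ∀ i ∈ J \ I, α i ≠ o i
  swap
  · push Not at hα
    obtain ⟨i, hi, h⟩ := hα
    refine ⟨1, one_ne_zero, fun v _ z u _ _ _ hu => hu i hi ?_⟩
    rw [h, ho i (Finset.mem_sdiff.1 hi).1, AddChar.map_zero_eq_one]
  let Γ' : Finset (Σ i, κ i) := (graphOver J o ∪ graphOver (J \ I) α)ᶜ
  have hΓ'card : Γ'.card + J.card + (J.card - I.card) = Fintype.card (Σ i, κ i) := by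
    have hd : Disjoint (graphOver J o) (graphOver (J \ I) α) := by
      refine Finset.disjoint_left.2 fun γ h h' => ?_
      rw [mem_graphOver] at h h'
      exact hα _ h'.1 (h'.2.symm.trans h.2)
    have h1 := Finset.card_compl_add_card (graphOver J o ∪ graphOver (J \ I) α)
    rw [Finset.card_union_of_disjoint hd, card_graphOver, card_graphOver,
      Finset.card_sdiff_of_subset hI] at h1
    rw [← h1, add_assoc]
  have hIJ := Finset.card_le_card hI
  -- Torus parameters: r coordinates for z, and for u the r - ρ coordinates left free once its
  -- values at the Smith vectors are prescribed.
  let τ := Fin r ⊕ {l : Fin r // l ∉ Set.range S.f}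
  have hfin : Fintype {l : Fin r // l ∉ Set.range S.f} := Fintype.ofFinite _
  have hτ : Fintype.card τ + ρ = r + r := by
    have h1 := Nat.card_congr (Equiv.Set.sumCompl (Set.range S.f))
    have h2 : Nat.card ((Set.range S.f)ᶜ : Set (Fin r)) =
      Fintype.card {l : Fin r // l ∉ Set.range S.f} := @Nat.card_eq_fintype_card _ hfin
    rw [Nat.card_sum, Nat.card_range_of_injective S.f.injective, h2, Nat.card_fin,
      Nat.card_fin] at h1
    rw [Fintype.card_sum, Fintype.card_fin]
    omega
  let X := (Γ' → ℂ) × (τ → ℂˣ)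
  let U : X → Fin r → ℂˣ := fun x => basisPoint S.bM fun l =>
    if h : ∃ l', S.f l' = l then ζ h.choose else x.2 (Sum.inr ⟨l, h⟩)
  let Z : X → Fin r → ℂˣ := fun x l => x.2 (Sum.inl l)
  let H : X → (Σ i, κ i) → ℂ := fun x γ => if h : γ ∈ Γ' then x.1 ⟨γ, h⟩ else 0
  -- For i outside I, the difference of the equations at z u and at z determines the coefficient at
  -- `α i`. The other non-base coefficients of that equation are scaled by u^(e (α i)) - 1, which
  -- keeps the parametrization free of this denominator.
  let q : X → (Σ i, κ i) → ℂ := fun x γ =>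
    if γ.1 ∈ J \ I then
      if γ.2 = α γ.1 then
        -∑ a, H x ⟨γ.1, a⟩ * ((monomialChar (Z x) (e γ.1 a - e γ.1 (α γ.1)) : ℂ) *
          ((monomialChar (U x) (e γ.1 a) : ℂ) - 1))
      else ((monomialChar (U x) (e γ.1 (α γ.1)) : ℂ) - 1) * H x γ
    else H x γ
  have hU : ∀ a, (fun x => (monomialChar (U x) a : ℂ)) ∈ LaurentRing Γ' τ := by
    intro a
    simp only [U, monomialChar_basisPoint]
    refine monomialChar_mem_laurentFunctions (fun l => ?_) (fun l => ?_) _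
    all_goals split_ifs
    · exact const_mem_laurentFunctions _
    · exact unit_mem_laurentFunctions _
    · exact const_mem_laurentFunctions _
    · exact unit_inv_mem_laurentFunctions _
  have hZ : ∀ a, (fun x => (monomialChar (Z x) a : ℂ)) ∈ LaurentRing Γ' τ := fun a =>
    monomialChar_mem_laurentFunctions (fun l => unit_mem_laurentFunctions _)
      (fun l => unit_inv_mem_laurentFunctions _) a
  have hH : ∀ γ, (fun x => H x γ) ∈ LaurentRing Γ' τ := by
    intro γ
    simp only [H]
    split_ifs
    · exact coord_mem_laurentFunctions _
    · exact const_mem_laurentFunctions 0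
  have hq : ∀ γ, (fun x => q x γ) ∈ LaurentRing Γ' τ := by
    intro γ
    simp only [q]
    split_ifs
    · exact neg_mem (sum_mem_laurentFunctions _ fun a _ => mul_mem (hH _)
        (mul_mem (hZ _) (sub_mem (hU _) (const_mem_laurentFunctions 1))))
    · exact mul_mem (sub_mem (hU _) (const_mem_laurentFunctions 1)) (hH _)
    · exact hH _
  -- Two conditions for each i in J \ I and one for each i in I, against 2r - ρ torus parameters: by
  -- `hρ` there are fewer parameters than members of C.
  obtain ⟨P, hP, hP0⟩ := exists_relation_of_card_lt (C := C) (fun j =>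
    (⟨fun x => complete J o e (q x) (Z x) (c j), complete_mem_laurentFunctions J o e hq hZ (c j)⟩ :
      LaurentRing Γ' τ)) (by rw [Fintype.card_coe]; omega)
  refine ⟨P, hP, fun v hv z u hz hzu hζ hu => hv ?_⟩
  let D : ι → ℂ := fun i => (monomialChar u (e i (α i)) : ℂ) - 1
  have hD : ∀ i ∈ J \ I, D i ≠ 0 := fun i hi h => hu i hi (Units.ext (sub_eq_zero.1 h))
  let x : X := (fun γ => if γ.1.1 ∈ J \ I then v γ / D γ.1.1 else v γ,
    Sum.elim z fun l => monomialChar u (S.bM l))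
  have hUx : U x = u := by
    refine monomialChar_injective (addChar_eq_of_basis S.bM fun l => ?_)
    simp only [U, monomialChar_basisPoint_self]
    split_ifs with h
    · rw [← hζ, h.choose_spec]
    · rfl
  have hZx : Z x = z := rfl
  have hHx : ∀ i ∈ J \ I, ∀ a, D i * H x ⟨i, a⟩ = if a = o i ∨ a = α i then 0 else v ⟨i, a⟩ := by
    intro i hi a
    have hmem : (⟨i, a⟩ : Σ i, κ i) ∈ Γ' ↔ ¬ (a = o i ∨ a = α i) := by
      simp only [Γ', Finset.mem_compl, Finset.mem_union, mem_graphOver, hi,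
        (Finset.mem_sdiff.1 hi).1, true_and]
    by_cases h : a = o i ∨ a = α i
    · rw [if_pos h]
      simp only [H]
      rw [dif_neg fun h' => hmem.1 h' h, mul_zero]
    · rw [if_neg h]
      simp only [H]
      rw [dif_pos (hmem.2 h)]
      simp only [x, if_pos hi]
      exact mul_div_cancel₀ _ (hD i hi)
  have hHx' : ∀ γ : Σ i, κ i, γ.1 ∉ J \ I → H x γ = if γ ∈ graphOver J o then 0 else v γ := by
    intro γ hγ
    have hmem : γ ∈ Γ' ↔ γ ∉ graphOver J o := by
      simp only [Γ', Finset.mem_compl, Finset.mem_union, mem_graphOver (J := J \ I), hγ,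
        false_and, or_false]
    simp only [H]
    by_cases h : γ ∈ graphOver J o
    · rw [dif_neg fun h' => hmem.1 h' h, if_pos h]
    · rw [dif_pos (hmem.2 h), if_neg h]
      simp only [x, if_neg hγ]
  have hcomp : complete J o e (q x) (Z x) = v := by
    refine complete_eq ho (fun i hi => ?_) (fun γ hγ => ?_) hz
    · simp only [q]
      by_cases hi' : i ∈ J \ I
      · rw [if_pos hi', if_neg (hα i hi').symm, hUx]
        exact (hHx i hi' _).trans (if_pos (Or.inl rfl))
      · rw [if_neg hi', hHx' _ hi', if_pos (mem_graphOver.2 ⟨hi, rfl⟩)]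
    · obtain ⟨i, a⟩ := γ
      simp only [q, hUx, hZx]
      by_cases hi : i ∈ J \ I
      · have hiJ := (Finset.mem_sdiff.1 hi).1
        have hao : a ≠ o i := fun h => hγ ⟨hiJ, h⟩
        rw [if_pos hi]
        by_cases ha : a = α i
        · rw [if_pos ha]
          subst ha
          have h1 := hz i hiJ
          have h2 := hzu i hiJ
          -- The difference of the two equations term by term: the term at `α i` is separated, and
          -- the base term cancels.
          have h3 : ∀ a, v ⟨i, a⟩ * (monomialChar (z * u) (e i a) : ℂ) -
              v ⟨i, a⟩ * (monomialChar z (e i a) : ℂ) =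
              (if a = α i then v ⟨i, α i⟩ * monomialChar z (e i (α i)) * D i else 0) +
              D i * monomialChar z (e i (α i)) *
                (H x ⟨i, a⟩ * ((monomialChar z (e i a - e i (α i)) : ℂ) *
                  ((monomialChar u (e i a) : ℂ) - 1))) := by
            intro a
            rw [AddChar.map_sub_eq_div, Units.val_div_eq_div_val, monomialChar_mul, Units.val_mul]
            have h4 : ∀ w y t s : ℂ, y ≠ 0 →
                D i * y * (H x ⟨i, a⟩ * (w / y * (s - 1))) =
                (D i * H x ⟨i, a⟩) * (w * (s - 1)) := by
              intro w y t s hy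
              field_simp
            rw [h4 _ _ 0 _ (Units.ne_zero _), hHx i hi]
            by_cases hb : a = α i
            · subst hb
              simp [D]
              ring
            by_cases hb' : a = o i
            · subst hb'
              simp [hb, ho i hiJ]
            · simp only [hb, hb', or_self, if_false]
              ring
          have h5 := congrArg₂ (· - ·) h2 h1
          simp only [← Finset.sum_sub_distrib, sub_zero, h3, Finset.sum_add_distrib,
            Finset.sum_ite_eq', Finset.mem_univ, if_true, ← Finset.mul_sum] at h5
          have h6 : D i * (monomialChar z (e i (α i)) : ℂ) ≠ 0 :=
            mul_ne_zero (hD i hi) (Units.ne_zero _)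
          refine mul_left_cancel₀ h6 ?_
          linear_combination -h5
        · rw [if_neg ha]
          exact (hHx i hi a).trans (if_neg fun h => h.elim hao ha)
      · rw [if_neg hi, hHx' _ hi, if_neg fun h => hγ (mem_graphOver.1 h)]
  have := hP0 x
  simp only [hcomp] at this
  exact this

/-- **Generic uniqueness.** If all proper subcollections of `J` have larger defect than `J`, then,
outside a hypersurface in the space of coefficients, any two common zeros of the equations with
index in `J` are not separated by the exponents of these equations. -/
theorem exists_polynomial_unique_zero {C : Type} [Fintype C] {J : Finset ι} {o : ∀ i, κ i}
    {e : ∀ i, κ i → Fin r → ℤ} (ho : ∀ i ∈ J, e i (o i) = 0)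
    (hess : ∀ I, I ⊂ J → r + I.card <
      Module.finrank ℝ (realSpan (exponentGroup e I)) + J.card)
    (c : C → Σ i, κ i) (hC : Fintype.card C + J.card = Fintype.card (Σ i, κ i) + r) :
    ∃ P : MvPolynomial C ℂ, P ≠ 0 ∧ ∀ v : (Σ i, κ i) → ℂ, P.eval (v ∘ c) ≠ 0 →
      ∀ z z' : Fin r → ℂˣ,
        (∀ i ∈ J, ∑ a, v ⟨i, a⟩ * (monomialChar z (e i a) : ℂ) = 0) →
        (∀ i ∈ J, ∑ a, v ⟨i, a⟩ * (monomialChar z' (e i a) : ℂ) = 0) →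
        ∀ i ∈ J, ∀ a, monomialChar z' (e i a) = monomialChar z (e i a) := by
  let good : Finset ι → (C → ℂ) → Prop := fun I w => ∀ (v : (Σ i, κ i) → ℂ), v ∘ c = w →
      ∀ z u : Fin r → ℂˣ,
        (∀ i ∈ J, ∑ a, v ⟨i, a⟩ * (monomialChar z (e i a) : ℂ) = 0) →
        (∀ i ∈ J, ∑ a, v ⟨i, a⟩ * (monomialChar (z * u) (e i a) : ℂ) = 0) →
        (∀ i ∈ I, ∀ a, monomialChar u (e i a) = 1) →
        ∃ i ∈ J \ I, ∀ a, monomialChar u (e i a) = 1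
  obtain ⟨P, hP, hP'⟩ : ∃ P : MvPolynomial C ℂ, P ≠ 0 ∧ ∀ w, P.eval w ≠ 0 →
      ∀ I : {I // I ⊂ J}, good I w := by
    refine exists_common_polynomial (T := {I // I ⊂ J}) fun I => ?_
    obtain ⟨I, hI⟩ := I
    obtain ⟨ρ, ⟨S⟩⟩ := exists_smith (exponentGroup e I)
    have hρ := hess I hI
    rw [finrank_realSpan S] at hρ
    -- If u is trivial on the exponents in I, its values at the Smith vectors are roots of unity of
    -- bounded order. So finitely many strata suffice for each I.
    have hfin : Finite {ζ : Fin ρ → ℂˣ // ∀ l, ζ l ^ S.a l = 1} := by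
      refine Set.Finite.to_subtype (s := {ζ : Fin ρ → ℂˣ | ∀ l, ζ l ^ S.a l = 1})
        (Set.Finite.pi' (t := fun l => {x : ℂˣ | x ^ S.a l = 1}) fun l => ?_)
      have : NeZero (S.a l).natAbs := ⟨Int.natAbs_ne_zero.2 (smith_coeff_ne_zero S l)⟩
      have hroots : Finite (rootsOfUnity (S.a l).natAbs ℂ) := inferInstance
      refine (Set.finite_coe_iff.1 hroots).subset fun x hx => ?_
      have hx : x ^ S.a l = 1 := hx
      change x ^ (S.a l).natAbs = 1
      rcases Int.natAbs_eq (S.a l) with h | h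
      · rwa [h, zpow_natCast] at hx
      · rwa [h, zpow_neg, zpow_natCast, inv_eq_one] at hx
    obtain ⟨P, hP, hP'⟩ := exists_common_polynomial
      (T := {ζ : Fin ρ → ℂˣ // ∀ l, ζ l ^ S.a l = 1} × ∀ i, κ i)
      (good := fun t w => ∀ (v : (Σ i, κ i) → ℂ), v ∘ c = w → ∀ z u : Fin r → ℂˣ,
        (∀ i ∈ J, ∑ a, v ⟨i, a⟩ * (monomialChar z (e i a) : ℂ) = 0) →
        (∀ i ∈ J, ∑ a, v ⟨i, a⟩ * (monomialChar (z * u) (e i a) : ℂ) = 0) →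
        (∀ l, monomialChar u (S.bM (S.f l)) = t.1.1 l) →
        ¬ ∀ i ∈ J \ I, monomialChar u (e i (t.2 i)) ≠ 1) (fun t => by
          obtain ⟨P, hP, h⟩ := exists_polynomial_of_stratum hI.1 ho S hρ c hC t.1.1 t.2
          exact ⟨P, hP, fun w hw v hv => h v (hv ▸ hw)⟩)
    refine ⟨P, hP, fun w hw v hv z u hz hzu hu => ?_⟩
    by_contra! hc
    have huG : ∀ g ∈ exponentGroup e I, monomialChar u g = 1 := by
      intro g hg
      induction hg using AddSubgroup.closure_induction with
      | mem g hg =>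
        obtain ⟨i, hi, a, rfl⟩ := hg
        exact hu i hi a
      | zero => exact AddChar.map_zero_eq_one _
      | add g h _ _ hg hh => rw [AddChar.map_add_eq_mul, hg, hh, one_mul]
      | neg g _ hg => rw [AddChar.map_neg_eq_inv, hg, inv_one]
    have hch : ∀ i, ∃ a, i ∈ J \ I → monomialChar u (e i a) ≠ 1 := by
      intro i
      by_cases hi : i ∈ J \ I
      · obtain ⟨a, ha⟩ := hc i hi
        exact ⟨a, fun _ => ha⟩
      · exact ⟨o i, fun h => (hi h).elim⟩
    choose α hα using hch
    refine hP' w hw (⟨fun l => monomialChar u (S.bM (S.f l)), fun l => ?_⟩, α) v hv z u hz hzu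
      (fun l => rfl) fun i hi => hα i hi
    rw [← AddChar.map_zsmul_eq_zpow]
    exact huG _ (smith_smul_mem S l)
  refine ⟨P, hP, fun v hv z z' hz hz' => ?_⟩
  -- Let I collect all equations of J not separating the two zeros. If I were proper, the generic
  -- condition for I would supply a further such equation.
  let I := J.filter fun i => ∀ a, monomialChar (z' / z) (e i a) = 1
  by_cases hIJ : I = J
  · intro i hi a
    rw [← hIJ] at hi
    have := (Finset.mem_filter.1 hi).2 a
    rwa [monomialChar_div, div_eq_one] at this
  · exfalso
    obtain ⟨i, hi, h⟩ := hP' _ hv ⟨I, Finset.ssubset_iff_subset_ne.2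
      ⟨Finset.filter_subset _ _, hIJ⟩⟩ v rfl z (z' / z) hz (by simpa using hz')
      fun i hi => (Finset.mem_filter.1 hi).2
    obtain ⟨h1, h2⟩ := Finset.mem_sdiff.1 hi
    exact h2 (Finset.mem_filter.2 ⟨h1, h⟩)

end Uniqueness

/-! ### Generic consistent systems in coordinates -/

section GenericSystems

variable {n k : ℕ} (A : Fin k → Finset (Fin n → ℤ))

/-- The index set of the coefficients of the systems with supports `A i`. -/
abbrev Terms := Σ i, {a // a ∈ A i}

variable {A}

theorem differenceGroup_eq_closure (o : ∀ i, {a // a ∈ A i}) (I : Finset (Fin k)) :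
    differenceGroup A I =
      AddSubgroup.closure {g | ∃ i ∈ I, ∃ a : {a // a ∈ A i}, g = a.1 - (o i).1} := by
  refine le_antisymm ((AddSubgroup.closure_le _).2 ?_) ((AddSubgroup.closure_le _).2 ?_)
  · rintro _ ⟨i, hi, a, ha, b, hb, rfl⟩
    have := sub_mem (AddSubgroup.subset_closure (k := {g | ∃ i ∈ I, ∃ a : {a // a ∈ A i},
      g = a.1 - (o i).1}) ⟨i, hi, ⟨a, ha⟩, rfl⟩) (AddSubgroup.subset_closure ⟨i, hi, ⟨b, hb⟩, rfl⟩)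
    rwa [sub_sub_sub_cancel_right] at this
  · rintro _ ⟨i, hi, a, rfl⟩
    exact sub_mem_differenceGroup A I hi a.2 (o i).2

theorem mem_annihilator_differenceGroup (o : ∀ i, {a // a ∈ A i}) {I : Finset (Fin k)}
    {y : Fin n → ℂˣ} (h : ∀ i ∈ I, ∀ a : {a // a ∈ A i}, monomialChar y (a.1 - (o i).1) = 1) :
    y ∈ annihilator (differenceGroup A I) := by
  intro g hg
  rw [differenceGroup_eq_closure o] at hg
  induction hg using AddSubgroup.closure_induction with
  | mem g hg =>
    obtain ⟨i, hi, a, rfl⟩ := hg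
    exact h i hi a
  | zero => exact AddChar.map_zero_eq_one _
  | add g h _ _ hg hh => rw [AddChar.map_add_eq_mul, hg, hh, one_mul]
  | neg g _ hg => rw [AddChar.map_neg_eq_inv, hg, inv_one]

/-- Rado's theorem with deficiency c gives at least k - c independent exponents. At most |J| - c of
them can come from J, so there are exactly k - c. -/
theorem exists_independent_exponents (o : ∀ i, {a // a ∈ A i}) {J : Finset (Fin k)} {c : ℕ}
    (hmin : ∀ I : Finset (Fin k),
      I.card ≤ Module.finrank ℝ (realSpan (differenceGroup A I)) + c)
    (hJ : J.card = Module.finrank ℝ (realSpan (differenceGroup A J)) + c) :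
    ∃ (K : Finset (Fin k)) (β : ∀ i, {a // a ∈ A i}), K.card + c = k ∧
      LinearIndependent ℝ fun i : K => toReal n ((β i).1 - (o i).1) := by
  classical
  obtain ⟨K, v, hK, hv, hlin⟩ := exists_linearIndependent_transversal c
    (fun i => (A i).image fun a => toReal n (a - (o i).1)) (fun I => by
      refine (hmin I).trans (Nat.add_le_add_right (Submodule.finrank_mono ?_) c)
      rw [differenceGroup_eq_closure o, realSpan_closure]
      refine Submodule.span_mono ?_
      rintro _ ⟨_, ⟨i, hi, a, rfl⟩, rfl⟩
      exact Set.mem_biUnion (x := i) hi (Finset.mem_coe.2 (Finset.mem_image_of_mem _ a.2)))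
  have hv' : ∀ i, ∃ a : {a // a ∈ A i}, i ∈ K → v i = toReal n (a.1 - (o i).1) := by
    intro i
    by_cases hi : i ∈ K
    · obtain ⟨a, ha, h⟩ := Finset.mem_image.1 (hv i hi)
      exact ⟨⟨a, ha⟩, fun _ => h.symm⟩
    · exact ⟨o i, fun h => (hi h).elim⟩
  choose β hβ using hv'
  have hlin' : LinearIndependent ℝ fun i : K => toReal n ((β i).1 - (o i).1) := by
    rwa [show (fun i : K => toReal n ((β i).1 - (o i).1)) = fun i : K => v i from
      funext fun i => (hβ i i.2).symm]
  refine ⟨K, β, le_antisymm ?_ (by simpa using hK), hlin'⟩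
  have h1 : (K ∩ J).card ≤ Module.finrank ℝ (realSpan (differenceGroup A J)) := by
    have h2 : LinearIndependent ℝ fun i : (K ∩ J : Finset _) =>
        (⟨toReal n ((β i).1 - (o i).1), Submodule.subset_span ⟨_, sub_mem_differenceGroup A J
          (Finset.mem_inter.1 i.2).2 (β i).2 (o i).2, rfl⟩⟩ : realSpan (differenceGroup A J)) := by
      refine LinearIndependent.of_comp (Submodule.subtype _) ?_
      exact hlin'.comp (fun i : (K ∩ J : Finset _) => ⟨i.1, (Finset.mem_inter.1 i.2).1⟩)
        fun i j h => Subtype.ext (congrArg (fun x : K => x.1) h)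
    rw [← Fintype.card_coe]
    exact h2.fintype_card_le_finrank
  have h3 := Finset.card_inter_add_card_sdiff K J
  have h4 : (K \ J).card ≤ (Jᶜ).card := Finset.card_le_card fun i hi =>
    Finset.mem_compl.2 (Finset.mem_sdiff.1 hi).2
  have h5 := Finset.card_add_card_compl J
  rw [Fintype.card_fin] at h5
  omega

variable {J : Finset (Fin k)} {r : ℕ}
  (S : Module.Basis.SmithNormalForm (AddSubgroup.toIntSubmodule (differenceGroup A J)) (Fin n) r)

/-- The coordinates of the exponents, relative to the base points, in the lattice of integral
points of the span of the difference group. -/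
def relativeExponent (o : ∀ i, {a // a ∈ A i}) (i : Fin k) (a : {a // a ∈ A i}) (l : Fin r) : ℤ :=
  S.bM.repr (a.1 - (o i).1) (S.f l)

/-- The coordinates of the image of a point of the torus in the quotient torus whose characters
are the integral points of the span of the difference group. -/
def quotientPoint (x : Fin n → ℂˣ) (l : Fin r) : ℂˣ :=
  monomialChar x (S.bM (S.f l))

open Classical in
/-- A section of `quotientPoint`. -/
def sectionPoint (z : Fin r → ℂˣ) : Fin n → ℂˣ :=
  basisPoint S.bM fun j => if h : ∃ l, S.f l = j then z h.choose else 1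

theorem quotientPoint_sectionPoint (z : Fin r → ℂˣ) : quotientPoint S (sectionPoint S z) = z := by
  ext l
  have h : ∃ l', S.f l' = S.f l := ⟨l, rfl⟩
  rw [quotientPoint, sectionPoint, monomialChar_basisPoint_self, dif_pos h,
    S.f.injective h.choose_spec]

theorem sectionPoint_one : sectionPoint S 1 = 1 := by
  refine monomialChar_injective (addChar_eq_of_basis S.bM fun j => ?_)
  rw [sectionPoint, monomialChar_basisPoint_self, monomialChar_one]
  split_ifs <;> rfl

/-- After division by base monomials, the equations in J depend only on the image of x in the
r-dimensional quotient torus. -/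
theorem monomialChar_quotientPoint (o : ∀ i, {a // a ∈ A i}) {i : Fin k} (hi : i ∈ J)
    (a : {a // a ∈ A i}) (x : Fin n → ℂˣ) :
    monomialChar (quotientPoint S x) (relativeExponent S o i a) =
      monomialChar x (a.1 - (o i).1) := by
  conv_rhs => rw [eq_sum_of_mem_saturation S
    (le_saturation _ (sub_mem_differenceGroup A J hi a.2 (o i).2))]
  rw [addChar_map_sum, monomialChar_apply]
  exact Finset.prod_congr rfl fun l _ => (AddChar.map_zsmul_eq_zpow _ _ _).symm

/-- Passing to coordinates in the saturation is an injective linear map on real spans, so the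
defects of subsets of J are unchanged. -/
theorem finrank_exponentGroup (o : ∀ i, {a // a ∈ A i}) {I : Finset (Fin k)} (hI : I ⊆ J) :
    Module.finrank ℝ (realSpan (exponentGroup (relativeExponent S o) I)) =
      Module.finrank ℝ (realSpan (differenceGroup A I)) := by
  let ψ : (Fin r → ℝ) →ₗ[ℝ] Fin n → ℝ :=
    Fintype.linearCombination ℝ fun l => toReal n (S.bM (S.f l))
  have hψ : Function.Injective ψ :=
    LinearIndependent.fintypeLinearCombination_injective (linearIndependent_toReal_smith S)
  have hψe : ∀ i ∈ I, ∀ a, ψ (toReal r (relativeExponent S o i a)) =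
      toReal n (a.1 - (o i).1) := by
    intro i hi a
    conv_rhs => rw [eq_sum_of_mem_saturation S
      (le_saturation _ (sub_mem_differenceGroup A J (hI hi) a.2 (o i).2)), map_sum]
    rw [Fintype.linearCombination_apply]
    refine Finset.sum_congr rfl fun l _ => ?_
    rw [map_zsmul, ← Int.cast_smul_eq_zsmul ℝ]
    rfl
  have himage : ψ '' (toReal r '' {g | ∃ i ∈ I, ∃ a, g = relativeExponent S o i a}) =
      toReal n '' {g | ∃ i ∈ I, ∃ a : {a // a ∈ A i}, g = a.1 - (o i).1} := by
    ext w
    constructor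
    · rintro ⟨_, ⟨_, ⟨i, hi, a, rfl⟩, rfl⟩, rfl⟩
      exact ⟨_, ⟨i, hi, a, rfl⟩, (hψe i hi a).symm⟩
    · rintro ⟨_, ⟨i, hi, a, rfl⟩, rfl⟩
      exact ⟨_, ⟨_, ⟨i, hi, a, rfl⟩, rfl⟩, hψe i hi a⟩
  rw [(Submodule.equivMapOfInjective ψ hψ _).finrank_eq, exponentGroup, realSpan_closure,
    Submodule.map_span, himage, differenceGroup_eq_closure o, realSpan_closure]

end GenericSystems

/-! ### The hypersurface of non-generic systems -/

section GenericPolynomial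

variable {n k : ℕ} {A : Fin k → Finset (Fin n → ℤ)}

/-- The point `x` is a zero of the equations with index in `I` and with coefficients `v`; the
`i`-th equation is divided by the monomial with exponent `o i`. -/
def IsZeroOn (o : ∀ i, {a // a ∈ A i}) (I : Finset (Fin k)) (v : Terms A → ℂ)
    (x : Fin n → ℂˣ) : Prop :=
  ∀ i ∈ I, ∑ a, v ⟨i, a⟩ * (monomialChar x (a.1 - (o i).1) : ℂ) = 0

/-- **Generic consistent systems.** For an essential subcollection `J` there is a hypersurface
`P = 0` in the space of coefficients which does not contain any component of the closure of the
set of consistent systems, such that outside this hypersurface the zeros of the equations with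
index in `J` of any system in the closure lie in a single coset of the annihilator of the
difference group, through a zero `t`, and the remaining equations, translated by the points
`t * ζ j`, are generic. -/
theorem exists_generic_polynomial (o : ∀ i, {a // a ∈ A i}) {J : Finset (Fin k)} {c : ℕ}
    (hmin : ∀ I : Finset (Fin k),
      I.card ≤ Module.finrank ℝ (realSpan (differenceGroup A I)) + c)
    (hJ : J.card = Module.finrank ℝ (realSpan (differenceGroup A J)) + c)
    (hess : ∀ I, I ⊂ J → I.card < Module.finrank ℝ (realSpan (differenceGroup A I)) + c)
    {N : ℕ} (ζ : Fin N → Fin n → ℂˣ)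
    {Q : MvPolynomial {γ : Terms A // γ.1 ∉ J} ℂ} (hQ : Q ≠ 0) :
    ∃ P : MvPolynomial (Terms A) ℂ,
      (∀ (p : MvPolynomial (Terms A) ℂ) (v : Terms A → ℂ) (x : Fin n → ℂˣ),
        IsZeroOn o Finset.univ v x → p.eval v ≠ 0 →
        ∃ v' x', IsZeroOn o Finset.univ v' x' ∧ p.eval v' ≠ 0 ∧ P.eval v' ≠ 0) ∧
      ∀ v : Terms A → ℂ, (∀ p : MvPolynomial (Terms A) ℂ,
          (∀ v' x, IsZeroOn o Finset.univ v' x → p.eval v' = 0) → p.eval v = 0) →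
        P.eval v ≠ 0 →
        ∃ t : Fin n → ℂˣ, IsZeroOn o J v t ∧
          (∀ x, IsZeroOn o J v x → x / t ∈ annihilator (differenceGroup A J)) ∧
          ∀ j, Q.eval (fun γ => v γ.1 * (monomialChar (t * ζ j) γ.1.2.1 : ℂ)) ≠ 0 := by
  classical
  obtain ⟨r, ⟨S⟩⟩ := exists_smith (differenceGroup A J)
  obtain ⟨K, β, hK, hβ⟩ := exists_independent_exponents o hmin hJ
  rw [finrank_realSpan S] at hJ
  let e := relativeExponent S o
  have heo : ∀ i, e i (o i) = 0 := fun i => by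
    ext l
    simp [e, relativeExponent]
  have hquot : ∀ {v : Terms A → ℂ} {x : Fin n → ℂˣ}, IsZeroOn o J v x →
      ∀ i ∈ J, ∑ a, v ⟨i, a⟩ * (monomialChar (quotientPoint S x) (e i a) : ℂ) = 0 := by
    intro v x h i hi
    rw [← h i hi]
    exact Finset.sum_congr rfl fun a _ => by rw [monomialChar_quotientPoint S o hi]
  have hsec : ∀ (z : Fin r → ℂˣ) {i} (_ : i ∈ J) (a : {a // a ∈ A i}),
      monomialChar z (e i a) = monomialChar (sectionPoint S z) (a.1 - (o i).1) := by
    intro z i hi a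
    conv_lhs => rw [← quotientPoint_sectionPoint S z, monomialChar_quotientPoint S o hi]
  -- the free coefficients
  let C := {γ : Terms A // γ.2 = o γ.1 → γ.1 ∈ K}
  -- Exactly c base coefficients are excluded, and |J| = r + c.
  have hC : Fintype.card C + J.card = Fintype.card (Terms A) + r := by
    have h1 : Fintype.card {γ : Terms A // ¬ (γ.2 = o γ.1 → γ.1 ∈ K)} = (graphOver Kᶜ o).card := by
      rw [Fintype.card_subtype]
      congr 1
      ext γ
      simp only [Finset.mem_filter, Finset.mem_univ, true_and, mem_graphOver, Finset.mem_compl,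
        Classical.not_imp]
      exact and_comm
    have h2 := Fintype.card_subtype_compl (fun γ : Terms A => γ.2 = o γ.1 → γ.1 ∈ K)
    have h3 := Fintype.card_subtype_le (fun γ : Terms A => γ.2 = o γ.1 → γ.1 ∈ K)
    have h4 := Finset.card_add_card_compl K
    rw [card_graphOver] at h1
    rw [Fintype.card_fin] at h4
    have h5 : Fintype.card C =
      Fintype.card {γ : Terms A // γ.2 = o γ.1 → γ.1 ∈ K} := rfl
    omega
  obtain ⟨P₁, hP₁, huniq⟩ := exists_polynomial_unique_zero (J := J) (o := o) (e := e)
    (fun i _ => heo i) (fun I hI => by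
      rw [finrank_exponentGroup S o hI.1]
      have := hess I hI
      omega) (fun γ : C => γ.1) hC
  -- the parametrization of the systems whose equations with index in `J` are consistent
  let σ := ((graphOver J o)ᶜ : Finset (Terms A))
  have hσ : Fintype.card σ + J.card = Fintype.card (Terms A) := by
    rw [Fintype.card_coe, ← Finset.card_compl_add_card (graphOver J o), card_graphOver]
  have hmem : ∀ {γ : Terms A}, γ ∈ σ ↔ ¬ (γ.1 ∈ J ∧ γ.2 = o γ.1) := by
    intro γ
    rw [Finset.mem_compl, mem_graphOver]
  let H : (σ → ℂ) × (Fin r → ℂˣ) → Terms A → ℂ := fun x γ => if h : γ ∈ σ then x.1 ⟨γ, h⟩ else 0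
  have hH : ∀ γ, (fun x => H x γ) ∈ LaurentRing σ (Fin r) := by
    intro γ
    simp only [H]
    split_ifs
    · exact coord_mem_laurentFunctions _
    · exact const_mem_laurentFunctions 0
  have hH0 : ∀ x, ∀ i ∈ J, H x ⟨i, o i⟩ = 0 := fun x i hi =>
    dif_neg fun h => hmem.1 h ⟨hi, rfl⟩
  have hZ : ∀ a, (fun x : (σ → ℂ) × (Fin r → ℂˣ) => (monomialChar x.2 a : ℂ)) ∈
      LaurentRing σ (Fin r) := fun a =>
    monomialChar_mem_laurentFunctions (fun l => unit_mem_laurentFunctions _)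
      (fun l => unit_inv_mem_laurentFunctions _) a
  let s : Terms A → LaurentRing σ (Fin r) := fun γ =>
    ⟨fun x => complete J o e (H x) x.2 γ, complete_mem_laurentFunctions J o e hH hZ γ⟩
  have hs : ∀ v x, IsZeroOn o J v x → ∃ y, (∀ γ, (s γ).1 y = v γ) := by
    intro v x hx
    refine ⟨(fun γ => v γ, quotientPoint S x), fun γ => congrFun (complete_eq (fun i _ => heo i)
      (hH0 _) (fun γ hγ => ?_) (hquot hx)) γ⟩
    simp only [H]
    rw [dif_pos (hmem.2 hγ)]
  have hs' : ∀ y, IsZeroOn o J (fun γ => (s γ).1 y) (sectionPoint S y.2) := by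
    intro y i hi
    have := sum_complete (z := y.2) (fun i _ => heo i) (hH0 y) hi
    rw [← this]
    exact Finset.sum_congr rfl fun a _ => by rw [hsec _ hi]
  have hrel : ∀ (p : MvPolynomial (Terms A) ℂ) {v x}, IsZeroOn o J v x →
      MvPolynomial.aeval s p = 0 → p.eval v = 0 := by
    intro p v x hx hp
    obtain ⟨y, hy⟩ := hs v x hx
    have := congrFun (congrArg Subtype.val hp) y
    rw [aeval_laurentRing_apply] at this
    rwa [funext hy] at this
  have hmono : ∀ {v x}, IsZeroOn o Finset.univ v x → IsZeroOn o J v x :=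
    fun h i _ => h i (Finset.mem_univ i)
  have hdom : ∀ {P : MvPolynomial C ℂ}, P ≠ 0 → ∃ v x, IsZeroOn o Finset.univ v x ∧
      P.eval (fun γ => v γ.1) ≠ 0 := by
    intro P hP
    obtain ⟨v, x, hx, hv⟩ := exists_consistent_eval_ne_zero
      (e := fun i (a : {a // a ∈ A i}) => a.1 - (o i).1) (fun i => sub_self _) hβ hP
    exact ⟨v, x, fun i _ => hx i, hv⟩
  -- A relation would hold at all consistent systems, contradicting their density in the free
  -- coefficients.
  have hind : AlgebraicIndependent ℂ (s ∘ fun γ : C => γ.1) := by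
    rw [algebraicIndependent_iff]
    intro p hp
    by_contra h
    obtain ⟨v, x, hx, hv⟩ := hdom h
    refine hv ?_
    have := hrel (MvPolynomial.rename (fun γ : C => γ.1) p) (hmono hx)
      (by rw [MvPolynomial.aeval_rename]; exact hp)
    rwa [MvPolynomial.eval_rename] at this
  have hcard : Fintype.card C = Fintype.card σ + Fintype.card (Fin r) := by
    rw [Fintype.card_fin]
    omega
  -- the genericity of the remaining equations
  have hsect : ∀ (w : Fin n → ℂˣ) a, (fun x : (σ → ℂ) × (Fin r → ℂˣ) =>
      (monomialChar (sectionPoint S x.2 * w) a : ℂ)) ∈ LaurentRing σ (Fin r) := by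
    intro w a
    simp only [monomialChar_mul, Units.val_mul, sectionPoint, monomialChar_basisPoint]
    refine mul_mem ?_ (const_mem_laurentFunctions _)
    refine monomialChar_mem_laurentFunctions (fun l => ?_) (fun l => ?_) _
    all_goals split_ifs
    · exact unit_mem_laurentFunctions _
    · exact const_mem_laurentFunctions _
    · exact unit_inv_mem_laurentFunctions _
    · exact const_mem_laurentFunctions _
  let F : Fin N → LaurentRing σ (Fin r) := fun j =>
    ⟨fun x => Q.eval fun γ => (s γ.1).1 x * (monomialChar (sectionPoint S x.2 * ζ j) γ.1.2.1 : ℂ),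
      eval_mem_laurentFunctions Q fun γ => mul_mem (s γ.1).2 (hsect _ _)⟩
  -- Coefficients outside J are free coordinates: at z = 1, dividing them by the monomials of `ζ j`
  -- gives Q any prescribed argument.
  have hF : ∀ j, F j ≠ 0 := by
    intro j h0
    refine hQ (MvPolynomial.funext fun w => ?_)
    rw [map_zero]
    have := congrFun (congrArg Subtype.val h0) (fun γ => if h : γ.1.1 ∉ J then
      w ⟨γ.1, h⟩ / (monomialChar (ζ j) γ.1.2.1 : ℂ) else 0, 1)
    refine Eq.trans ?_ this
    simp only [F]
    congr 2
    ext γ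
    have hγ : γ.1 ∈ σ := hmem.2 fun h => γ.2 h.1
    simp only [s, complete, H]
    rw [if_neg fun h => γ.2 h.1, dif_pos hγ, dif_pos γ.2, sectionPoint_one, one_mul,
      div_mul_cancel₀ _ (Units.ne_zero _)]
  have := isDomain_laurentRing (σ := σ) (τ := Fin r)
  obtain ⟨P₂, hP₂, hex⟩ := exists_point_of_generic s (fun γ : C => γ.1) hind hcard
    (F := ∏ j, F j) (Finset.prod_ne_zero_iff.2 fun j _ => hF j)
  refine ⟨MvPolynomial.rename (fun γ : C => γ.1) (P₁ * P₂), fun p v x hx hp => ?_,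
    fun v hv hP => ?_⟩
  -- A polynomial p that is not a relation divides a non-zero polynomial P' in the free
  -- coefficients. A consistent system at which P' P₁ P₂ does not vanish is then as required.
  · have hp0 : MvPolynomial.aeval s p ≠ 0 := fun h => hp (hrel p (hmono hx) h)
    obtain ⟨P', hP', hdvd⟩ := exists_dvd_aeval hind hcard hp0
    obtain ⟨v', x', hx', hv'⟩ := hdom (mul_ne_zero hP' (mul_ne_zero hP₁ hP₂))
    rw [map_mul] at hv'
    refine ⟨v', x', hx', fun h => left_ne_zero_of_mul hv' ?_, ?_⟩
    · obtain ⟨y, hy⟩ := hs v' x' (hmono hx')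
      obtain ⟨b, hb⟩ := hdvd
      have h1 := congrFun (congrArg Subtype.val hb) y
      rw [aeval_laurentRing_apply] at h1
      simp only [Function.comp_apply, hy] at h1
      rw [h1]
      change (MvPolynomial.aeval s p).1 y * b.1 y = 0
      rw [aeval_laurentRing_apply, funext hy, h, zero_mul]
    · rw [MvPolynomial.eval_rename]
      exact right_ne_zero_of_mul hv'
  · rw [MvPolynomial.eval_rename, map_mul] at hP
    obtain ⟨y, hy, hFy⟩ := hex v (fun p hp => hv p fun v' x hx => hrel p (hmono hx) hp)
      (right_ne_zero_of_mul hP)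
    have ht : IsZeroOn o J v (sectionPoint S y.2) := by
      have := hs' y
      rwa [funext hy] at this
    refine ⟨sectionPoint S y.2, ht, fun x hx => ?_, fun j => ?_⟩
    · refine mem_annihilator_differenceGroup o fun i hi a => ?_
      have := huniq v (left_ne_zero_of_mul hP) _ _ (hquot ht) (hquot hx) i hi a
      rw [monomialChar_quotientPoint S o hi, monomialChar_quotientPoint S o hi] at this
      rw [monomialChar_div, this, div_self']
    · have h1 : (∏ j, (F j).1 y) ≠ 0 := by
        convert! hFy
        simp
      have h2 := Finset.prod_ne_zero_iff.1 h1 j (Finset.mem_univ j)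
      simp only [F, hy] at h2
      exact h2

end GenericPolynomial

/-! ### Zariski open sets of vector spaces -/

section Zariski

variable {V : Type*} [AddCommGroup V] [Module ℂ V]

theorem isTopologicalBasis_zariski (V : Type*) [AddCommGroup V] [Module ℂ V] :
    @TopologicalSpace.IsTopologicalBasis V (zariski V)
      {D | ∃ p : MvPolynomial (Module.Dual ℂ V) ℂ, D = {v | p.eval (fun l => l v) ≠ 0}} := by
  let := zariski V
  refine ⟨?_, ?_, rfl⟩
  · rintro _ ⟨p, rfl⟩ _ ⟨q, rfl⟩ x hx
    refine ⟨_, ⟨p * q, rfl⟩, ?_, fun y hy => ?_⟩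
    · simpa using hx
    · simpa using hy
  · refine Set.eq_univ_of_forall fun x => ⟨_, ⟨1, rfl⟩, ?_⟩
    simp

theorem isOpen_eval_ne_zero {Γ : Type*} (φ : V →ₗ[ℂ] Γ → ℂ) (P : MvPolynomial Γ ℂ) :
    IsOpen[zariski V] {v | P.eval (φ v) ≠ 0} := by
  refine TopologicalSpace.isOpen_generateFrom_of_mem
    ⟨MvPolynomial.rename (fun γ => LinearMap.proj γ ∘ₗ φ) P, ?_⟩
  simp only [MvPolynomial.eval_rename]
  rfl

theorem exists_polynomial_pullback {Γ : Type*} [Fintype Γ] (φ : (Γ → ℂ) →ₗ[ℂ] V)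
    (p : MvPolynomial (Module.Dual ℂ V) ℂ) :
    ∃ P : MvPolynomial Γ ℂ, ∀ v, P.eval v = p.eval fun l => l (φ v) := by
  classical
  let f : Module.Dual ℂ V → MvPolynomial Γ ℂ := fun l =>
    ∑ γ, MvPolynomial.C (l (φ (Pi.single γ 1))) * MvPolynomial.X γ
  have hf : ∀ l v, (f l).eval v = l (φ v) := by
    intro l v
    conv_rhs => rw [pi_eq_sum_univ' v, map_sum, map_sum]
    rw [map_sum]
    refine Finset.sum_congr rfl fun γ _ => ?_
    rw [map_smul, map_smul, map_mul, MvPolynomial.eval_C, MvPolynomial.eval_X, smul_eq_mul,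
      mul_comm]
  refine ⟨MvPolynomial.aeval f p, fun v => ?_⟩
  induction p using MvPolynomial.induction_on with
  | C a => simp
  | add p q hp hq => simp only [map_add, hp, hq]
  | mul_X p l hp => simp only [map_mul, hp, MvPolynomial.aeval_X, MvPolynomial.eval_X, hf]

end Zariski

/-! ### Systems and their coefficients -/

section Coefficients

variable {ι M : Type*} [AddCommGroup M] {κ : ι → Type*} [∀ i, Fintype (κ i)] {B : ι → Set M}
  (e : ∀ i, κ i → M) (he : ∀ i, Set.range (e i) = B i)

/-- The system whose `i`-th equation is the sum of the monomials with exponents `e i a` and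
coefficients `v ⟨i, a⟩`. -/
def systemOf : ((Σ i, κ i) → ℂ) →ₗ[ℂ] Systems B :=
  LinearMap.pi fun i => LinearMap.codRestrict (laurentSpace (B i))
    (Fintype.linearCombination ℂ (fun a => AddMonoidAlgebra.single (e i a) (1 : ℂ)) ∘ₗ
      LinearMap.funLeft ℂ ℂ (Sigma.mk i)) fun v => by
        rw [LinearMap.comp_apply, Fintype.linearCombination_apply]
        refine sum_mem fun a _ => Submodule.smul_mem _ _ ?_
        rw [laurentSpace, AddMonoidAlgebra.supported_eq_span_single]
        exact Submodule.subset_span ⟨_, he i ▸ ⟨a, rfl⟩, rfl⟩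

theorem coe_systemOf (v : (Σ i, κ i) → ℂ) (i : ι) :
    (systemOf e he v i : AddMonoidAlgebra ℂ M) =
      ∑ a, AddMonoidAlgebra.single (e i a) (v ⟨i, a⟩) := by
  simp [systemOf, Fintype.linearCombination_apply]

theorem evalAt_systemOf (v : (Σ i, κ i) → ℂ) (i : ι) (y : LatticeTorus M) :
    evalAt y (systemOf e he v i : AddMonoidAlgebra ℂ M) = ∑ a, v ⟨i, a⟩ * (y (e i a) : ℂ) := by
  rw [coe_systemOf, map_sum]
  simp [evalAt]

/-- Injectivity of `e` is not required: projected exponents may collide, and surjectivity alone lets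
a non-empty open condition pull back to a non-zero polynomial. -/
theorem systemOf_surjective : Function.Surjective (systemOf e he) := by
  intro s
  have h : ∀ i, ∃ w : κ i → ℂ, Fintype.linearCombination ℂ
      (fun a => AddMonoidAlgebra.single (e i a) (1 : ℂ)) w = (s i : AddMonoidAlgebra ℂ M) := by
    intro i
    have hrange : Set.range (fun a => AddMonoidAlgebra.single (e i a) (1 : ℂ)) =
        (fun m => AddMonoidAlgebra.single m (1 : ℂ)) '' B i := by
      rw [← he i, ← Set.range_comp]
      rfl
    rw [← LinearMap.mem_range, Fintype.range_linearCombination, hrange,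
      ← AddMonoidAlgebra.supported_eq_span_single]
    exact (s i).2
  choose w hw using h
  exact ⟨fun γ => w γ.1 γ.2, funext fun i => Subtype.ext (hw i)⟩

theorem systemOf_injective (hinj : ∀ i, Function.Injective (e i)) :
    Function.Injective (systemOf e he) := by
  classical
  intro v v' h
  ext ⟨i, a⟩
  have := congrArg (fun f : AddMonoidAlgebra ℂ M => f.coeff (e i a))
    (congrArg Subtype.val (congrFun h i))
  simpa [coe_systemOf, AddMonoidAlgebra.coeff_single, Finsupp.single_apply, (hinj i).eq_iff]
    using this

end Coefficients

/-! ### The zero set of a generic consistent system -/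

section Decomposition

variable {n k : ℕ} {A : Fin k → Finset (Fin n → ℤ)} {J : Finset (Fin k)}

theorem monomialChar_subtorus (y : LatticeTorus (QuotientLattice A J)) (a : Fin n → ℤ) :
    monomialChar (subtorus A J y) a = y (QuotientAddGroup.mk' (lattice A J) a) :=
  DFunLike.congr_fun (monomialChar_of_addChar
    (y.compAddMonoidHom (QuotientAddGroup.mk' (lattice A J)))) a

theorem subtorus_mem_annihilator (y : LatticeTorus (QuotientLattice A J)) :
    subtorus A J y ∈ annihilator (lattice A J) := by
  intro g hg
  rw [monomialChar_subtorus, QuotientAddGroup.mk'_apply, (QuotientAddGroup.eq_zero_iff g).2 hg,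
    AddChar.map_zero_eq_one]

theorem exists_subtorus_eq {x : Fin n → ℂˣ} (hx : x ∈ annihilator (lattice A J)) :
    ∃ y, subtorus A J y = x := by
  refine ⟨AddChar.toAddMonoidHomEquiv.symm (QuotientAddGroup.lift (lattice A J)
    (monomialChar x).toAddMonoidHom fun g hg => ?_), ?_⟩
  · exact congrArg Additive.ofMul (hx g hg)
  · ext l
    exact congrArg Units.val (monomialChar_single x l)

/-- The system with supports `A i` and given coefficients. -/
abbrev systemOfTerms (A : Fin k → Finset (Fin n → ℤ)) :
    (Terms A → ℂ) →ₗ[ℂ] Systems fun i => (A i : Set (Fin n → ℤ)) :=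
  systemOf (κ := fun i => {a // a ∈ A i}) (fun _ a => a.1) fun _ => Subtype.range_coe

/-- The coefficients of a system with supports `A i`. -/
def termEquiv (A : Fin k → Finset (Fin n → ℤ)) :
    (Terms A → ℂ) ≃ₗ[ℂ] Systems fun i => (A i : Set (Fin n → ℤ)) :=
  LinearEquiv.ofBijective (systemOfTerms A)
    ⟨systemOf_injective _ _ fun _ => Subtype.val_injective, systemOf_surjective _ _⟩

theorem evalLaurent_termEquiv (v : Terms A → ℂ) (i : Fin k) (x : Fin n → ℂˣ) :
    evalLaurent x (termEquiv A v i : AddMonoidAlgebra ℂ (Fin n → ℤ)) =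
      ∑ a, v ⟨i, a⟩ * (monomialChar x a.1 : ℂ) :=
  evalAt_systemOf (κ := fun i => {a // a ∈ A i}) (fun _ a => a.1) (fun _ => Subtype.range_coe) v i _

theorem evalLaurent_termEquiv_eq_zero_iff (o : ∀ i, {a // a ∈ A i}) (v : Terms A → ℂ) (i : Fin k)
    (x : Fin n → ℂˣ) : evalLaurent x (termEquiv A v i : AddMonoidAlgebra ℂ (Fin n → ℤ)) = 0 ↔
      ∑ a, v ⟨i, a⟩ * (monomialChar x (a.1 - (o i).1) : ℂ) = 0 := by
  have : ∑ a, v ⟨i, a⟩ * (monomialChar x a.1 : ℂ) =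
      monomialChar x (o i).1 * ∑ a, v ⟨i, a⟩ * (monomialChar x (a.1 - (o i).1) : ℂ) := by
    rw [Finset.mul_sum]
    refine Finset.sum_congr rfl fun a _ => ?_
    rw [mul_left_comm, ← Units.val_mul, ← AddChar.map_add_eq_mul, add_sub_cancel]
  rw [evalLaurent_termEquiv, this, mul_eq_zero, or_iff_right (Units.ne_zero _)]

theorem mem_zeroSet_termEquiv (o : ∀ i, {a // a ∈ A i}) (v : Terms A → ℂ) (x : Fin n → ℂˣ) :
    x ∈ zeroSet (termEquiv A v) ↔ IsZeroOn o Finset.univ v x :=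
  ⟨fun h i _ => (evalLaurent_termEquiv_eq_zero_iff o v i x).1 (h i),
    fun h i => (evalLaurent_termEquiv_eq_zero_iff o v i x).2 (h i (Finset.mem_univ i))⟩

theorem isClosed_zeroSet (s : Systems fun i => (A i : Set (Fin n → ℤ))) :
    IsClosed[zariskiTorus n] (zeroSet s) := by
  let := zariskiTorus n
  have : zeroSet s = ⋂ i, {x | evalLaurent x (s i : AddMonoidAlgebra ℂ (Fin n → ℤ)) = 0} := by
    ext x
    simp [zeroSet]
  rw [this]
  exact isClosed_iInter fun i =>
    isClosed_eq_zero_torus ((mem_torusFunctions_iff _).2 ⟨_, fun _ => rfl⟩)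

/-- The restrictions of the equations with index not in `J` and with coefficients `v` to the coset
of the subtorus through `t`. -/
def restrictedSystem (A : Fin k → Finset (Fin n → ℤ)) (J : Finset (Fin k)) :
    ((Σ i : {i : Fin k // i ∉ J}, {a // a ∈ A i.1}) → ℂ) →ₗ[ℂ] Systems (projectedSupport A J) :=
  systemOf (κ := fun i : {i : Fin k // i ∉ J} => {a // a ∈ A i.1})
    (fun _ a => QuotientAddGroup.mk' (lattice A J) a.1) fun i => by
      rw [projectedSupport, Set.image_eq_range]
      rfl

theorem evalAt_restrictedSystem (v : Terms A → ℂ) (t : Fin n → ℂˣ) (i : {i : Fin k // i ∉ J})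
    (y : LatticeTorus (QuotientLattice A J)) :
    evalAt y (restrictedSystem A J (fun γ => v ⟨γ.1.1, γ.2⟩ * (monomialChar t γ.2.1 : ℂ)) i :
        AddMonoidAlgebra ℂ (QuotientLattice A J)) =
      evalLaurent (t * subtorus A J y) (termEquiv A v i : AddMonoidAlgebra ℂ (Fin n → ℤ)) := by
  rw [restrictedSystem, evalAt_systemOf, evalLaurent_termEquiv]
  refine Finset.sum_congr rfl fun a _ => ?_
  rw [monomialChar_mul, monomialChar_subtorus, Units.val_mul, mul_assoc]

theorem exists_generic_decomposition (A : Fin k → Finset (Fin n → ℤ)) (hA : ∀ i, (A i).Nonempty)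
    (J : Finset (Fin k)) (hJ : IsEssential (geomDefect A hA) J)
    (W : Set (Systems (projectedSupport A J))) (hW : IsOpen[zariski _] W) (hW' : W.Nonempty) :
    ∃ U : Set (Systems fun i => (A i : Set (Fin n → ℤ))),
      IsOpen[zariski _] U ∧
      consistencyVariety A ⊆ closure[zariski _] (consistencyVariety A ∩ U) ∧
      ∀ s ∈ consistencyVariety A ∩ U,
        ∃ Y : Fin (latticeIndex A J) → Set (Fin n → ℂˣ),
          zeroSet s = ⋃ j, Y j ∧
          (∀ j j', j ≠ j' → Disjoint (Y j) (Y j')) ∧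
          ∀ j, IsClosed[zariskiTorus n] (Y j) ∧
            ∃ (t : Fin n → ℂˣ) (g : Systems (projectedSupport A J)),
              g ∈ W ∧
              (∀ (i : {i : Fin k // i ∉ J}) (y : LatticeTorus (QuotientLattice A J)),
                evalAt y (g i : AddMonoidAlgebra ℂ (QuotientLattice A J)) =
                  evalLaurent (t * subtorus A J y)
                    (s i : AddMonoidAlgebra ℂ (Fin n → ℤ))) ∧
              Y j = (fun y => t * subtorus A J y) '' latticeZeroSet g := by
  classical
  let := zariski (Systems fun i => (A i : Set (Fin n → ℤ)))
  let := zariski (Systems (projectedSupport A J))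
  -- the numerical conditions
  have hdef : ∀ I, geomDefect A hA I =
      Module.finrank ℝ (realSpan (differenceGroup A I)) - I.card := fun I => by
    rw [geomDefect, tau_eq]
  have hempty : Module.finrank ℝ (realSpan (differenceGroup A (∅ : Finset (Fin k)))) = 0 := by
    rw [← iSup_parallelSpace]
    simp
  -- Here -c is the minimal defect; comparison with the empty collection, of defect 0, gives c ≥ 0.
  obtain ⟨c, hc⟩ : ∃ c, J.card = Module.finrank ℝ (realSpan (differenceGroup A J)) + c := by
    refine Nat.exists_eq_add_of_le ?_
    have := hJ.1 ∅
    rw [hdef, hdef, hempty, Finset.card_empty] at this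
    omega
  have hmin : ∀ I : Finset (Fin k),
      I.card ≤ Module.finrank ℝ (realSpan (differenceGroup A I)) + c := by
    intro I
    have := hJ.1 I
    rw [hdef, hdef] at this
    omega
  have hess : ∀ I, I ⊂ J → I.card < Module.finrank ℝ (realSpan (differenceGroup A I)) + c := by
    intro I hI
    have := hJ.2 I hI
    rw [hdef, hdef] at this
    omega
  let o : ∀ i, {a // a ∈ A i} := fun i => ⟨(hA i).choose, (hA i).choose_spec⟩
  have hcosets := exists_annihilator_cosets (differenceGroup A J)
  rw [← lattice_eq_saturation A J hA] at hcosets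
  obtain ⟨ζ, hζ, huniq⟩ := hcosets
  have hGL : differenceGroup A J ≤ lattice A J := by
    rw [lattice_eq_saturation A J hA]
    exact le_saturation _
  -- the genericity condition on the restricted systems
  obtain ⟨g₀, hg₀⟩ := hW'
  obtain ⟨_, ⟨q, rfl⟩, hq, hqW⟩ :=
    (isTopologicalBasis_zariski (Systems (projectedSupport A J))).exists_subset_of_mem_open hg₀ hW
  obtain ⟨Q, hQ⟩ := exists_polynomial_pullback (restrictedSystem A J) q
  have hQ0 : Q ≠ 0 := by
    rintro rfl
    obtain ⟨w, hw⟩ : ∃ w, restrictedSystem A J w = g₀ := systemOf_surjective _ _ g₀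
    refine hq ?_
    rw [← hw, ← hQ, map_zero]
  let ι : (Σ i : {i : Fin k // i ∉ J}, {a // a ∈ A i.1}) → {γ : Terms A // γ.1 ∉ J} :=
    fun γ => ⟨⟨γ.1.1, γ.2⟩, γ.1.2⟩
  have hι : Function.Injective ι := by
    rintro ⟨⟨i, hi⟩, a⟩ ⟨⟨i', hi'⟩, a'⟩ h
    obtain ⟨rfl, h⟩ := Sigma.mk.inj (congrArg Subtype.val h)
    obtain rfl := eq_of_heq h
    rfl
  obtain ⟨P, hdense, hP⟩ := exists_generic_polynomial o hmin hc hess ζ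
    (Q := MvPolynomial.rename ι Q)
    fun h => hQ0 (MvPolynomial.rename_injective ι hι (h.trans (map_zero _).symm))
  have hsub : {s : Systems fun i => (A i : Set (Fin n → ℤ)) | (zeroSet s).Nonempty} ⊆
      consistencyVariety A := subset_closure
  refine ⟨{s | P.eval ((termEquiv A).symm s) ≠ 0},
    isOpen_eval_ne_zero (termEquiv A).symm.toLinearMap P,
    closure_minimal (fun s hs => ?_) isClosed_closure, ?_⟩
  · rw [(isTopologicalBasis_zariski _).mem_closure_iff]
    rintro _ ⟨p, rfl⟩ hp
    obtain ⟨x, hx⟩ := hs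
    obtain ⟨v, rfl⟩ := (termEquiv A).surjective s
    obtain ⟨p', hp'⟩ := exists_polynomial_pullback (termEquiv A).toLinearMap p
    obtain ⟨v', x', hx', hv', hPv'⟩ := hdense p' v x ((mem_zeroSet_termEquiv o v x).1 hx)
      (by rw [hp']; exact hp)
    rw [hp'] at hv'
    refine ⟨termEquiv A v', hv', hsub ⟨x', (mem_zeroSet_termEquiv o v' x').2 hx'⟩, ?_⟩
    change P.eval ((termEquiv A).symm (termEquiv A v')) ≠ 0
    rwa [LinearEquiv.symm_apply_apply]
  rintro s ⟨hsR, hsU⟩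
  obtain ⟨v, rfl⟩ := (termEquiv A).surjective s
  change P.eval ((termEquiv A).symm (termEquiv A v)) ≠ 0 at hsU
  rw [LinearEquiv.symm_apply_apply] at hsU
  -- A polynomial vanishing at all consistent systems vanishes on their closure R.
  obtain ⟨t, ht, hcoset, hQt⟩ := hP v (fun p hp => by
    have hclosed : IsClosed {s | p.eval ((termEquiv A).symm s) = 0} :=
      ⟨isOpen_eval_ne_zero (termEquiv A).symm.toLinearMap p⟩
    have := closure_minimal (fun s hs => ?_) hclosed hsR
    · change p.eval ((termEquiv A).symm (termEquiv A v)) = 0 at this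
      rwa [LinearEquiv.symm_apply_apply] at this
    · obtain ⟨x, hx⟩ := hs
      obtain ⟨w, rfl⟩ := (termEquiv A).surjective s
      change p.eval ((termEquiv A).symm (termEquiv A w)) = 0
      rw [LinearEquiv.symm_apply_apply]
      exact hp w x ((mem_zeroSet_termEquiv o w x).1 hx)) hsU
  have hcoset' : ∀ x ∈ zeroSet (termEquiv A v), x / t ∈ annihilator (differenceGroup A J) :=
    fun x hx => hcoset x fun i _ => (mem_zeroSet_termEquiv o v x).1 hx i (Finset.mem_univ i)
  -- Each piece is the part of the zero set in one of the cosets of T_J that make up the coset of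
  -- the annihilator of G_J through t.
  refine ⟨fun j => {x | x / (t * ζ j) ∈ annihilator (lattice A J)} ∩ zeroSet (termEquiv A v),
    ?_, fun j j' hj => ?_, fun j => ⟨?_, t * ζ j, restrictedSystem A J
      (fun γ => v ⟨γ.1.1, γ.2⟩ * (monomialChar (t * ζ j) γ.2.1 : ℂ)), hqW ?_,
      evalAt_restrictedSystem v (t * ζ j), ?_⟩⟩
  · ext x
    simp only [Set.mem_iUnion, Set.mem_inter_iff, Set.mem_ofPred_eq, ← div_div]
    refine ⟨fun hx => ?_, fun ⟨_, _, hx⟩ => hx⟩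
    obtain ⟨j, hj, -⟩ := huniq _ (hcoset' x hx)
    exact ⟨j, hj, hx⟩
  · refine Set.disjoint_left.2 fun x hx hx' => hj ?_
    simp only [Set.mem_inter_iff, Set.mem_ofPred_eq, ← div_div] at hx hx'
    exact (huniq _ (hcoset' x hx.2)).unique hx.1 hx'.1
  · let := zariskiTorus n
    exact (isClosed_coset _ _).inter (isClosed_zeroSet _)
  · have := hQt j
    rw [MvPolynomial.eval_rename] at this
    change q.eval _ ≠ 0
    rw [← hQ]
    exact this
  · ext x
    constructor
    · rintro ⟨hx, hx0⟩
      obtain ⟨y, hy⟩ := exists_subtorus_eq hx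
      have hxy : t * ζ j * subtorus A J y = x := by rw [hy, mul_div_cancel]
      refine ⟨y, fun i => ?_, hxy⟩
      rw [evalAt_restrictedSystem, hxy]
      exact hx0 i
    · rintro ⟨y, hy, rfl⟩
      refine ⟨?_, fun i => ?_⟩
      · simpa using subtorus_mem_annihilator y
      -- The equations in J hold on the whole coset, since `ζ j` and the subtorus are annihilated by
      -- the exponent differences.
      · by_cases hi : i ∈ J
        · rw [evalLaurent_termEquiv_eq_zero_iff o, ← ht i hi]
          refine Finset.sum_congr rfl fun a _ => ?_
          have ha := sub_mem_differenceGroup A J hi a.2 (o i).2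
          rw [monomialChar_mul, monomialChar_mul, hζ j _ ha,
            subtorus_mem_annihilator y _ (hGL ha), mul_one, mul_one]
        · have := hy ⟨i, hi⟩
          rwa [evalAt_restrictedSystem] at this

end Decomposition

end ToricSystems

end

/-! ### The theorem -/

theorem mainTheorem6 (n k : ℕ) (A : Fin k → Finset (Fin n → ℤ)) (hA : ∀ i, (A i).Nonempty)
    (J : Finset (Fin k)) (hJ : IsEssential (geomDefect A hA) J) :
    -- (i) the images of the Kodaira maps have finite dimension, and the two defects agree
    (∀ I : Finset (Fin k),
      kodairaDim A hA I = (tau A hA I : WithBot ℕ∞) ∧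
      geomDefect A hA I =
        linDefect (fun i => parallelSpace (A i : Set (Fin n → ℤ))) I) ∧
    -- (ii) the index is finite, and every fibre of the Kodaira map has this number of components
    (latticeIndex A J ≠ 0 ∧ ind A hA J = latticeIndex A J ∧
      ∀ x : Fin n → ℂˣ,
        numComponents (zariskiTorus n) (kodairaFiber A hA J x) = latticeIndex A J) ∧
    -- (iii) for every generic class `W` of systems with the projected supports, the zero set of a
    -- generic consistent system is a disjoint union of `ind(J)` zero sets of members of `W`
    (∀ W : Set (Systems (projectedSupport A J)), IsOpen[zariski _] W → W.Nonempty →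
      ∃ U : Set (Systems fun i => (A i : Set (Fin n → ℤ))),
        IsOpen[zariski _] U ∧
        consistencyVariety A ⊆ closure[zariski _] (consistencyVariety A ∩ U) ∧
        ∀ s ∈ consistencyVariety A ∩ U,
          ∃ Y : Fin (ind A hA J) → Set (Fin n → ℂˣ),
            zeroSet s = ⋃ j, Y j ∧
            (∀ j j', j ≠ j' → Disjoint (Y j) (Y j')) ∧
            ∀ j, IsClosed[zariskiTorus n] (Y j) ∧
              ∃ (t : Fin n → ℂˣ) (g : Systems (projectedSupport A J)),
                g ∈ W ∧
                (∀ (i : {i : Fin k // i ∉ J}) (y : LatticeTorus (QuotientLattice A J)),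
                  evalAt y (g i : AddMonoidAlgebra ℂ (QuotientLattice A J)) =
                    evalLaurent (t * subtorus A J y)
                      (s i : AddMonoidAlgebra ℂ (Fin n → ℤ))) ∧
                Y j = (fun y => t * subtorus A J y) '' latticeZeroSet g) := by
  have hind : ∀ x, numComponents (zariskiTorus n) (kodairaFiber A hA J x) = latticeIndex A J :=
    numComponents_kodairaFiber A hA J
  refine ⟨fun I => ⟨kodairaDim_eq_tau A hA I, geomDefect_eq_linDefect A hA I⟩,
    ⟨?_, hind 1, hind⟩, fun W hW hW' => ?_⟩
  · rw [latticeIndex, lattice_eq_saturation A J hA]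
    exact relIndex_saturation_ne_zero _
  · rw [show ind A hA J = latticeIndex A J from hind 1]
    exact exists_generic_decomposition A hA J hJ W hW hW'
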